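/- For a finite point set $P\subset[0,1)^2$ (points counted with multiplicity) let \[ D_2(P)=\left(\int_{[0,1]^2}\bigl(B(x,y)-|P|\,xy\bigr)^2\,\mathrm{d}x\,\mathrm{d}y\right)^{1/2}, \] where $B(x,y)$ is the number of points of $P$ in $[0,x)\times[0,y)$ and $|P|$ is the number of points of $P$. For $\alpha\in\mathbb{R}$ and an integer $N\ge 1$ let \[ L(\alpha,N)=\left\{\left(\{n\alpha\},\tfrac nN\right):0\le n\le N-1\right\},\qquad S(\alpha,N)=\left\{\left(\{\pm n\alpha\},\tfrac nN\right):0\le n\le N-1\right\}, \] where $\{\cdot\}$ is the fractional part, and $L(\alpha,N)$ has $N$ and $S(\alpha,N)$ has $2N$ points, counted with multiplicity. Theorem 1. Let $\alpha=[a_0;a_1,a_2,\dots]$ be irrational, with convergents $p_K/q_K=[a_0;a_1,\dots,a_K]$ in lowest terms. Below, $f\ll g$ means that there is a constant $C$, which may depend on $\alpha$, such that $|f|\le C|g|$ for all sufficiently large values of the variable ($N$ or $K$). The following three conditions are equivalent: (i) $D_2(S(\alpha,N))\ll\sqrt{\log N}$ as $N\to\infty$; (ii) $D_2(S(\alpha,q_K))\ll\sqrt{\log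 q_K}$ as $K\to\infty$; (iii) $\frac1K\sum_{k=1}^K a_k^2\ll 1$ as $K\to\infty$. Moreover, $D_2(L(\alpha,q_K))\ll\sqrt{\log q_K}$ as $K\to\infty$ if and only if both $\frac1K\sum_{k=1}^K a_k^2\ll 1$ and $\frac1{\sqrt K}\left|\sum_{k=1}^K(-1)^k a_k\right|\ll 1$ as $K\to\infty$. -/

import Mathlib

open Filter Asymptotics MeasureTheory

namespace LatticeDiscrepancy

open Classical in
/-- `B(x, y)`: the number of points of `P`, counted with multiplicity, in `[0, x) × [0, y)`. -/
noncomputable def boxCount (P : Multiset (ℝ × ℝ)) (x y : ℝ) : ℕ :=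
  P.countP (fun p => p ∈ Set.Ico 0 x ×ˢ Set.Ico 0 y)

/-- The `L²` discrepancy `D₂(P)` of a finite point set (with multiplicities) in the unit square. -/
noncomputable def D₂ (P : Multiset (ℝ × ℝ)) : ℝ :=
  Real.sqrt (∫ z in Set.Icc (0 : ℝ) 1 ×ˢ Set.Icc (0 : ℝ) 1,
    ((boxCount P z.1 z.2 : ℝ) - (Multiset.card P : ℝ) * z.1 * z.2) ^ 2)

/-- The `N`-element lattice point set `L(α, N) = {({nα}, n / N) : 0 ≤ n ≤ N - 1}`. -/
noncomputable def L (α : ℝ) (N : ℕ) : Multiset (ℝ × ℝ) :=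
  (Multiset.range N).map (fun n => (Int.fract ((n : ℝ) * α), (n : ℝ) / (N : ℝ)))

/-- The `2N`-element symmetrization `S(α, N) = {({±nα}, n / N) : 0 ≤ n ≤ N - 1}`; coinciding
points (such as the two copies of the origin coming from `n = 0`) are counted with
multiplicity. -/
noncomputable def S (α : ℝ) (N : ℕ) : Multiset (ℝ × ℝ) :=
  (Multiset.range N).map (fun n => (Int.fract ((n : ℝ) * α), (n : ℝ) / (N : ℝ))) +
    (Multiset.range N).map (fun n => (Int.fract (-((n : ℝ) * α)), (n : ℝ) / (N : ℝ)))

/-- The partial quotient `a_k` of `α = [a₀; a₁, a₂, …]`. The default value `0` only occurs when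
the expansion terminates, hence never for irrational `α`. -/
noncomputable def partialQuotient (α : ℝ) : ℕ → ℝ
  | 0 => (GenContFract.of α).h
  | k + 1 => ((GenContFract.of α).partDens.get? k).getD 0

/-- The denominator `q_K` of the `K`-th convergent `p_K / q_K = [a₀; a₁, …, a_K]` of `α`, as a
natural number (see `cast_convergentDen`). -/
noncomputable def convergentDen (α : ℝ) (K : ℕ) : ℕ :=
  ⌊(GenContFract.of α).dens K⌋₊

/-- The floor in `convergentDen` changes nothing: the denominators are natural numbers. -/
theorem cast_convergentDen (α : ℝ) (K : ℕ) :
    (convergentDen α K : ℝ) = (GenContFract.of α).dens K := by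
  have key : ∀ n, (∃ z : ℤ, ((GenContFract.of α).contsAux n).b = z) ∧
      ∃ z : ℤ, ((GenContFract.of α).contsAux (n + 1)).b = z := by
    intro n
    induction n with
    | zero => exact ⟨⟨0, by simp [GenContFract.contsAux]⟩, ⟨1, by simp [GenContFract.contsAux]⟩⟩
    | succ n ih =>
      obtain ⟨⟨u, hu⟩, ⟨v, hv⟩⟩ := ih
      refine ⟨⟨v, hv⟩, ?_⟩
      rcases hs : (GenContFract.of α).s.get? n with _ | gp
      · exact ⟨v, by rw [GenContFract.contsAux, hs]; exact hv⟩
      · obtain ⟨ha, w, hw⟩ := GenContFract.of_partNum_eq_one_and_exists_int_partDen_eq hs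
        refine ⟨w * v + u, ?_⟩
        rw [GenContFract.contsAux, hs]
        simp [GenContFract.nextConts, GenContFract.nextDen, ha, hw, hu, hv]
  obtain ⟨z, hz⟩ := (key K).2
  have hden : (GenContFract.of α).dens K = z := hz
  have hnn : (0 : ℝ) ≤ (GenContFract.of α).dens K := GenContFract.zero_le_of_den
  rw [hden] at hnn
  lift z to ℕ using (by exact_mod_cast hnn)
  rw [convergentDen, hden]
  simp

end LatticeDiscrepancy

/-! Write `‖x‖` for the distance to the nearest integer and `e(x) = exp(2πix)`. The points of `L α
N` below height `y` are the first `⌈N y⌉` ones, so up to a bounded error `D₂ ^ 2` is the average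
over `1 ≤ M ≤ N` of the squared `L²` norm of the one-dimensional local discrepancy of the first `M`
multiples of `α` (`D₂_sq_comparison`). By Parseval (`hasSum_local_discrepancy`) that norm is the
square of a constant term plus `1 / (2π²)` times the sum over `h ≥ 1` of `|∑_{n<M} e(nhα)|² / h²`.

The nonconstant part has the order of `∑ a_k²`. Above, the exponential sum is at most `1 / (2‖hα‖)`,
and for `h < q_k` the points `hα` are `1 / (2 q_k)`-separated modulo 1, so the frequencies in
`[q_{k-1}, q_k)` contribute at most a constant times `(q_k / q_{k-1})²`, which is of order `a_k²`
(`exists_sum_main_range_le`). Below, the single frequency `h = q_k` already contributes a constant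
times `a_{k+1}²` on average over `M ≤ q_K` (`sum_sq_le_average`).

For `S` the constant term is trivial because `{x} + {-x} = 1`. For `L` it is `∑_{n<M} ({nα} - 1/2)`.
When `N = q_K`, replacing `α` by `p_K / q_K` changes this sum by a bounded amount. Its mean over `M`
is then minus the Dedekind sum `s(p_K, q_K)` up to a bounded error (`average_centredSawSum`), and by
reciprocity `12 s(p_K, q_K) = -∑ (-1)^k a_k + O(1)`. Its variance is computed by Fourier analysis on
`ℤ / q_K` and is again bounded by a multiple of `∑ a_k²` (`sum_sq_centredSawSum_le`).

It remains to compare `log q_K` with `K`. Always `K ≪ log q_K ≤ ∑ a_k`. Hence `∑ a_k² ≪ log q_K`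
forces `∑ a_k² ≪ ∑ a_k`, and then `∑ a_k² ≪ K`. -/

namespace LatticeDiscrepancy

/-! ### Continued fractions and the separation of multiples. -/

/-- The arithmetic data of an infinite simple continued fraction expansion of `α`: partial
quotients `a (k + 1)`, convergents `p k / q k`, which lie alternately below and above `α`. -/
structure ContFracData (α : ℝ) (a q : ℕ → ℕ) (p : ℕ → ℤ) : Prop where
  one_le_a : ∀ k, 1 ≤ a (k + 1)
  q_zero : q 0 = 1
  q_one : q 1 = a 1
  q_rec : ∀ k, q (k + 2) = a (k + 2) * q (k + 1) + q k
  p_one : p 1 = a 1 * p 0 + 1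
  p_rec : ∀ k, p (k + 2) = a (k + 2) * p (k + 1) + p k
  sign : ∀ k, 0 < (-1 : ℝ) ^ k * (q k * α - p k)

theorem exists_int_eq_nums (α : ℝ) (K : ℕ) : ∃ z : ℤ, (GenContFract.of α).nums K = z := by
  have key : ∀ n, (∃ z : ℤ, ((GenContFract.of α).contsAux n).a = z) ∧
      ∃ z : ℤ, ((GenContFract.of α).contsAux (n + 1)).a = z := by
    intro n
    induction n with
    | zero =>
      exact ⟨⟨1, by simp [GenContFract.contsAux]⟩,
        ⟨⌊α⌋, by simp [GenContFract.contsAux, GenContFract.of_h_eq_floor]⟩⟩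
    | succ n ih =>
      obtain ⟨⟨u, hu⟩, ⟨v, hv⟩⟩ := ih
      refine ⟨⟨v, hv⟩, ?_⟩
      rcases hs : (GenContFract.of α).s.get? n with _ | gp
      · exact ⟨v, by rw [GenContFract.contsAux, hs]; exact hv⟩
      · obtain ⟨ha, w, hw⟩ := GenContFract.of_partNum_eq_one_and_exists_int_partDen_eq hs
        refine ⟨w * v + u, ?_⟩
        rw [GenContFract.contsAux, hs]
        simp [GenContFract.nextConts, GenContFract.nextNum, ha, hw, hu, hv]
  exact (key K).2

theorem not_terminatedAt_of_irrational {α : ℝ} (hα : Irrational α) (n : ℕ) :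
    ¬ (GenContFract.of α).TerminatedAt n := by
  intro h
  have : (GenContFract.of α).Terminates := ⟨n, h⟩
  rw [GenContFract.terminates_iff_rat] at this
  obtain ⟨r, hr⟩ := this
  exact hα ⟨r, hr.symm⟩

theorem exists_get?_eq_some {α : ℝ} (hα : Irrational α) (n : ℕ) :
    ∃ b : ℕ, 1 ≤ b ∧ (GenContFract.of α).s.get? n = some ⟨1, b⟩ := by
  have h := not_terminatedAt_of_irrational hα n
  rcases hs : (GenContFract.of α).s.get? n with _ | gp
  · exact absurd hs h
  · obtain ⟨h1, w, hw⟩ := GenContFract.of_partNum_eq_one_and_exists_int_partDen_eq hs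
    have hb : (1 : ℝ) ≤ gp.b := GenContFract.of_one_le_get?_partDen
      (GenContFract.partDen_eq_s_b hs)
    rw [hw] at hb
    have hb' : 1 ≤ w := by exact_mod_cast hb
    lift w to ℕ using by omega
    refine ⟨w, by exact_mod_cast hb', ?_⟩
    obtain ⟨x, y⟩ := gp
    simp only at h1 hw
    simp [h1, hw]

theorem exists_contFracData {α : ℝ} (hα : Irrational α) :
    ∃ (a : ℕ → ℕ) (p : ℕ → ℤ), ContFracData α a (convergentDen α) p ∧
      ∀ k, partialQuotient α (k + 1) = a (k + 1) := by
  choose b hb1 hb using exists_get?_eq_some hα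
  choose p hp using exists_int_eq_nums α
  have hq := cast_convergentDen α
  have hden0 : ∀ k, (0 : ℝ) < (GenContFract.of α).dens k := by
    intro k
    have := GenContFract.succ_nth_fib_le_of_nth_den (v := α) (n := k)
      (Or.inr (not_terminatedAt_of_irrational hα _))
    have h2 : 0 < Nat.fib (k + 1) := Nat.fib_pos.2 (by omega)
    have h3 : (0 : ℝ) < Nat.fib (k + 1) := by exact_mod_cast h2
    linarith
  -- The stream holds the partial quotient of index `k + 1` at position `k`. The value `a 0` is
  -- arbitrary: no field of `ContFracData` mentions it.
  refine ⟨fun k => b (k - 1), p, ⟨fun k => hb1 k, ?_, ?_, ?_, ?_, ?_, ?_⟩, ?_⟩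
  · have : (convergentDen α 0 : ℝ) = 1 := by rw [hq]; simp
    exact_mod_cast this
  · have : (convergentDen α 1 : ℝ) = b 0 := by
      rw [hq, GenContFract.first_den_eq (hb 0)]
    simpa using (by exact_mod_cast this : convergentDen α 1 = b 0)
  · intro k
    have := GenContFract.dens_recurrence (hb (k + 1)) rfl rfl
    rw [← hq, ← hq, ← hq] at this
    simp only [one_mul] at this
    simpa using (by exact_mod_cast this :
      convergentDen α (k + 2) = b (k + 1) * convergentDen α (k + 1) + convergentDen α k)
  · have := GenContFract.first_num_eq (hb 0)
    rw [hp] at this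
    have h0 := hp 0
    simp only [GenContFract.zeroth_num_eq_h] at h0
    rw [h0] at this
    simp only at this
    simpa using (by exact_mod_cast this : p 1 = b 0 * p 0 + 1)
  · intro k
    have := GenContFract.nums_recurrence (hb (k + 1)) rfl rfl
    rw [hp, hp, hp] at this
    simp only [one_mul] at this
    simpa using (by exact_mod_cast this : p (k + 2) = b (k + 1) * p (k + 1) + p k)
  · intro k
    have hk := not_terminatedAt_of_irrational hα k
    rw [GenContFract.of_terminatedAt_n_iff_succ_nth_intFractPair_stream_eq_none] at hk
    obtain ⟨ifp', h'⟩ := Option.ne_none_iff_exists'.1 hk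
    obtain ⟨ifp, h1, h2, -⟩ := GenContFract.IntFractPair.succ_nth_stream_eq_some_iff.1 h'
    have hs := GenContFract.sub_convs_eq h1
    simp only [if_neg h2] at hs
    have hB : 0 < ((GenContFract.of α).contsAux (k + 1)).b := hden0 k
    have hpB : 0 ≤ ((GenContFract.of α).contsAux k).b := GenContFract.zero_le_of_contsAux_b
    have hfr : 0 < ifp.fr := lt_of_le_of_ne
      (GenContFract.IntFractPair.nth_stream_fr_nonneg h1) (Ne.symm h2)
    have hd : 0 < (GenContFract.of α).dens k := hden0 k
    have e : (-1 : ℝ) ^ k * (convergentDen α k * α - p k) =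
        (GenContFract.of α).dens k * ((-1) ^ k * (α - (GenContFract.of α).convs k)) := by
      rw [GenContFract.conv_eq_num_div_den, hp, hq]
      field_simp
    rw [e, hs]
    refine mul_pos hd ?_
    rw [← mul_div_assoc, ← mul_pow]
    simp only [mul_neg, mul_one, neg_neg, one_pow]
    positivity
  · intro k
    have := GenContFract.partDen_eq_s_b (hb k)
    simp [partialQuotient, this]

/-- The multiples `h * β` with `0 < |h| < Q` stay at distance at least `1 / (2 * Q)` from `ℤ`. -/
def WellSeparated (β : ℝ) (Q : ℕ) : Prop :=
  ∀ h : ℤ, h ≠ 0 → |h| < Q → ∀ m : ℤ, 1 ≤ 2 * (Q : ℝ) * |h * β - m|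

namespace ContFracData

variable {α : ℝ} {a q : ℕ → ℕ} {p : ℕ → ℤ}

theorem q_pos (d : ContFracData α a q p) (k : ℕ) : 0 < q k := by
  induction k using Nat.twoStepInduction with
  | zero => simp [d.q_zero]
  | one => rw [d.q_one]; exact d.one_le_a 0
  | more k ih _ => rw [d.q_rec]; omega

theorem q_add_le (d : ContFracData α a q p) (k : ℕ) : q (k + 1) + q k ≤ q (k + 2) := by
  rw [d.q_rec]
  have : q (k + 1) ≤ a (k + 2) * q (k + 1) :=
    Nat.le_mul_of_pos_left (q (k + 1)) (d.one_le_a (k + 1))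
  omega

theorem q_mono (d : ContFracData α a q p) : Monotone q := by
  refine monotone_nat_of_le_succ fun k => ?_
  cases k with
  | zero => rw [d.q_zero]; exact d.q_pos 1
  | succ k => exact le_trans (Nat.le_add_right _ _) (d.q_add_le k)

theorem self_le_q (d : ContFracData α a q p) (k : ℕ) : k ≤ q k := by
  induction k with
  | zero => omega
  | succ k ih =>
    cases k with
    | zero => exact d.q_pos 1
    | succ k =>
      have h1 : q (k + 1) + q k ≤ q (k + 1 + 1) := d.q_add_le k
      have h2 := d.q_pos k
      omega

theorem q_succ_le (d : ContFracData α a q p) (k : ℕ) : q (k + 1) ≤ (a (k + 1) + 1) * q k := by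
  cases k with
  | zero => simp [d.q_zero, d.q_one]
  | succ k =>
    rw [d.q_rec]
    have := d.q_mono (Nat.le_succ k)
    simp only [Nat.succ_eq_add_one] at this
    nlinarith

theorem det (d : ContFracData α a q p) (k : ℕ) :
    p (k + 1) * q k - p k * q (k + 1) = (-1) ^ k := by
  induction k with
  | zero => rw [d.p_one, d.q_one, d.q_zero]; push_cast; ring
  | succ k ih =>
    rw [d.p_rec, d.q_rec, pow_succ, ← ih]
    push_cast
    ring

/-- The denominators at least double every two steps. -/
theorem mul_log_two_le (d : ContFracData α a q p) (K : ℕ) :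
    (K : ℝ) * Real.log 2 ≤ 2 * Real.log (q K) + Real.log 2 := by
  have h2 : 0 < Real.log 2 := Real.log_pos (by norm_num)
  have hq : ∀ k, 0 ≤ Real.log (q k) := fun k =>
    Real.log_nonneg (by exact_mod_cast d.q_pos k)
  induction K using Nat.twoStepInduction with
  | zero => have := hq 0; push_cast; linarith
  | one => have := hq 1; push_cast; linarith
  | more k ih _ =>
    have h1 : 2 * q k ≤ q (k + 2) := by
      have := d.q_add_le k
      have := d.q_mono (Nat.le_succ k)
      simp only [Nat.succ_eq_add_one] at this
      omega
    have h3 : (0 : ℝ) < q k := by exact_mod_cast d.q_pos k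
    have h4 : Real.log (2 * q k) ≤ Real.log (q (k + 2)) :=
      Real.log_le_log (by positivity) (by exact_mod_cast h1)
    rw [Real.log_mul (by norm_num) h3.ne'] at h4
    push_cast
    linarith

/-- Multiply `q (k + 1) ≤ (a (k + 1) + 1) * q k` over `k` and use `log (1 + a) ≤ a`. -/
theorem log_q_le (d : ContFracData α a q p) (K : ℕ) :
    Real.log (q K) ≤ ∑ k ∈ Finset.Icc 1 K, (a k : ℝ) := by
  induction K with
  | zero => simp [d.q_zero]
  | succ K ih =>
    rw [Finset.sum_Icc_succ_top (by omega)]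
    have h3 : (0 : ℝ) < q K := by exact_mod_cast d.q_pos K
    have h3' : (0 : ℝ) < q (K + 1) := by exact_mod_cast d.q_pos (K + 1)
    have h1 : (q (K + 1) : ℝ) ≤ ((a (K + 1) : ℝ) + 1) * q K := by exact_mod_cast d.q_succ_le K
    have h4 := Real.log_le_log h3' h1
    rw [Real.log_mul (by positivity) h3.ne'] at h4
    have h5 := Real.log_le_sub_one_of_pos (show (0 : ℝ) < (a (K + 1) : ℝ) + 1 by positivity)
    linarith

/-- Expand `(h, m)` as `x (q_k, p_k) + y (q_{k+1}, p_{k+1})` in this unimodular basis. Since `0 <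
|h| < q_{k+1}`, `x` is nonzero and `y` is zero or of opposite sign. The errors `q_k β - p_k` and
`q_{k+1} β - p_{k+1}` alternate in sign, so the two contributions to `hβ - m` add up and it is at
least `d0` in absolute value. Finally `q_{k+1} d0 + q_k d1 = 1` with `d1 ≤ d0` bounds `d0` below.
Stating this for a general `β` covers both `α` and its later convergents. -/
theorem wellSeparated_of_alternating (d : ContFracData α a q p) {β : ℝ} {k : ℕ}
    (h1 : 0 ≤ (-1) ^ (k + 1) * (q (k + 1) * β - p (k + 1)))
    (h2 : (-1) ^ (k + 1) * (q (k + 1) * β - p (k + 1)) ≤ (-1) ^ k * (q k * β - p k)) :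
    WellSeparated β (q (k + 1)) := by
  intro h h0 hlt m
  set σ : ℤ := (-1) ^ k with hσ
  have hσ2 : σ * σ = 1 := by rw [hσ, ← pow_add, ← two_mul]; simp
  have hdet := d.det k
  rw [← hσ] at hdet
  have hσR : ((-1 : ℝ)) ^ k = (σ : ℝ) := by simp [hσ]
  have hσR' : ((-1 : ℝ)) ^ (k + 1) = -(σ : ℝ) := by rw [pow_succ, hσR]; ring
  rw [hσR'] at h1
  rw [hσR, hσR'] at h2
  have hσ2R : (σ : ℝ) * σ = 1 := by exact_mod_cast hσ2
  have hdetR : (p (k + 1) : ℝ) * q k - p k * q (k + 1) = σ := by exact_mod_cast hdet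
  obtain ⟨x, hx⟩ : ∃ x, x = σ * (h * p (k + 1) - m * q (k + 1)) := ⟨_, rfl⟩
  obtain ⟨y, hy⟩ : ∃ y, y = σ * (m * q k - h * p k) := ⟨_, rfl⟩
  set d0 := (σ : ℝ) * (q k * β - p k) with hd0
  set d1 := -(σ : ℝ) * (q (k + 1) * β - p (k + 1)) with hd1
  have hxy : x * q k + y * q (k + 1) = h := by
    rw [hx, hy]; linear_combination (σ * h) * hdet + h * hσ2
  have hxm : x * p k + y * p (k + 1) = m := by
    rw [hx, hy]; linear_combination (σ * m) * hdet + m * hσ2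
  have hxyR : (x : ℝ) * q k + y * q (k + 1) = h := by exact_mod_cast hxy
  have hxmR : (x : ℝ) * p k + y * p (k + 1) = m := by exact_mod_cast hxm
  have key : (h : ℝ) * β - m = σ * (x * d0 - y * d1) := by
    rw [← hxyR, ← hxmR, hd0, hd1]
    linear_combination (-(x * (q k * β - p k) + y * (q (k + 1) * β - p (k + 1)))) * hσ2R
  have hsum : q (k + 1) * d0 + q k * d1 = 1 := by
    rw [hd0, hd1]
    linear_combination σ * hdetR + hσ2R
  have hq0 := d.q_pos k
  have hq1 := d.q_pos (k + 1)
  have hqq : (q k : ℝ) ≤ q (k + 1) := by exact_mod_cast d.q_mono (Nat.le_succ k)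
  have hq0R : (0 : ℝ) < q k := by exact_mod_cast hq0
  have hd0n : 0 ≤ d0 := h1.trans h2
  have hd0' : 1 ≤ 2 * (q (k + 1) : ℝ) * d0 := by nlinarith
  have habsσ : |(σ : ℝ)| = 1 := by rw [← hσR]; simp
  rw [key, abs_mul, habsσ, one_mul]
  refine hd0'.trans (mul_le_mul_of_nonneg_left ?_ (by positivity))
  rw [abs_lt] at hlt
  rcases lt_trichotomy x 0 with hx0 | hx0 | hx0
  · have hy0 : 0 ≤ y := by
      by_contra hy0
      push Not at hy0
      nlinarith
    have hxR : (x : ℝ) ≤ -1 := by exact_mod_cast (show x ≤ -1 by omega)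
    have hyR : (0 : ℝ) ≤ y := by exact_mod_cast hy0
    refine le_trans ?_ (neg_le_abs _)
    nlinarith
  · exfalso
    rw [hx0, zero_mul, zero_add] at hxy
    rcases lt_trichotomy y 0 with hy0 | hy0 | hy0
    · nlinarith
    · rw [hy0, zero_mul] at hxy; exact h0 hxy.symm
    · nlinarith
  · have hy0 : y ≤ 0 := by
      by_contra hy0
      push Not at hy0
      nlinarith
    have hxR : (1 : ℝ) ≤ x := by exact_mod_cast hx0
    have hyR : (y : ℝ) ≤ 0 := by exact_mod_cast hy0
    refine le_trans ?_ (le_abs_self _)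
    nlinarith

theorem wellSeparated (d : ContFracData α a q p) (k : ℕ) : WellSeparated α (q (k + 1)) := by
  refine d.wellSeparated_of_alternating (d.sign (k + 1)).le ?_
  have h := d.sign (k + 2)
  have h1 := d.sign (k + 1)
  have ha : (1 : ℝ) ≤ a (k + 2) := by exact_mod_cast d.one_le_a (k + 1)
  have e : (-1 : ℝ) ^ (k + 2) * (q (k + 2) * α - p (k + 2)) =
      (-1) ^ k * (q k * α - p k) -
        a (k + 2) * ((-1) ^ (k + 1) * (q (k + 1) * α - p (k + 1))) := by
    rw [d.q_rec, d.p_rec]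
    push_cast
    ring
  nlinarith

theorem wellSeparated_convergent (d : ContFracData α a q p) {k K : ℕ} (hk : k + 1 ≤ K) :
    WellSeparated ((p K : ℝ) / q K) (q (k + 1)) := by
  -- After multiplication by `q K` the errors are integers. Downward induction on `k`, starting at
  -- `k + 1 = K` where the two errors are `0` and `1`.
  have key : ∀ i k, k + 1 + i = K →
      0 ≤ (-1 : ℤ) ^ (k + 1) * (q (k + 1) * p K - p (k + 1) * q K) ∧
      (-1 : ℤ) ^ (k + 1) * (q (k + 1) * p K - p (k + 1) * q K) ≤
        (-1 : ℤ) ^ k * (q k * p K - p k * q K) := by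
    intro i
    induction i with
    | zero =>
      intro k hk
      obtain rfl : K = k + 1 := by omega
      have h1 : (-1 : ℤ) ^ (k + 1) * (q (k + 1) * p (k + 1) - p (k + 1) * q (k + 1)) = 0 := by
        ring
      have h2 : (-1 : ℤ) ^ k * (q k * p (k + 1) - p k * q (k + 1)) = 1 := by
        have := d.det k
        rw [mul_comm (q k : ℤ), this, ← pow_add, ← two_mul]
        simp
      rw [h1, h2]
      norm_num
    | succ i ih =>
      intro k hk
      obtain ⟨h1, h2⟩ := ih (k + 1) (by omega)
      refine ⟨h1.trans h2, ?_⟩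
      have e : (-1 : ℤ) ^ (k + 2) * (q (k + 2) * p K - p (k + 2) * q K) =
          (-1) ^ k * (q k * p K - p k * q K) -
            a (k + 2) * ((-1) ^ (k + 1) * (q (k + 1) * p K - p (k + 1) * q K)) := by
        rw [d.q_rec, d.p_rec]
        push_cast
        ring
      have ha : (1 : ℤ) ≤ a (k + 2) := by exact_mod_cast d.one_le_a (k + 1)
      rw [show k + 1 + 1 = k + 2 from rfl] at h1 h2
      have h3 := h1.trans h2
      nlinarith
  obtain ⟨i, hi⟩ := Nat.exists_eq_add_of_le hk
  obtain ⟨h1, h2⟩ := key i k hi.symm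
  have hK : (0 : ℝ) < q K := by exact_mod_cast d.q_pos K
  have e : ∀ j, (-1 : ℝ) ^ j * (q j * ((p K : ℝ) / q K) - p j) =
      (((-1 : ℤ) ^ j * (q j * p K - p j * q K) : ℤ) : ℝ) / q K := by
    intro j
    push_cast
    field_simp
  refine d.wellSeparated_of_alternating ?_ ?_
  · rw [e]
    exact div_nonneg (by exact_mod_cast h1) hK.le
  · rw [e, e]
    exact div_le_div_of_nonneg_right (by exact_mod_cast h2) hK.le

end ContFracData

/-! ### Sums over frequencies weighted by `1 / h ^ 2`. -/

/-- A summable weight on `ℤ` that dominates `1 / x ^ 2` for every real `x` with floor `b`, once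
these values are capped at `4` for `b = 0` and `b = -1`. -/
noncomputable def binWeight (b : ℤ) : ℝ :=
  4 * (((if b = 0 then 1 else 0) + (if b = -1 then 1 else 0)) +
    (1 / (b : ℝ) ^ 2 + 1 / ((b + 1 : ℤ) : ℝ) ^ 2))

theorem binWeight_nonneg (b : ℤ) : 0 ≤ binWeight b := by
  unfold binWeight
  positivity

theorem summable_binWeight : Summable binWeight := by
  have hs1 : Summable fun b : ℤ => 1 / (b : ℝ) ^ 2 := Real.summable_one_div_int_pow.2 (by norm_num)
  have hs2 : Summable ((fun b : ℤ => 1 / (b : ℝ) ^ 2) ∘ (Equiv.addRight (1 : ℤ))) :=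
    (Equiv.summable_iff _).2 hs1
  have hs3 : ∀ c : ℤ, Summable fun b : ℤ => (if b = c then (1 : ℝ) else 0) := fun c =>
    (hasSum_ite_eq c (1 : ℝ)).summable
  have h := (((hs3 0).add (hs3 (-1))).add (hs1.add hs2)).mul_left 4
  refine h.congr fun b => ?_
  simp only [binWeight, Function.comp_apply, Equiv.coe_addRight]

/-- For `⌊y⌋ = 0` or `-1` the cap is used; otherwise `|y|` is at least `|⌊y⌋|` or `|⌊y⌋ + 1|`,
according to its sign. -/
theorem le_mul_binWeight {f y : ℝ} (h0 : 0 ≤ f) {c : ℝ} (hc0 : 0 ≤ c) (h1 : f ≤ 4 * c)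
    (h2 : f * y ^ 2 ≤ 4 * c) : f ≤ c * binWeight ⌊y⌋ := by
  have hfl := Int.floor_le y
  have hfl' := Int.lt_floor_add_one y
  generalize ⌊y⌋ = b at hfl hfl'
  have hA : 0 ≤ 1 / (b : ℝ) ^ 2 := by positivity
  have hB : 0 ≤ 1 / ((b + 1 : ℤ) : ℝ) ^ 2 := by positivity
  have hC : (0 : ℝ) ≤ if b = 0 then 1 else 0 := by positivity
  have hD : (0 : ℝ) ≤ if b = -1 then 1 else 0 := by positivity
  have hkey : ∀ t : ℝ, t ≤ ((if b = 0 then (1 : ℝ) else 0) + (if b = -1 then 1 else 0)) +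
      (1 / (b : ℝ) ^ 2 + 1 / ((b + 1 : ℤ) : ℝ) ^ 2) → f ≤ c * (4 * t) →
      f ≤ c * binWeight b := fun t ht hF =>
    hF.trans (mul_le_mul_of_nonneg_left (mul_le_mul_of_nonneg_left ht (by norm_num)) hc0)
  by_cases hb0 : b = 0
  · refine hkey 1 ?_ (by linarith)
    rw [if_pos hb0]; linarith
  by_cases hb1 : b = -1
  · refine hkey 1 ?_ (by linarith)
    rw [if_pos hb1]; linarith
  rcases lt_or_gt_of_ne hb0 with hneg | hpos
  · have hc : ((b + 1 : ℤ) : ℝ) ≤ -1 := by exact_mod_cast (show b + 1 ≤ -1 by omega)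
    refine hkey (1 / ((b + 1 : ℤ) : ℝ) ^ 2) (by linarith) ?_
    have hc2 : 0 < ((b + 1 : ℤ) : ℝ) ^ 2 := by nlinarith
    rw [mul_one_div, mul_div_assoc', le_div_iff₀ hc2]
    have hlt : y ≤ ((b + 1 : ℤ) : ℝ) := by push_cast; linarith
    have : ((b + 1 : ℤ) : ℝ) ^ 2 ≤ y ^ 2 := by nlinarith
    have := mul_le_mul_of_nonneg_left this h0
    linarith
  · have hc : (1 : ℝ) ≤ (b : ℝ) := by exact_mod_cast hpos
    refine hkey (1 / (b : ℝ) ^ 2) (by linarith) ?_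
    have hc2 : 0 < (b : ℝ) ^ 2 := by nlinarith
    rw [mul_one_div, mul_div_assoc', le_div_iff₀ hc2]
    have : (b : ℝ) ^ 2 ≤ y ^ 2 := by nlinarith
    have := mul_le_mul_of_nonneg_left this h0
    linarith

/-- Among `Q` consecutive `h`, separation puts the numbers `2Q (hβ - round (hβ))` in distinct unit
intervals, so the sum is dominated by `Q ^ 2` times the total of `binWeight`. -/
theorem exists_sum_block_le : ∃ C : ℝ, 0 < C ∧ ∀ (β : ℝ) (Q : ℕ) (F : ℕ → ℝ) (n : ℕ),
    WellSeparated β Q → (∀ h ∈ Finset.Ico n (n + Q), 0 ≤ F h) →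
    (∀ h ∈ Finset.Ico n (n + Q), F h ≤ 4 * (Q : ℝ) ^ 2) →
    (∀ h ∈ Finset.Ico n (n + Q), F h * (h * β - round (h * β)) ^ 2 ≤ 1) →
    ∑ h ∈ Finset.Ico n (n + Q), F h ≤ C * (Q : ℝ) ^ 2 := by
  have hnn : 0 ≤ ∑' b, binWeight b := tsum_nonneg binWeight_nonneg
  refine ⟨∑' b, binWeight b + 1, by linarith, ?_⟩
  intro β Q F n hsep hF0 hF1 hF2
  obtain ⟨b, hb⟩ : ∃ b : ℕ → ℤ, ∀ h, b h = ⌊2 * (Q : ℝ) * (h * β - round ((h : ℝ) * β))⌋ :=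
    ⟨_, fun _ => rfl⟩
  have hinj : Set.InjOn b (Finset.Ico n (n + Q)) := by
    intro h hh h' hh' hbb
    by_contra hne
    simp only [Finset.coe_Ico, Set.mem_Ico] at hh hh'
    rw [hb, hb] at hbb
    have h1 := Int.abs_sub_lt_one_of_floor_eq_floor hbb
    have h2 := hsep ((h : ℤ) - h') (by omega) (by rw [abs_lt]; omega)
      (round ((h : ℝ) * β) - round ((h' : ℝ) * β))
    rw [← mul_sub, abs_mul, abs_of_nonneg (show (0 : ℝ) ≤ 2 * (Q : ℝ) by positivity)] at h1
    have e : (h * β - round ((h : ℝ) * β)) - (h' * β - round ((h' : ℝ) * β)) =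
        (((h : ℤ) - h' : ℤ) : ℝ) * β - ((round ((h : ℝ) * β) - round ((h' : ℝ) * β) : ℤ) : ℝ) := by
      push_cast; ring
    rw [e] at h1
    linarith
  have hterm : ∀ h ∈ Finset.Ico n (n + Q), F h ≤ (Q : ℝ) ^ 2 * binWeight (b h) := by
    intro h hh
    rw [hb]
    refine le_mul_binWeight (hF0 h hh) (by positivity) (hF1 h hh) ?_
    calc F h * (2 * (Q : ℝ) * (h * β - round ((h : ℝ) * β))) ^ 2
        = 4 * (Q : ℝ) ^ 2 * (F h * (h * β - round ((h : ℝ) * β)) ^ 2) := by ring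
      _ ≤ 4 * (Q : ℝ) ^ 2 * 1 := mul_le_mul_of_nonneg_left (hF2 h hh) (by positivity)
      _ = _ := by ring
  calc ∑ h ∈ Finset.Ico n (n + Q), F h
      ≤ ∑ h ∈ Finset.Ico n (n + Q), (Q : ℝ) ^ 2 * binWeight (b h) := Finset.sum_le_sum hterm
    _ = (Q : ℝ) ^ 2 * ∑ c ∈ (Finset.Ico n (n + Q)).image b, binWeight c := by
        rw [← Finset.mul_sum, Finset.sum_image hinj]
    _ ≤ (Q : ℝ) ^ 2 * (∑' c, binWeight c + 1) := by
        refine mul_le_mul_of_nonneg_left ?_ (by positivity)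
        have := summable_binWeight.sum_le_tsum ((Finset.Ico n (n + Q)).image b)
          (fun c _ => binWeight_nonneg c)
        linarith
    _ = _ := by ring

/-- On `q_K ≤ h < q_{K+1}` replace `1 / h ^ 2` by `1 / q_K ^ 2` and apply the block bound with `Q =
q_{K+1} ≤ 2 a_{K+1} q_K`. It serves twice: with `β = α` for the series over frequencies, and with
`β` a convergent for the variance of sawtooth sums. -/
theorem exists_sum_main_range_le : ∃ C : ℝ, 0 < C ∧
    ∀ (α : ℝ) (a q : ℕ → ℕ) (p : ℕ → ℤ), ContFracData α a q p →
    ∀ (β : ℝ) (K : ℕ) (F : ℕ → ℝ), (∀ k < K, WellSeparated β (q (k + 1))) →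
    (∀ h ∈ Finset.Ico 1 (q K), 0 ≤ F h) →
    (∀ h ∈ Finset.Ico 1 (q K), F h * (h * β - round (h * β)) ^ 2 ≤ 1) →
    ∑ h ∈ Finset.Ico 1 (q K), F h / (h : ℝ) ^ 2 ≤ C * ∑ k ∈ Finset.Icc 1 K, (a k : ℝ) ^ 2 := by
  obtain ⟨C, hC, hblock⟩ := exists_sum_block_le
  refine ⟨4 * C, by positivity, ?_⟩
  intro α a q p d β K F
  induction K with
  | zero => intro _ _ _; simp [d.q_zero]
  | succ K ih =>
    intro hsep hF0 hF2
    have hmono : q K ≤ q (K + 1) := d.q_mono (Nat.le_succ K)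
    have hsub : Finset.Ico 1 (q K) ⊆ Finset.Ico 1 (q (K + 1)) :=
      Finset.Ico_subset_Ico_right hmono
    have hih := ih (fun k hk => hsep k (by omega)) (fun h hh => hF0 h (hsub hh))
      (fun h hh => hF2 h (hsub hh))
    rw [← Finset.sum_Ico_consecutive _ (d.q_pos K) hmono, Finset.sum_Icc_succ_top (by omega),
      mul_add]
    refine add_le_add hih ?_
    have hqK : (0 : ℝ) < q K := by exact_mod_cast d.q_pos K
    -- The block starts at `h = 0`, where nothing is known about `F`; there it is replaced by `0`.
    let G : ℕ → ℝ := fun h => if h = 0 then 0 else F h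
    have hmem : ∀ h ∈ Finset.Ico 0 (0 + q (K + 1)), h ≠ 0 → h ∈ Finset.Ico 1 (q (K + 1)) := by
      intro h hh h0
      simp only [Finset.mem_Ico] at hh ⊢
      omega
    have hG := hblock β (q (K + 1)) G 0 (hsep K (by omega)) ?_ ?_ ?_
    · have hratio : (q (K + 1) : ℝ) ≤ 2 * a (K + 1) * q K := by
        have h1 := d.q_succ_le K
        have h2 : (a (K + 1) + 1) * q K ≤ (2 * a (K + 1)) * q K :=
          Nat.mul_le_mul_right _ (by have := d.one_le_a K; omega)
        exact_mod_cast h1.trans h2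
      calc ∑ h ∈ Finset.Ico (q K) (q (K + 1)), F h / (h : ℝ) ^ 2
          ≤ ∑ h ∈ Finset.Ico (q K) (q (K + 1)), G h / (q K : ℝ) ^ 2 := by
            refine Finset.sum_le_sum fun h hh => ?_
            rw [Finset.mem_Ico] at hh
            have hpos := d.q_pos K
            have h1 : (q K : ℝ) ≤ h := by exact_mod_cast hh.1
            simp only [G]
            rw [if_neg (by omega)]
            have h0 := hF0 h (Finset.mem_Ico.2 ⟨by omega, hh.2⟩)
            gcongr
        _ ≤ ∑ h ∈ Finset.Ico 0 (0 + q (K + 1)), G h / (q K : ℝ) ^ 2 := by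
            refine Finset.sum_le_sum_of_subset_of_nonneg ?_ ?_
            · intro h hh
              rw [Finset.mem_Ico] at hh ⊢
              omega
            · intro h hh _
              refine div_nonneg ?_ (by positivity)
              simp only [G]
              split_ifs with h0
              · exact le_rfl
              · exact hF0 h (hmem h hh h0)
        _ ≤ C * (q (K + 1) : ℝ) ^ 2 / (q K : ℝ) ^ 2 := by
            rw [← Finset.sum_div]
            gcongr
        _ ≤ C * (2 * a (K + 1) * q K) ^ 2 / (q K : ℝ) ^ 2 := by gcongr
        _ = 4 * C * (a (K + 1) : ℝ) ^ 2 := by field_simp; ring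
    · intro h hh
      simp only [G]
      split_ifs with h0
      · exact le_rfl
      · exact hF0 h (hmem h hh h0)
    · intro h hh
      simp only [G]
      split_ifs with h0
      · positivity
      -- For `0 < h < q (K + 1)` the cap is no extra assumption: separation bounds the distance of
      -- `hβ` to `ℤ` from below.
      · have hm := hmem h hh h0
        have h1 := hF0 h hm
        have h2 := hF2 h hm
        rw [Finset.mem_Ico] at hm
        have h3 := hsep K (by omega) h (by omega) (by rw [abs_lt]; omega) (round ((h : ℝ) * β))
        rw [Int.cast_natCast] at h3
        have h4 : 1 ≤ (2 * (q (K + 1) : ℝ) * |(h : ℝ) * β - round ((h : ℝ) * β)|) ^ 2 :=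
          one_le_pow₀ h3
        rw [mul_pow, sq_abs] at h4
        calc F h ≤ F h * ((2 * (q (K + 1) : ℝ)) ^ 2 * (h * β - round ((h : ℝ) * β)) ^ 2) :=
              le_mul_of_one_le_right h1 h4
          _ = 4 * (q (K + 1) : ℝ) ^ 2 * (F h * (h * β - round ((h : ℝ) * β)) ^ 2) := by ring
          _ ≤ 4 * (q (K + 1) : ℝ) ^ 2 * 1 := by gcongr
          _ = _ := by ring
    · intro h hh
      simp only [G]
      split_ifs with h0
      · simp
      · exact hF2 h (hmem h hh h0)

/-- The block `[jQ, (j + 1)Q)` contributes at most a constant times `Q ^ 2 / (jQ) ^ 2 = 1 / j ^ 2`.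
-/
theorem exists_sum_tail_le : ∃ C : ℝ, 0 < C ∧ ∀ (β : ℝ) (Q : ℕ) (F : ℕ → ℝ) (J : ℕ), 0 < Q →
    WellSeparated β Q → (∀ h, 0 ≤ F h) → (∀ h, F h ≤ 4 * (Q : ℝ) ^ 2) →
    (∀ h : ℕ, F h * (h * β - round (h * β)) ^ 2 ≤ 1) →
    ∑ h ∈ Finset.Ico Q ((J + 1) * Q), F h / (h : ℝ) ^ 2 ≤ C := by
  obtain ⟨C, hC, hblock⟩ := exists_sum_block_le
  have hs : Summable fun j : ℕ => 1 / (j : ℝ) ^ 2 :=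
    Real.summable_one_div_nat_pow.2 (by norm_num)
  have hnn : ∀ j : ℕ, 0 ≤ 1 / (j : ℝ) ^ 2 := fun j => by positivity
  refine ⟨C * (∑' j : ℕ, 1 / (j : ℝ) ^ 2 + 1), 
    mul_pos hC (by have : 0 ≤ ∑' j : ℕ, 1 / (j : ℝ) ^ 2 := tsum_nonneg hnn
                   linarith), ?_⟩
  intro β Q F J hQ hsep hF0 hF1 hF2
  have hQR : (0 : ℝ) < Q := by exact_mod_cast hQ
  have key : ∑ h ∈ Finset.Ico Q ((J + 1) * Q), F h / (h : ℝ) ^ 2 ≤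
      C * ∑ j ∈ Finset.Icc 1 J, 1 / (j : ℝ) ^ 2 := by
    induction J with
    | zero => simp
    | succ J ih =>
      have e : (J + 1 + 1) * Q = (J + 1) * Q + Q := by ring
      rw [← Finset.sum_Ico_consecutive _ (show Q ≤ (J + 1) * Q by nlinarith)
        (show (J + 1) * Q ≤ (J + 1 + 1) * Q by nlinarith),
        Finset.sum_Icc_succ_top (by omega), mul_add]
      refine add_le_add ih ?_
      rw [e]
      calc ∑ h ∈ Finset.Ico ((J + 1) * Q) ((J + 1) * Q + Q), F h / (h : ℝ) ^ 2
          ≤ ∑ h ∈ Finset.Ico ((J + 1) * Q) ((J + 1) * Q + Q),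
              F h / (((J + 1 : ℕ) : ℝ) * Q) ^ 2 := by
            refine Finset.sum_le_sum fun h hh => ?_
            rw [Finset.mem_Ico] at hh
            have h1 : ((J + 1 : ℕ) : ℝ) * Q ≤ h := by exact_mod_cast hh.1
            have h0 := hF0 h
            gcongr
        _ ≤ C * (Q : ℝ) ^ 2 / (((J + 1 : ℕ) : ℝ) * Q) ^ 2 := by
            rw [← Finset.sum_div]
            gcongr
            exact hblock β Q F _ hsep (fun h _ => hF0 h) (fun h _ => hF1 h) (fun h _ => hF2 h)
        _ = C * (1 / ((J + 1 : ℕ) : ℝ) ^ 2) := by field_simp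
  refine key.trans (mul_le_mul_of_nonneg_left ?_ hC.le)
  have := hs.sum_le_tsum (Finset.Icc 1 J) (fun j _ => hnn j)
  linarith

/-- Frequencies below `q K` give the sum of squares, all the others only a bounded amount. The cap
`4 * q K ^ 2` will come from the number of summands `M ≤ q K`. -/
theorem exists_hasSum_le : ∃ C : ℝ, 0 < C ∧
    ∀ (α : ℝ) (a q : ℕ → ℕ) (p : ℕ → ℤ), ContFracData α a q p →
    ∀ (K : ℕ) (F : ℕ → ℝ) (s : ℝ), (∀ h, 0 ≤ F h) → (∀ h, F h ≤ 4 * (q K : ℝ) ^ 2) →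
    (∀ h : ℕ, F h * (h * α - round (h * α)) ^ 2 ≤ 1) →
    HasSum (fun h : ℕ => F h / (h : ℝ) ^ 2) s →
    s ≤ C * (∑ k ∈ Finset.Icc 1 K, (a k : ℝ) ^ 2 + 1) := by
  obtain ⟨C₁, hC₁, hmain⟩ := exists_sum_main_range_le
  obtain ⟨C₂, hC₂, htail⟩ := exists_sum_tail_le
  refine ⟨C₁ + C₂, by positivity, ?_⟩
  intro α a q p d K F s hF0 hF1 hF2 hs
  have hsep : WellSeparated α (q K) := by
    cases K with
    | zero =>
      intro h h0 h1
      rw [d.q_zero, abs_lt] at h1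
      omega
    | succ K => exact d.wellSeparated K
  have hq := d.q_pos K
  have hsum0 : 0 ≤ ∑ k ∈ Finset.Icc 1 K, (a k : ℝ) ^ 2 := Finset.sum_nonneg fun k _ => by positivity
  refine le_of_tendsto' hs.tendsto_sum_nat fun n => ?_
  have h1 := hmain α a q p d α K F (fun k _ => d.wellSeparated k) (fun h _ => hF0 h)
    (fun h _ => hF2 h)
  have h2 := htail α (q K) F n hq hsep hF0 hF1 hF2
  calc ∑ h ∈ Finset.range n, F h / (h : ℝ) ^ 2
      ≤ ∑ h ∈ Finset.range ((n + 1) * q K), F h / (h : ℝ) ^ 2 := by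
        refine Finset.sum_le_sum_of_subset_of_nonneg ?_ ?_
        · refine Finset.range_subset_range.2 ?_
          nlinarith
        · intro h _ _
          exact div_nonneg (hF0 h) (by positivity)
    _ = ∑ h ∈ Finset.Ico 1 (q K), F h / (h : ℝ) ^ 2 +
          ∑ h ∈ Finset.Ico (q K) ((n + 1) * q K), F h / (h : ℝ) ^ 2 := by
        rw [Finset.sum_Ico_consecutive _ hq (by nlinarith), Finset.range_eq_Ico,
          Finset.sum_eq_sum_Ico_succ_bot (by positivity)]
        simp
    _ ≤ (C₁ + C₂) * (∑ k ∈ Finset.Icc 1 K, (a k : ℝ) ^ 2 + 1) := by nlinarith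

/-! ### Parseval's identity for the one-dimensional local discrepancy. -/

theorem ite_lt_eq_indicator (w : ℝ) (g : ℝ → ℝ) :
    (fun x => if w < x then g x else 0) = (Set.Ioi w).indicator g := by
  ext x
  simp [Set.indicator, Set.mem_Ioi]

theorem integral_ite_lt {w : ℝ} (hw : w ∈ Set.Icc (0 : ℝ) 1) (g : ℝ → ℝ) :
    ∫ x in Set.Icc (0 : ℝ) 1, (if w < x then g x else 0) = ∫ x in w..1, g x := by
  rw [integral_Icc_eq_integral_Ioc, ite_lt_eq_indicator, setIntegral_indicator measurableSet_Ioi,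
    intervalIntegral.integral_of_le hw.2, Set.Ioc_inter_Ioi, max_eq_right hw.1]

theorem integrableOn_ite_lt (w : ℝ) {g : ℝ → ℝ} (hg : Continuous g) :
    IntegrableOn (fun x => if w < x then g x else 0) (Set.Icc (0 : ℝ) 1) := by
  rw [ite_lt_eq_indicator]
  exact (hg.continuousOn.integrableOn_compact isCompact_Icc).indicator measurableSet_Ioi

theorem step_mul_step_eq (u v : ℝ) :
    (fun x : ℝ => ((if u < x then 1 else 0) - x) * ((if v < x then 1 else 0) - x)) =
      fun x => (if max u v < x then (1 : ℝ) else 0) - (if u < x then x else 0) -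
        (if v < x then x else 0) + x ^ 2 := by
  ext x
  by_cases h1 : u < x <;> by_cases h2 : v < x <;> simp [h1, h2] <;> ring

/-- The first term is half the Bernoulli polynomial `B₂` at `|u - v|`, whose cosine series is known;
the second is the product of the two means. -/
theorem integral_step_mul_step {u v : ℝ} (hu : u ∈ Set.Icc (0 : ℝ) 1) (hv : v ∈ Set.Icc (0 : ℝ) 1) :
    ∫ x in Set.Icc (0 : ℝ) 1, ((if u < x then 1 else 0) - x) * ((if v < x then 1 else 0) - x) =
      1 / 2 * (|u - v| ^ 2 - |u - v| + 1 / 6) + (u - 1 / 2) * (v - 1 / 2) := by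
  have hm : max u v ∈ Set.Icc (0 : ℝ) 1 := ⟨le_max_of_le_left hu.1, max_le hu.2 hv.2⟩
  have i1 := integrableOn_ite_lt (max u v) (continuous_const (y := (1 : ℝ)))
  have i2 := integrableOn_ite_lt u continuous_id
  have i3 := integrableOn_ite_lt v continuous_id
  have i4 : IntegrableOn (fun x : ℝ => x ^ 2) (Set.Icc (0 : ℝ) 1) :=
    (continuous_pow 2).continuousOn.integrableOn_compact isCompact_Icc
  simp only [id] at i2 i3
  have i12 : IntegrableOn (fun x => (if max u v < x then (1 : ℝ) else 0) - (if u < x then x else 0))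
    (Set.Icc (0 : ℝ) 1) := i1.sub i2
  have i123 : IntegrableOn (fun x => (if max u v < x then (1 : ℝ) else 0) -
    (if u < x then x else 0) - (if v < x then x else 0)) (Set.Icc (0 : ℝ) 1) := i12.sub i3
  rw [step_mul_step_eq, integral_add i123 i4, integral_sub i12 i3, integral_sub i1 i2,
    integral_ite_lt hm, integral_ite_lt hu, integral_ite_lt hv, integral_Icc_eq_integral_Ioc,
    ← intervalIntegral.integral_of_le zero_le_one, intervalIntegral.integral_const, integral_id,
    integral_id, integral_pow]
  rcases le_total u v with h | h
  · rw [max_eq_right h, abs_of_nonpos (by linarith), smul_eq_mul]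
    norm_num
    ring
  · rw [max_eq_left h, abs_of_nonneg (by linarith), smul_eq_mul]
    norm_num
    ring

/-- The term `h = 0` is a division by zero and counts as `0`. -/
theorem hasSum_cos_div_sq {x : ℝ} (hx : x ∈ Set.Icc (0 : ℝ) 1) :
    HasSum (fun h : ℕ => Real.cos (2 * Real.pi * h * x) / (h : ℝ) ^ 2)
      (Real.pi ^ 2 * (x ^ 2 - x + 1 / 6)) := by
  have h := hasSum_one_div_nat_pow_mul_cos one_ne_zero hx
  convert! h using 1
  · ext n
    ring_nf
  · simp [Polynomial.bernoulli, Finset.sum_range_succ, bernoulli_one,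
      bernoulli_two, Nat.factorial]
    ring

theorem integrableOn_step_mul_step (u v : ℝ) :
    IntegrableOn (fun x : ℝ => ((if u < x then 1 else 0) - x) * ((if v < x then 1 else 0) - x))
      (Set.Icc (0 : ℝ) 1) := by
  rw [step_mul_step_eq]
  have i2 := integrableOn_ite_lt u continuous_id
  have i3 := integrableOn_ite_lt v continuous_id
  exact (((integrableOn_ite_lt (max u v) (continuous_const (y := (1 : ℝ)))).sub i2).sub i3).add
    ((continuous_pow 2).continuousOn.integrableOn_compact isCompact_Icc)

/-- Parseval's identity for the local discrepancy of finitely many points of the unit interval. -/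
theorem hasSum_local_discrepancy {ι : Type*} (s : Finset ι) (u : ι → ℝ)
    (hu : ∀ i ∈ s, u i ∈ Set.Icc (0 : ℝ) 1) :
    HasSum (fun h : ℕ => ((∑ i ∈ s, Real.cos (2 * Real.pi * h * u i)) ^ 2 +
        (∑ i ∈ s, Real.sin (2 * Real.pi * h * u i)) ^ 2) / (h : ℝ) ^ 2)
      (2 * Real.pi ^ 2 * ((∫ x in Set.Icc (0 : ℝ) 1, (∑ i ∈ s, ((if u i < x then 1 else 0) - x)) ^ 2)
        - (∑ i ∈ s, (u i - 1 / 2)) ^ 2)) := by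
  -- Both sides are quadratic in the points, so the identity is proved for each pair, where `cos A
  -- cos B + sin A sin B = cos (A - B)`, and then summed.
  have hpair : ∀ i ∈ s, ∀ j ∈ s, HasSum (fun h : ℕ => (Real.cos (2 * Real.pi * h * u i) *
      Real.cos (2 * Real.pi * h * u j) + Real.sin (2 * Real.pi * h * u i) *
      Real.sin (2 * Real.pi * h * u j)) / (h : ℝ) ^ 2)
      (2 * Real.pi ^ 2 * ((∫ x in Set.Icc (0 : ℝ) 1, ((if u i < x then 1 else 0) - x) *
        ((if u j < x then 1 else 0) - x)) - (u i - 1 / 2) * (u j - 1 / 2))) := by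
    intro i hi j hj
    have hi' := hu i hi
    have hj' := hu j hj
    rw [integral_step_mul_step hi' hj']
    have hx : |u i - u j| ∈ Set.Icc (0 : ℝ) 1 :=
      ⟨abs_nonneg _, by rw [abs_le]; constructor <;> linarith [hi'.1, hi'.2, hj'.1, hj'.2]⟩
    convert! hasSum_cos_div_sq hx using 1
    · ext h
      rw [← Real.cos_sub, ← mul_sub]
      rcases abs_choice (u i - u j) with h' | h' <;> rw [h']
      rw [mul_neg, Real.cos_neg]
    · ring
  have hsum := hasSum_sum fun i hi => hasSum_sum fun j hj => hpair i hi j hj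
  convert! hsum using 1
  · ext h
    rw [sq, sq, Finset.sum_mul_sum, Finset.sum_mul_sum, ← Finset.sum_add_distrib, Finset.sum_div]
    refine Finset.sum_congr rfl fun i _ => ?_
    rw [← Finset.sum_add_distrib, Finset.sum_div]
  · have h1 : ∫ x in Set.Icc (0 : ℝ) 1, (∑ i ∈ s, ((if u i < x then 1 else 0) - x)) ^ 2 =
        ∑ i ∈ s, ∑ j ∈ s, ∫ x in Set.Icc (0 : ℝ) 1, ((if u i < x then 1 else 0) - x) *
          ((if u j < x then 1 else 0) - x) := by
      simp_rw [sq, Finset.sum_mul_sum]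
      rw [integral_finsetSum]
      · refine Finset.sum_congr rfl fun i _ => ?_
        rw [integral_finsetSum]
        intro j _
        exact integrableOn_step_mul_step _ _
      · intro i _
        exact integrable_finsetSum _ fun j _ => integrableOn_step_mul_step _ _
    rw [h1, sq (∑ i ∈ s, (u i - 1 / 2)), Finset.sum_mul_sum, ← Finset.sum_sub_distrib,
      Finset.mul_sum]
    refine Finset.sum_congr rfl fun i _ => ?_
    rw [← Finset.sum_sub_distrib, Finset.mul_sum]

/-! ### From the planar discrepancy to averages of one-dimensional ones. -/

theorem integral_ceil_mul (f : ℕ → ℝ) {N : ℕ} (hN : 0 < N) :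
    ∫ y in Set.Icc (0 : ℝ) 1, f ⌈(N : ℝ) * y⌉₊ = 1 / (N : ℝ) * ∑ M ∈ Finset.range N, f (M + 1) := by
  have hNR : (0 : ℝ) < N := by exact_mod_cast hN
  have hle : ∀ k : ℕ, (k : ℝ) / N ≤ ((k + 1 : ℕ) : ℝ) / N := fun k => by
    push_cast; gcongr; linarith
  have heq : ∀ k : ℕ, Set.EqOn (fun y : ℝ => f ⌈(N : ℝ) * y⌉₊) (fun _ => f (k + 1))
      (Set.Ioc ((k : ℝ) / N) (((k + 1 : ℕ) : ℝ) / N)) := by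
    intro k y hy
    have : ⌈(N : ℝ) * y⌉₊ = k + 1 := by
      rw [Nat.ceil_eq_iff (by omega)]
      rw [Set.mem_Ioc, div_lt_iff₀ hNR, le_div_iff₀ hNR] at hy
      constructor
      · simpa [mul_comm] using hy.1
      · rw [mul_comm]; exact hy.2
    simp only [this]
  have hint : ∀ k < N, IntervalIntegrable (fun y : ℝ => f ⌈(N : ℝ) * y⌉₊) volume
      ((k : ℝ) / N) (((k + 1 : ℕ) : ℝ) / N) := by
    intro k _
    rw [intervalIntegrable_iff_integrableOn_Ioc_of_le (hle k)]
    exact (integrableOn_congr_fun (heq k) measurableSet_Ioc).2 (by simp)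
  have h := intervalIntegral.sum_integral_adjacent_intervals (a := fun k : ℕ => (k : ℝ) / N) hint
  rw [integral_Icc_eq_integral_Ioc, ← intervalIntegral.integral_of_le zero_le_one]
  simp only [CharP.cast_eq_zero, zero_div, div_self hNR.ne'] at h
  rw [← h, Finset.mul_sum]
  refine Finset.sum_congr rfl fun k _ => ?_
  rw [intervalIntegral.integral_of_le (hle k), setIntegral_congr_fun measurableSet_Ioc (heq k),
    setIntegral_const, smul_eq_mul, Real.volume_real_Ioc_of_le (hle k)]
  push_cast
  ring

theorem sum_range_ite_lt_mul (N : ℕ) {y : ℝ} (hy : y ∈ Set.Icc (0 : ℝ) 1) (f : ℕ → ℝ) :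
    ∑ n ∈ Finset.range N, (if (n : ℝ) < N * y then f n else 0) =
      ∑ n ∈ Finset.range ⌈(N : ℝ) * y⌉₊, f n := by
  rw [← Finset.sum_filter]
  congr 1
  ext n
  simp only [Finset.mem_filter, Finset.mem_range, Nat.lt_ceil, and_iff_right_iff_imp]
  intro h
  have h2 : (N : ℝ) * y ≤ N := mul_le_of_le_one_right (Nat.cast_nonneg _) hy.2
  exact_mod_cast h.trans_le h2

theorem measurable_sum_ite {ι : Type*} (s : Finset ι) (u : ℕ → ι → ℝ) (N : ℕ) :
    Measurable fun z : ℝ × ℝ => ∑ n ∈ Finset.range N, (if (n : ℝ) < N * z.2 then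
      ∑ i ∈ s, ((if u n i < z.1 then (1 : ℝ) else 0) - z.1) else 0) := by
  refine Finset.measurable_sum _ fun n _ => ?_
  refine Measurable.ite (measurableSet_lt measurable_const (by fun_prop)) ?_ measurable_const
  refine Finset.measurable_sum _ fun i _ => ?_
  exact (Measurable.ite (measurableSet_lt measurable_const measurable_fst) measurable_const
    measurable_const).sub measurable_fst

theorem measurable_count_sub (N : ℕ) (c : ℝ) :
    Measurable fun z : ℝ × ℝ => c * z.1 *
      ((∑ n ∈ Finset.range N, (if (n : ℝ) < N * z.2 then (1 : ℝ) else 0)) - N * z.2) := by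
  refine (measurable_fst.const_mul c).mul (Measurable.sub ?_ (by fun_prop))
  refine Finset.measurable_sum _ fun n _ => ?_
  exact Measurable.ite (measurableSet_lt measurable_const (by fun_prop)) measurable_const
    measurable_const

theorem integrableOn_unitSquare_sq {f : ℝ × ℝ → ℝ} (hf : Measurable f) {c : ℝ}
    (hb : ∀ z ∈ Set.Icc (0 : ℝ) 1 ×ˢ Set.Icc (0 : ℝ) 1, |f z| ≤ c) :
    IntegrableOn (fun z => f z ^ 2) (Set.Icc (0 : ℝ) 1 ×ˢ Set.Icc (0 : ℝ) 1) := by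
  refine Measure.integrableOn_of_bounded (M := c ^ 2)
    (isCompact_Icc.prod isCompact_Icc).measure_lt_top.ne (hf.pow_const 2).aestronglyMeasurable ?_
  refine (ae_restrict_mem (measurableSet_Icc.prod measurableSet_Icc)).mono fun z hz => ?_
  rw [Real.norm_eq_abs, abs_pow]
  have := hb z hz
  gcongr

theorem volume_real_unitSquare :
    (volume : Measure (ℝ × ℝ)).real (Set.Icc (0 : ℝ) 1 ×ˢ Set.Icc (0 : ℝ) 1) = 1 := by
  rw [Measure.volume_eq_prod, measureReal_prod_prod]
  simp

theorem setIntegral_sq_le_of_eq_add {f g b : ℝ × ℝ → ℝ} {c : ℝ}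
    (hf : IntegrableOn (fun z => f z ^ 2) (Set.Icc (0 : ℝ) 1 ×ˢ Set.Icc (0 : ℝ) 1))
    (hg : IntegrableOn (fun z => g z ^ 2) (Set.Icc (0 : ℝ) 1 ×ˢ Set.Icc (0 : ℝ) 1))
    (hfg : ∀ z ∈ Set.Icc (0 : ℝ) 1 ×ˢ Set.Icc (0 : ℝ) 1, f z = g z + b z)
    (hb : ∀ z ∈ Set.Icc (0 : ℝ) 1 ×ˢ Set.Icc (0 : ℝ) 1, |b z| ≤ c) :
    ∫ z in Set.Icc (0 : ℝ) 1 ×ˢ Set.Icc (0 : ℝ) 1, f z ^ 2 ≤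
      2 * (∫ z in Set.Icc (0 : ℝ) 1 ×ˢ Set.Icc (0 : ℝ) 1, g z ^ 2) + 2 * c ^ 2 := by
  have hK : volume (Set.Icc (0 : ℝ) 1 ×ˢ Set.Icc (0 : ℝ) 1) ≠ ⊤ :=
    (isCompact_Icc.prod isCompact_Icc).measure_lt_top.ne
  have hc : IntegrableOn (fun _ : ℝ × ℝ => 2 * c ^ 2) (Set.Icc (0 : ℝ) 1 ×ˢ Set.Icc (0 : ℝ) 1) :=
    integrableOn_const hK
  have hg2 : IntegrableOn (fun z : ℝ × ℝ => 2 * g z ^ 2)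
    (Set.Icc (0 : ℝ) 1 ×ˢ Set.Icc (0 : ℝ) 1) := hg.const_mul 2
  calc ∫ z in Set.Icc (0 : ℝ) 1 ×ˢ Set.Icc (0 : ℝ) 1, f z ^ 2
      ≤ ∫ z in Set.Icc (0 : ℝ) 1 ×ˢ Set.Icc (0 : ℝ) 1, (2 * g z ^ 2 + 2 * c ^ 2) := by
        refine setIntegral_mono_on hf (hg2.add hc) (measurableSet_Icc.prod measurableSet_Icc) ?_
        intro z hz
        rw [hfg z hz]
        have h1 := hb z hz
        have h2 : b z ^ 2 ≤ c ^ 2 := by rw [← sq_abs]; gcongr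
        nlinarith [sq_nonneg (g z - b z)]
    _ = _ := by
        rw [integral_add hg2 hc, integral_const_mul, setIntegral_const, volume_real_unitSquare,
          one_smul]

/-- Up to a bounded error, the square of the `L²` discrepancy of a point set whose points lie in
groups at the heights `n / N` is the mean square of one-dimensional local discrepancies. -/
theorem D₂_sq_comparison {ι : Type*} (s : Finset ι) (u : ℕ → ι → ℝ) {N : ℕ} (hN : 0 < N)
    (P : Multiset (ℝ × ℝ)) (hcard : Multiset.card P = N * s.card)
    (hbox : ∀ x ∈ Set.Icc (0 : ℝ) 1, ∀ y ∈ Set.Icc (0 : ℝ) 1, (boxCount P x y : ℝ) =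
      ∑ n ∈ Finset.range N, if (n : ℝ) < N * y then ∑ i ∈ s, (if u n i < x then 1 else 0) else 0) :
    D₂ P ^ 2 ≤ 2 * (1 / (N : ℝ) * ∑ M ∈ Finset.range N, ∫ x in Set.Icc (0 : ℝ) 1,
      (∑ n ∈ Finset.range (M + 1), ∑ i ∈ s, ((if u n i < x then 1 else 0) - x)) ^ 2)
        + 2 * (s.card : ℝ) ^ 2 ∧
    1 / (N : ℝ) * ∑ M ∈ Finset.range N, ∫ x in Set.Icc (0 : ℝ) 1,
      (∑ n ∈ Finset.range (M + 1), ∑ i ∈ s, ((if u n i < x then 1 else 0) - x)) ^ 2 ≤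
        2 * D₂ P ^ 2 + 2 * (s.card : ℝ) ^ 2 := by
  obtain ⟨A, hA⟩ : ∃ A : ℝ × ℝ → ℝ, A = fun z => ∑ n ∈ Finset.range N, (if (n : ℝ) < N * z.2 then
      ∑ i ∈ s, ((if u n i < z.1 then (1 : ℝ) else 0) - z.1) else 0) := ⟨_, rfl⟩
  -- `A` subtracts `x` once for each point below height `y`. What remains, `B`, is `s.card * x * (⌈N
  -- y⌉ - N y)`, hence bounded by `s.card`.
  obtain ⟨B, hB⟩ : ∃ B : ℝ × ℝ → ℝ, B = fun z => (s.card : ℝ) * z.1 *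
      ((∑ n ∈ Finset.range N, (if (n : ℝ) < N * z.2 then (1 : ℝ) else 0)) - N * z.2) := ⟨_, rfl⟩
  have hAm : Measurable A := hA ▸ measurable_sum_ite s u N
  have hBm : Measurable B := hB ▸ measurable_count_sub N s.card
  have hsplit : ∀ z ∈ Set.Icc (0 : ℝ) 1 ×ˢ Set.Icc (0 : ℝ) 1,
      (boxCount P z.1 z.2 : ℝ) - (Multiset.card P : ℝ) * z.1 * z.2 = A z + B z := by
    intro z hz
    rw [hbox z.1 hz.1 z.2 hz.2, hcard, hA, hB]
    simp only [sum_range_ite_lt_mul N hz.2, Finset.sum_sub_distrib, Finset.sum_const,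
      Finset.card_range, nsmul_eq_mul]
    push_cast
    ring
  have hBb : ∀ z ∈ Set.Icc (0 : ℝ) 1 ×ˢ Set.Icc (0 : ℝ) 1, |B z| ≤ s.card := by
    intro z hz
    have h0 : (0 : ℝ) ≤ N * z.2 := mul_nonneg (Nat.cast_nonneg _) hz.2.1
    have h1 := Nat.le_ceil ((N : ℝ) * z.2)
    have h2 := Nat.ceil_lt_add_one h0
    rw [hB]
    simp only [sum_range_ite_lt_mul N hz.2, Finset.sum_const, Finset.card_range, nsmul_eq_mul,
      mul_one]
    rw [abs_mul, abs_mul, Nat.abs_cast, abs_of_nonneg hz.1.1, abs_of_nonneg (by linarith)]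
    have h3 : z.1 * ((⌈(N : ℝ) * z.2⌉₊ : ℝ) - N * z.2) ≤ 1 :=
      mul_le_one₀ hz.1.2 (by linarith) (by linarith)
    rw [mul_assoc]
    exact mul_le_of_le_one_right (Nat.cast_nonneg _) h3
  have hAb : ∀ z ∈ Set.Icc (0 : ℝ) 1 ×ˢ Set.Icc (0 : ℝ) 1, |A z| ≤ N * s.card := by
    intro z hz
    rw [hA]
    refine (Finset.abs_sum_le_sum_abs _ _).trans ?_
    refine (Finset.sum_le_card_nsmul _ _ (s.card : ℝ) fun n _ => ?_).trans ?_
    · split_ifs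
      · refine (Finset.abs_sum_le_sum_abs _ _).trans ?_
        refine (Finset.sum_le_card_nsmul _ _ (1 : ℝ) fun i _ => ?_).trans ?_
        · have h1 := hz.1.1
          have h2 := hz.1.2
          split_ifs <;> rw [abs_le] <;> constructor <;> linarith
        · simp
      · simp
    · simp
  have hABb : ∀ z ∈ Set.Icc (0 : ℝ) 1 ×ˢ Set.Icc (0 : ℝ) 1, |A z + B z| ≤ N * s.card + s.card :=
    fun z hz => (abs_add_le _ _).trans (add_le_add (hAb z hz) (hBb z hz))
  have iA := integrableOn_unitSquare_sq hAm hAb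
  have iAB := integrableOn_unitSquare_sq (hAm.add hBm) hABb
  have hD : D₂ P ^ 2 = ∫ z in Set.Icc (0 : ℝ) 1 ×ˢ Set.Icc (0 : ℝ) 1, (A z + B z) ^ 2 := by
    rw [D₂, Real.sq_sqrt (integral_nonneg fun z => sq_nonneg _)]
    refine setIntegral_congr_fun (measurableSet_Icc.prod measurableSet_Icc) fun z hz => ?_
    simp only [hsplit z hz]
  have hE : ∫ z in Set.Icc (0 : ℝ) 1 ×ˢ Set.Icc (0 : ℝ) 1, A z ^ 2 =
      1 / (N : ℝ) * ∑ M ∈ Finset.range N, ∫ x in Set.Icc (0 : ℝ) 1,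
      (∑ n ∈ Finset.range (M + 1), ∑ i ∈ s, ((if u n i < x then 1 else 0) - x)) ^ 2 := by
    -- By Fubini: for fixed `x` the integrand depends on `y` only through `⌈N y⌉`, which takes each
    -- value `M + 1 ≤ N` on an interval of length `1 / N`.
    rw [Measure.volume_eq_prod] at iA ⊢
    rw [setIntegral_prod _ iA, Finset.mul_sum]
    simp_rw [← integral_const_mul]
    rw [← integral_finsetSum]
    · refine setIntegral_congr_fun measurableSet_Icc fun x _ => ?_
      rw [← Finset.mul_sum, ← integral_ceil_mul (fun M => (∑ n ∈ Finset.range M,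
        ∑ i ∈ s, ((if u n i < x then 1 else 0) - x)) ^ 2) hN]
      refine setIntegral_congr_fun measurableSet_Icc fun y hy => ?_
      simp only [hA, sum_range_ite_lt_mul N hy]
    · intro M _
      refine Integrable.const_mul ?_ _
      simp_rw [sq, Finset.sum_mul_sum]
      refine integrable_finsetSum _ fun n _ => integrable_finsetSum _ fun m _ =>
        integrable_finsetSum _ fun i _ => integrable_finsetSum _ fun j _ => ?_
      exact integrableOn_step_mul_step _ _
  rw [hD, ← hE]
  constructor
  · exact setIntegral_sq_le_of_eq_add iAB iA (fun z _ => rfl) hBb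
  · refine setIntegral_sq_le_of_eq_add (b := fun z => -B z) iA iAB (fun z _ => by simp) ?_
    intro z hz
    rw [abs_neg]
    exact hBb z hz

/-! ### Bounds for exponential and cosine sums. -/

theorem four_mul_sq_le_sin_sq (x : ℝ) : 4 * (x - round x) ^ 2 ≤ Real.sin (Real.pi * x) ^ 2 := by
  have hpi := Real.pi_pos
  have hx : |x - round x| ≤ 1 / 2 := abs_sub_round x
  have h1 := Real.mul_abs_le_abs_sin (x := Real.pi * (x - round x)) (by
    rw [abs_mul, abs_of_pos hpi]; nlinarith)
  have h2 : |Real.sin (Real.pi * (x - round x))| = |Real.sin (Real.pi * x)| := by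
    rw [mul_sub, mul_comm Real.pi (round x : ℝ), Real.sin_sub_int_mul_pi, abs_mul, abs_zpow]
    simp
  rw [h2, abs_mul, abs_of_pos hpi, ← mul_assoc, div_mul_cancel₀ _ hpi.ne'] at h1
  have := pow_le_pow_left₀ (by positivity) h1 2
  rw [mul_pow, sq_abs, sq_abs] at this
  linarith

theorem cos_mul_fract (h : ℕ) (x : ℝ) :
    Real.cos (2 * Real.pi * h * Int.fract x) = Real.cos (2 * Real.pi * h * x) := by
  rw [Int.fract, show 2 * Real.pi * h * (x - ⌊x⌋) =
    2 * Real.pi * h * x - ((h * ⌊x⌋ : ℤ) : ℝ) * (2 * Real.pi) by push_cast; ring,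
    Real.cos_sub_int_mul_two_pi]

theorem sin_mul_fract (h : ℕ) (x : ℝ) :
    Real.sin (2 * Real.pi * h * Int.fract x) = Real.sin (2 * Real.pi * h * x) := by
  rw [Int.fract, show 2 * Real.pi * h * (x - ⌊x⌋) =
    2 * Real.pi * h * x - ((h * ⌊x⌋ : ℤ) : ℝ) * (2 * Real.pi) by push_cast; ring,
    Real.sin_sub_int_mul_two_pi]

theorem two_mul_sin_mul_sum_cos (θ : ℝ) (M : ℕ) :
    2 * Real.sin (θ / 2) * ∑ n ∈ Finset.range M, Real.cos (n * θ) =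
      Real.sin (θ / 2) + Real.sin (M * θ - θ / 2) := by
  induction M with
  | zero => simp
  | succ M ih =>
    rw [Finset.sum_range_succ, mul_add, ih]
    have e1 : ((M + 1 : ℕ) : ℝ) * θ - θ / 2 = M * θ + θ / 2 := by push_cast; ring
    rw [e1, Real.sin_sub, Real.sin_add]
    ring

theorem two_mul_sin_mul_sum_sin (θ : ℝ) (M : ℕ) :
    2 * Real.sin (θ / 2) * ∑ n ∈ Finset.range M, Real.sin (n * θ) =
      Real.cos (θ / 2) - Real.cos (M * θ - θ / 2) := by
  induction M with
  | zero => simp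
  | succ M ih =>
    rw [Finset.sum_range_succ, mul_add, ih]
    have e1 : ((M + 1 : ℕ) : ℝ) * θ - θ / 2 = M * θ + θ / 2 := by push_cast; ring
    rw [e1, Real.cos_sub, Real.cos_add]
    ring

/-- `|∑_{n < M} e(n h α)|²`, written in real terms. -/
noncomputable def expSumSq (α : ℝ) (M h : ℕ) : ℝ :=
  (∑ n ∈ Finset.range M, Real.cos (2 * Real.pi * h * (n * α))) ^ 2 +
    (∑ n ∈ Finset.range M, Real.sin (2 * Real.pi * h * (n * α))) ^ 2

theorem expSumSq_nonneg (α : ℝ) (M h : ℕ) : 0 ≤ expSumSq α M h := by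
  unfold expSumSq
  positivity

theorem expSumSq_le_sq (α : ℝ) (M h : ℕ) : expSumSq α M h ≤ (M : ℝ) ^ 2 := by
  unfold expSumSq
  have hc := sq_sum_le_card_mul_sum_sq (s := Finset.range M)
    (f := fun n : ℕ => Real.cos (2 * Real.pi * h * (n * α)))
  have hs := sq_sum_le_card_mul_sum_sq (s := Finset.range M)
    (f := fun n : ℕ => Real.sin (2 * Real.pi * h * (n * α)))
  have e : (∑ n ∈ Finset.range M, Real.cos (2 * Real.pi * h * (n * α)) ^ 2) +
      ∑ n ∈ Finset.range M, Real.sin (2 * Real.pi * h * (n * α)) ^ 2 = M := by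
    rw [← Finset.sum_add_distrib]
    simp [Real.cos_sq_add_sin_sq]
  rw [Finset.card_range] at hc hs
  nlinarith

/-- The geometric sum satisfies `4 sin² (πhα) |∑ e(nhα)|² = |1 - e(Mhα)|² ≤ 4`, and `|sin πx| ≥
2‖x‖`. The factor `4` is kept for `S`, whose cosine sums carry a factor `2`. -/
theorem expSumSq_mul_le (α : ℝ) (M h : ℕ) :
    4 * (expSumSq α M h * (h * α - round (h * α)) ^ 2) ≤ 1 := by
  have h0 := expSumSq_nonneg α M h
  have h1 := mul_le_mul_of_nonneg_left (four_mul_sq_le_sin_sq (h * α)) h0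
  have hC := two_mul_sin_mul_sum_cos (2 * Real.pi * h * α) M
  have hS := two_mul_sin_mul_sum_sin (2 * Real.pi * h * α) M
  have e1 : ∀ n : ℕ, (n : ℝ) * (2 * Real.pi * h * α) = 2 * Real.pi * h * (n * α) := fun n => by ring
  have e2 : 2 * Real.pi * h * α / 2 = Real.pi * (h * α) := by ring
  simp_rw [e1, e2] at hC hS
  have h2 : 4 * (expSumSq α M h * Real.sin (Real.pi * (h * α)) ^ 2) ≤ 4 := by
    have e : 4 * (expSumSq α M h * Real.sin (Real.pi * (h * α)) ^ 2) =
        (2 * Real.sin (Real.pi * (h * α)) *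
          ∑ n ∈ Finset.range M, Real.cos (2 * Real.pi * h * (n * α))) ^ 2 +
        (2 * Real.sin (Real.pi * (h * α)) *
          ∑ n ∈ Finset.range M, Real.sin (2 * Real.pi * h * (n * α))) ^ 2 := by
      unfold expSumSq; ring
    rw [e, hC, hS]
    have a1 := Real.sin_sq_add_cos_sq (Real.pi * (h * α))
    have a2 := Real.sin_sq_add_cos_sq (2 * Real.pi * h * (M * α) - Real.pi * (h * α))
    have a3 := Real.neg_one_le_cos
      (Real.pi * (h * α) + (2 * Real.pi * h * (M * α) - Real.pi * (h * α)))
    rw [Real.cos_add] at a3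
    nlinarith
  linarith

/-- The quantity squared equals `sin (θ/2) + sin (Mθ + θ/2)`. After squaring and summing over `M`,
the cross terms add up to `1 - cos (Nθ) ≥ 0`. The sum of `sin² (Mθ + θ/2)` is `N/2` up to `1 / (4
sin θ)`, which is at most `N/8` because `N sin θ ≥ 2Nθ/π ≥ 2`. -/
theorem sum_sq_sin_mul_sum_cos_ge {θ : ℝ} (h0 : 0 < θ) (h1 : θ ≤ Real.pi / 2) (N : ℕ)
    (hN : Real.pi ≤ N * θ) : 3 / 8 * (N : ℝ) ≤
      ∑ M ∈ Finset.range N, (2 * Real.sin (θ / 2) *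
        ∑ n ∈ Finset.range (M + 1), Real.cos (n * θ)) ^ 2 := by
  have hpi := Real.pi_pos
  have hsin : 2 / Real.pi * θ ≤ Real.sin θ := Real.mul_le_sin h0.le h1
  have hsin0 : 0 < Real.sin θ := lt_of_lt_of_le (by positivity) hsin
  have hA : ∀ N : ℕ, 4 * Real.sin θ * ∑ M ∈ Finset.range N, Real.sin (M * θ + θ / 2) ^ 2 =
      2 * N * Real.sin θ - Real.sin (2 * (N * θ)) := by
    intro N
    induction N with
    | zero => simp
    | succ N ih =>
      rw [Finset.sum_range_succ, mul_add, ih]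
      have e1 : Real.sin (2 * (((N + 1 : ℕ) : ℝ) * θ)) = Real.sin (2 * (N * θ + θ / 2) + θ) := by
        congr 1; push_cast; ring
      have e2 : Real.sin (2 * ((N : ℝ) * θ)) = Real.sin (2 * (N * θ + θ / 2) - θ) := by
        congr 1; ring
      rw [e1, e2, Real.sin_sub (2 * (N * θ + θ / 2)), Real.sin_add (2 * (N * θ + θ / 2)),
        Real.cos_two_mul']
      have := Real.sin_sq_add_cos_sq (N * θ + θ / 2)
      generalize (N : ℝ) * θ + θ / 2 = φ at this ⊢
      push_cast
      linear_combination 2 * Real.sin θ * this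
  have hB : ∀ N : ℕ, 2 * Real.sin (θ / 2) * ∑ M ∈ Finset.range N, Real.sin (M * θ + θ / 2) =
      1 - Real.cos (N * θ) := by
    intro N
    induction N with
    | zero => simp
    | succ N ih =>
      rw [Finset.sum_range_succ, mul_add, ih]
      have e1 : Real.cos (((N + 1 : ℕ) : ℝ) * θ) = Real.cos ((N * θ + θ / 2) + θ / 2) := by
        congr 1; push_cast; ring
      have e2 : Real.cos ((N : ℝ) * θ) = Real.cos ((N * θ + θ / 2) - θ / 2) := by
        congr 1; ring
      rw [e1, e2, Real.cos_sub (N * θ + θ / 2), Real.cos_add (N * θ + θ / 2)]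
      ring
  have e : ∀ M : ℕ, (2 * Real.sin (θ / 2) * ∑ n ∈ Finset.range (M + 1), Real.cos (n * θ)) ^ 2 =
      Real.sin (θ / 2) ^ 2 + 2 * Real.sin (θ / 2) * Real.sin (M * θ + θ / 2) +
        Real.sin (M * θ + θ / 2) ^ 2 := by
    intro M
    rw [two_mul_sin_mul_sum_cos]
    have : ((M + 1 : ℕ) : ℝ) * θ - θ / 2 = M * θ + θ / 2 := by push_cast; ring
    rw [this]
    ring
  simp_rw [e]
  rw [Finset.sum_add_distrib, Finset.sum_add_distrib, ← Finset.mul_sum, hB N]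
  have h2 : 0 ≤ ∑ _M ∈ Finset.range N, Real.sin (θ / 2) ^ 2 := by positivity
  have h3 := Real.cos_le_one (N * θ)
  have h4 : 3 / 8 * (N : ℝ) ≤ ∑ M ∈ Finset.range N, Real.sin (M * θ + θ / 2) ^ 2 := by
    have h5 := hA N
    have h6 := Real.sin_le_one (2 * (N * θ))
    have h7 : 2 ≤ N * Real.sin θ := by
      calc (2 : ℝ) = 2 / Real.pi * Real.pi := by field_simp
        _ ≤ 2 / Real.pi * (N * θ) := by gcongr
        _ = N * (2 / Real.pi * θ) := by ring
        _ ≤ N * Real.sin θ := by gcongr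
    by_contra hcon
    push Not at hcon
    have h8 := mul_lt_mul_of_pos_left hcon (show 0 < 4 * Real.sin θ by positivity)
    nlinarith
  linarith

/-- The mean square of cosine sums is as large as the proximity of `x` to an integer permits. -/
theorem sum_sq_sum_cos_ge {x : ℝ} {Q N : ℕ} (hQ : 4 ≤ Q) (hQN : Q ≤ N)
    (h1 : 1 ≤ 2 * (Q : ℝ) * |x - round x|) (h2 : (Q : ℝ) * |x - round x| ≤ 1) :
    3 / (8 * Real.pi ^ 2) * (Q : ℝ) ^ 2 * N ≤
      ∑ M ∈ Finset.range N, (2 * ∑ n ∈ Finset.range (M + 1), Real.cos (2 * Real.pi * (n * x))) ^ 2 := by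
  have hpi := Real.pi_pos
  set δ := |x - round x| with hδ
  have hQR : (4 : ℝ) ≤ Q := by exact_mod_cast hQ
  have hQNR : (Q : ℝ) ≤ N := by exact_mod_cast hQN
  have hδ0 : 0 < δ := by
    by_contra hcon
    push Not at hcon
    nlinarith
  have hcos : ∀ n : ℕ, Real.cos (2 * Real.pi * (n * x)) = Real.cos (n * (2 * Real.pi * δ)) := by
    intro n
    have e : Real.cos (2 * Real.pi * (n * x)) = Real.cos (n * (2 * Real.pi * (x - round x))) := by
      rw [show (n : ℝ) * (2 * Real.pi * (x - round x)) = 2 * Real.pi * (n * x) -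
        ((n * round x : ℤ) : ℝ) * (2 * Real.pi) by push_cast; ring, Real.cos_sub_int_mul_two_pi]
    rw [e, hδ]
    rcases abs_choice (x - round x) with h' | h' <;> rw [h']
    rw [mul_neg, mul_neg, Real.cos_neg]
  simp_rw [hcos]
  -- Here `4 ≤ Q` matters: the angle `2πδ` must not exceed `π / 2`.
  have hδ4 : δ ≤ 1 / 4 := by nlinarith
  have hNδ : 1 ≤ 2 * (N : ℝ) * δ := h1.trans (by gcongr)
  have hmain := sum_sq_sin_mul_sum_cos_ge (θ := 2 * Real.pi * δ) (by positivity) (by nlinarith) N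
    (by nlinarith)
  have hsin : Real.sin (2 * Real.pi * δ / 2) ^ 2 ≤ (Real.pi * δ) ^ 2 := by
    rw [show 2 * Real.pi * δ / 2 = Real.pi * δ by ring]
    exact pow_le_pow_left₀ (Real.sin_nonneg_of_nonneg_of_le_pi (by positivity) (by nlinarith))
      (Real.sin_le (by positivity)) 2
  set W := ∑ M ∈ Finset.range N, (2 * ∑ n ∈ Finset.range (M + 1),
    Real.cos (n * (2 * Real.pi * δ))) ^ 2 with hW
  have hW0 : 0 ≤ W := Finset.sum_nonneg fun _ _ => sq_nonneg _
  have h3 : 3 / 8 * (N : ℝ) ≤ (Real.pi * δ) ^ 2 * W := by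
    refine hmain.trans (le_trans (le_of_eq ?_) (mul_le_mul_of_nonneg_right hsin hW0))
    rw [hW, Finset.mul_sum]
    refine Finset.sum_congr rfl fun M _ => ?_
    ring
  calc 3 / (8 * Real.pi ^ 2) * (Q : ℝ) ^ 2 * N = (Q : ℝ) ^ 2 / Real.pi ^ 2 * (3 / 8 * N) := by
        field_simp
    _ ≤ (Q : ℝ) ^ 2 / Real.pi ^ 2 * ((Real.pi * δ) ^ 2 * W) := by gcongr
    _ = ((Q : ℝ) * δ) ^ 2 * W := by field_simp
    _ ≤ 1 * W := by
        refine mul_le_mul_of_nonneg_right ?_ hW0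
        exact pow_le_one₀ (by positivity) h2
    _ = W := one_mul _

/-! ### The point sets `L` and `S`: Parseval and upper bounds. -/

theorem countP_map_range (v : ℕ → ℝ) {N : ℕ} (hN : 0 < N) (x y : ℝ)
    [DecidablePred fun p : ℝ × ℝ => p ∈ Set.Ico 0 x ×ˢ Set.Ico 0 y] :
    ((Multiset.countP (fun p : ℝ × ℝ => p ∈ Set.Ico 0 x ×ˢ Set.Ico 0 y)
      ((Multiset.range N).map fun n => (Int.fract (v n), (n : ℝ) / N)) : ℕ) : ℝ) =
    ∑ n ∈ Finset.range N, if (n : ℝ) < N * y then (if Int.fract (v n) < x then 1 else 0) else 0 := by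
  have hNR : (0 : ℝ) < N := by exact_mod_cast hN
  have e : Multiset.card (Multiset.filter (fun n : ℕ => (Int.fract (v n), (n : ℝ) / N) ∈
      Set.Ico 0 x ×ˢ Set.Ico 0 y) (Multiset.range N)) = (Finset.filter (fun n : ℕ =>
        (Int.fract (v n), (n : ℝ) / N) ∈ Set.Ico 0 x ×ˢ Set.Ico 0 y) (Finset.range N)).card := rfl
  rw [Multiset.countP_map, e, Finset.card_filter]
  push_cast
  refine Finset.sum_congr rfl fun n _ => ?_
  have h1 : ((Int.fract (v n), (n : ℝ) / N) ∈ Set.Ico 0 x ×ˢ Set.Ico 0 y) ↔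
      (n : ℝ) < N * y ∧ Int.fract (v n) < x := by
    simp only [Set.mem_prod, Set.mem_Ico, Int.fract_nonneg, true_and, div_lt_iff₀ hNR,
      mul_comm y, show 0 ≤ (n : ℝ) / N by positivity]
    exact and_comm
  simp only [h1]
  by_cases h2 : (n : ℝ) < N * y <;> by_cases h3 : Int.fract (v n) < x <;> simp [h2, h3]

theorem L_eq_map (α : ℝ) (N : ℕ) : L α N =
    (Multiset.range N).map fun n : ℕ => (Int.fract ((n : ℝ) * α), (n : ℝ) / N) := by
  simp [L, Multiset.bind_def, Multiset.pure_def, Multiset.bind_singleton]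

theorem S_eq_map (α : ℝ) (N : ℕ) : S α N =
    (Multiset.range N).map (fun n : ℕ => (Int.fract ((n : ℝ) * α), (n : ℝ) / N)) +
      (Multiset.range N).map fun n : ℕ => (Int.fract (-((n : ℝ) * α)), (n : ℝ) / N) := by
  simp [S, Multiset.bind_def, Multiset.pure_def, Multiset.bind_singleton]

/-- The finite set of multipliers, `{1}` for `L` and `{1, -1}` for `S`, lets one comparison theorem
handle both point sets. -/
theorem boxCount_L (α : ℝ) {N : ℕ} (hN : 0 < N) (x y : ℝ) :
    (boxCount (L α N) x y : ℝ) = ∑ n ∈ Finset.range N, if (n : ℝ) < N * y then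
      ∑ i ∈ ({1} : Finset ℤ), (if Int.fract ((i : ℝ) * (n * α)) < x then 1 else 0) else 0 := by
  unfold boxCount
  rw [L_eq_map, countP_map_range _ hN]
  simp only [Finset.sum_singleton, Int.cast_one, one_mul]

theorem boxCount_S (α : ℝ) {N : ℕ} (hN : 0 < N) (x y : ℝ) :
    (boxCount (S α N) x y : ℝ) = ∑ n ∈ Finset.range N, if (n : ℝ) < N * y then
      ∑ i ∈ ({1, -1} : Finset ℤ), (if Int.fract ((i : ℝ) * (n * α)) < x then 1 else 0) else 0 := by
  unfold boxCount
  rw [S_eq_map, Multiset.countP_add, Nat.cast_add, countP_map_range _ hN, countP_map_range _ hN,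
    ← Finset.sum_add_distrib]
  refine Finset.sum_congr rfl fun n _ => ?_
  rw [Finset.sum_pair (by norm_num), Int.cast_one, one_mul, Int.cast_neg, Int.cast_one,
    neg_one_mul]
  by_cases h : (n : ℝ) < N * y
  · simp only [if_pos h]
  · simp only [if_neg h, add_zero]

/-- The mean square over the unit interval of the one-dimensional local discrepancy of the
points `{i n α}` with `n < M` and `i ∈ s`. -/
noncomputable def localMeanSq (s : Finset ℤ) (α : ℝ) (M : ℕ) : ℝ :=
  ∫ x in Set.Icc (0 : ℝ) 1, (∑ n ∈ Finset.range M, ∑ i ∈ s,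
    ((if Int.fract ((i : ℝ) * (n * α)) < x then 1 else 0) - x)) ^ 2

/-- The Birkhoff sum of the sawtooth function along the multiples of `α`. -/
noncomputable def sawSum (α : ℝ) (M : ℕ) : ℝ :=
  ∑ n ∈ Finset.range M, (Int.fract ((n : ℝ) * α) - 1 / 2)

theorem hasSum_localMeanSq (s : Finset ℤ) (α : ℝ) (M : ℕ) :
    HasSum (fun h : ℕ =>
      ((∑ n ∈ Finset.range M, ∑ i ∈ s, Real.cos (2 * Real.pi * h * (i * (n * α)))) ^ 2 +
        (∑ n ∈ Finset.range M, ∑ i ∈ s, Real.sin (2 * Real.pi * h * (i * (n * α)))) ^ 2)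
          / (h : ℝ) ^ 2)
      (2 * Real.pi ^ 2 * (localMeanSq s α M -
        (∑ n ∈ Finset.range M, ∑ i ∈ s, (Int.fract ((i : ℝ) * (n * α)) - 1 / 2)) ^ 2)) := by
  have h := hasSum_local_discrepancy (Finset.range M ×ˢ s)
    (fun z : ℕ × ℤ => Int.fract ((z.2 : ℝ) * (z.1 * α)))
    (fun z _ => ⟨Int.fract_nonneg _, (Int.fract_lt_one _).le⟩)
  simp only [Finset.sum_product, cos_mul_fract, sin_mul_fract] at h
  exact h

theorem hasSum_localMeanSq_single (α : ℝ) (M : ℕ) :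
    HasSum (fun h : ℕ => expSumSq α M h / (h : ℝ) ^ 2)
      (2 * Real.pi ^ 2 * (localMeanSq {1} α M - sawSum α M ^ 2)) := by
  have h := hasSum_localMeanSq {1} α M
  simp only [Finset.sum_singleton, Int.cast_one, one_mul] at h
  exact h

theorem fract_add_fract_neg_of_irrational {x : ℝ} (hx : Irrational x) :
    Int.fract x + Int.fract (-x) = 1 := by
  have h0 : Int.fract x ≠ 0 := by
    intro h
    rw [Int.fract_eq_iff] at h
    obtain ⟨-, -, z, hz⟩ := h
    exact hx ⟨z, by push_cast; linarith⟩
  rw [Int.fract_neg h0]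
  ring

theorem hasSum_localMeanSq_pair {α : ℝ} (hα : Irrational α) {M : ℕ} (hM : 0 < M) :
    HasSum (fun h : ℕ =>
      (2 * ∑ n ∈ Finset.range M, Real.cos (2 * Real.pi * h * (n * α))) ^ 2 / (h : ℝ) ^ 2)
      (2 * Real.pi ^ 2 * (localMeanSq {1, -1} α M - 1)) := by
  have h := hasSum_localMeanSq {1, -1} α M
  -- For `n > 0` the two sawtooth values cancel. Only the double point at `n = 0` survives and
  -- contributes `-1/2 - 1/2`.
  have e : ∑ n ∈ Finset.range M, ∑ i ∈ ({1, -1} : Finset ℤ),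
      (Int.fract ((i : ℝ) * (n * α)) - 1 / 2) = -1 := by
    obtain ⟨M, rfl⟩ := Nat.exists_eq_succ_of_ne_zero hM.ne'
    simp only [Finset.sum_pair (show (1 : ℤ) ≠ -1 by norm_num)]
    rw [Finset.sum_range_succ', Finset.sum_eq_zero]
    · norm_num
    · intro n _
      have hn : Irrational (((n + 1 : ℕ) : ℝ) * α) := hα.natCast_mul (by omega)
      have := fract_add_fract_neg_of_irrational hn
      rw [Int.cast_one, one_mul, Int.cast_neg, Int.cast_one, neg_one_mul]
      linarith
  rw [e] at h
  simp only [Finset.sum_pair (show (1 : ℤ) ≠ -1 by norm_num), Int.cast_one, one_mul,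
    Int.cast_neg, neg_one_mul, mul_neg, Real.cos_neg, Real.sin_neg, add_neg_cancel,
    Finset.sum_const_zero, ← two_mul, ← Finset.mul_sum] at h
  simpa using h

theorem D₂_L_sq_comparison (α : ℝ) {N : ℕ} (hN : 0 < N) :
    D₂ (L α N) ^ 2 ≤
      2 * (1 / (N : ℝ) * ∑ M ∈ Finset.range N, localMeanSq {1} α (M + 1)) + 2 ∧
    1 / (N : ℝ) * ∑ M ∈ Finset.range N, localMeanSq {1} α (M + 1) ≤ 2 * D₂ (L α N) ^ 2 + 2 := by
  have h := D₂_sq_comparison {1} (fun n (i : ℤ) => Int.fract ((i : ℝ) * (n * α))) hN (L α N)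
    (by simp [L_eq_map]) (fun x _ y _ => boxCount_L α hN x y)
  rw [Finset.card_singleton] at h
  change D₂ (L α N) ^ 2 ≤ 2 * (1 / (N : ℝ) * ∑ M ∈ Finset.range N, localMeanSq {1} α (M + 1)) +
    2 * ((1 : ℕ) : ℝ) ^ 2 ∧ 1 / (N : ℝ) * ∑ M ∈ Finset.range N, localMeanSq {1} α (M + 1) ≤
      2 * D₂ (L α N) ^ 2 + 2 * ((1 : ℕ) : ℝ) ^ 2 at h
  norm_num at h ⊢
  exact h

theorem D₂_S_sq_comparison (α : ℝ) {N : ℕ} (hN : 0 < N) :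
    D₂ (S α N) ^ 2 ≤
      2 * (1 / (N : ℝ) * ∑ M ∈ Finset.range N, localMeanSq {1, -1} α (M + 1)) + 8 ∧
    1 / (N : ℝ) * ∑ M ∈ Finset.range N, localMeanSq {1, -1} α (M + 1) ≤
      2 * D₂ (S α N) ^ 2 + 8 := by
  have h := D₂_sq_comparison {1, -1} (fun n (i : ℤ) => Int.fract ((i : ℝ) * (n * α))) hN (S α N)
    (by rw [Finset.card_pair (by norm_num)]; simp [S_eq_map]; ring) (fun x _ y _ => boxCount_S α hN x y)
  rw [Finset.card_pair (by norm_num)] at h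
  change D₂ (S α N) ^ 2 ≤ 2 * (1 / (N : ℝ) * ∑ M ∈ Finset.range N, localMeanSq {1, -1} α (M + 1)) +
    2 * ((2 : ℕ) : ℝ) ^ 2 ∧ 1 / (N : ℝ) * ∑ M ∈ Finset.range N, localMeanSq {1, -1} α (M + 1) ≤
      2 * D₂ (S α N) ^ 2 + 2 * ((2 : ℕ) : ℝ) ^ 2 at h
  norm_num at h ⊢
  exact h

/-- The trivial bound `|∑ e(nhα)| ≤ M ≤ q K` supplies the cap that the tail of the frequency sum
requires. -/
theorem exists_localMeanSq_single_le : ∃ C : ℝ, 0 < C ∧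
    ∀ (α : ℝ) (a q : ℕ → ℕ) (p : ℕ → ℤ), ContFracData α a q p → ∀ K M : ℕ, M ≤ q K →
    localMeanSq {1} α M ≤ C * (∑ k ∈ Finset.Icc 1 K, (a k : ℝ) ^ 2 + 1) + sawSum α M ^ 2 := by
  obtain ⟨C, hC, h⟩ := exists_hasSum_le
  refine ⟨C, hC, ?_⟩
  intro α a q p d K M hM
  have hMR : (M : ℝ) ^ 2 ≤ (q K : ℝ) ^ 2 := by
    have : (M : ℝ) ≤ q K := by exact_mod_cast hM
    gcongr
  have hs := hasSum_localMeanSq_single α M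
  have h1 := h α a q p d K (expSumSq α M) _ (expSumSq_nonneg α M)
    (fun h => (expSumSq_le_sq α M h).trans (hMR.trans (by nlinarith [sq_nonneg (q K : ℝ)])))
    (fun h => by
      have h1 := expSumSq_mul_le α M h
      have h2 := mul_nonneg (expSumSq_nonneg α M h) (sq_nonneg (h * α - round (h * α)))
      linarith) hs
  have h2 : 0 ≤ 2 * Real.pi ^ 2 * (localMeanSq {1} α M - sawSum α M ^ 2) :=
    hs.nonneg fun h => div_nonneg (expSumSq_nonneg α M h) (by positivity)
  have hpi : 1 ≤ 2 * Real.pi ^ 2 := by nlinarith [Real.pi_gt_three]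
  have h3 : 0 ≤ localMeanSq {1} α M - sawSum α M ^ 2 := by
    by_contra hcon
    push Not at hcon
    nlinarith
  nlinarith

theorem sawSum_sq_le_localMeanSq (α : ℝ) (M : ℕ) : sawSum α M ^ 2 ≤ localMeanSq {1} α M := by
  have h2 : 0 ≤ 2 * Real.pi ^ 2 * (localMeanSq {1} α M - sawSum α M ^ 2) :=
    (hasSum_localMeanSq_single α M).nonneg fun h =>
      div_nonneg (expSumSq_nonneg α M h) (by positivity)
  have h3 := nonneg_of_mul_nonneg_right h2 (by positivity)
  linarith

theorem exists_localMeanSq_pair_le : ∃ C : ℝ, 0 < C ∧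
    ∀ (α : ℝ) (a q : ℕ → ℕ) (p : ℕ → ℤ), Irrational α → ContFracData α a q p →
    ∀ K M : ℕ, 0 < M → M ≤ q K →
    localMeanSq {1, -1} α M ≤ C * (∑ k ∈ Finset.Icc 1 K, (a k : ℝ) ^ 2 + 1) + 1 := by
  obtain ⟨C, hC, h⟩ := exists_hasSum_le
  refine ⟨C, hC, ?_⟩
  intro α a q p hα d K M hM0 hM
  have hMR : (M : ℝ) ^ 2 ≤ (q K : ℝ) ^ 2 := by
    have : (M : ℝ) ≤ q K := by exact_mod_cast hM
    gcongr
  have hs := hasSum_localMeanSq_pair hα hM0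
  have hle : ∀ h : ℕ, (2 * ∑ n ∈ Finset.range M, Real.cos (2 * Real.pi * h * (n * α))) ^ 2 ≤
      4 * expSumSq α M h := by
    intro h
    unfold expSumSq
    nlinarith [sq_nonneg (∑ n ∈ Finset.range M, Real.sin (2 * Real.pi * h * (n * α)))]
  have h1 := h α a q p d K _ _ (fun h => sq_nonneg _)
    (fun h => (hle h).trans (by have := expSumSq_le_sq α M h; linarith))
    (fun h => by
      have h1 := expSumSq_mul_le α M h
      have h2 := mul_le_mul_of_nonneg_right (hle h) (sq_nonneg (h * α - round (h * α)))
      linarith) hs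
  have h2 : 0 ≤ 2 * Real.pi ^ 2 * (localMeanSq {1, -1} α M - 1) :=
    hs.nonneg fun h => div_nonneg (sq_nonneg _) (by positivity)
  have hpi : 1 ≤ 2 * Real.pi ^ 2 := by nlinarith [Real.pi_gt_three]
  have h3 := nonneg_of_mul_nonneg_right h2 (by positivity)
  nlinarith

theorem average_le {N : ℕ} (hN : 0 < N) {f : ℕ → ℝ} {c : ℝ} (hf : ∀ M ∈ Finset.range N, f M ≤ c) :
    1 / (N : ℝ) * ∑ M ∈ Finset.range N, f M ≤ c := by
  have hNR : (0 : ℝ) < N := by exact_mod_cast hN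
  rw [one_div, inv_mul_le_iff₀ hNR]
  have := Finset.sum_le_card_nsmul _ _ _ hf
  simpa using this

theorem exists_D₂_S_sq_le : ∃ C : ℝ, 0 < C ∧
    ∀ (α : ℝ) (a q : ℕ → ℕ) (p : ℕ → ℤ), Irrational α → ContFracData α a q p →
    ∀ K N : ℕ, 0 < N → N ≤ q K →
    D₂ (S α N) ^ 2 ≤ C * (∑ k ∈ Finset.Icc 1 K, (a k : ℝ) ^ 2 + 1) := by
  obtain ⟨C, hC, h⟩ := exists_localMeanSq_pair_le
  refine ⟨2 * C + 10, by positivity, ?_⟩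
  intro α a q p hα d K N hN hNq
  have h1 := (D₂_S_sq_comparison α hN).1
  have h2 := average_le hN (f := fun M => localMeanSq {1, -1} α (M + 1)) fun M hM =>
    h α a q p hα d K (M + 1) (by omega) (by rw [Finset.mem_range] at hM; omega)
  have h3 : 0 ≤ ∑ k ∈ Finset.Icc 1 K, (a k : ℝ) ^ 2 := Finset.sum_nonneg fun _ _ => sq_nonneg _
  nlinarith

theorem exists_D₂_L_sq_le : ∃ C : ℝ, 0 < C ∧
    ∀ (α : ℝ) (a q : ℕ → ℕ) (p : ℕ → ℤ), ContFracData α a q p →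
    ∀ K N : ℕ, 0 < N → N ≤ q K →
    D₂ (L α N) ^ 2 ≤ C * (∑ k ∈ Finset.Icc 1 K, (a k : ℝ) ^ 2 + 1) +
      2 * (1 / (N : ℝ) * ∑ M ∈ Finset.range N, sawSum α (M + 1) ^ 2) := by
  obtain ⟨C, hC, h⟩ := exists_localMeanSq_single_le
  refine ⟨2 * C + 2, by positivity, ?_⟩
  intro α a q p d K N hN hNq
  have h1 := (D₂_L_sq_comparison α hN).1
  have h2 := average_le hN (f := fun M => localMeanSq {1} α (M + 1) - sawSum α (M + 1) ^ 2)
    fun M hM => sub_le_iff_le_add.2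
      (h α a q p d K (M + 1) (by rw [Finset.mem_range] at hM; omega))
  have h3 : 0 ≤ ∑ k ∈ Finset.Icc 1 K, (a k : ℝ) ^ 2 := Finset.sum_nonneg fun _ _ => sq_nonneg _
  rw [Finset.sum_sub_distrib, mul_sub] at h2
  nlinarith

theorem average_sawSum_sq_le (α : ℝ) {N : ℕ} (hN : 0 < N) :
    1 / (N : ℝ) * ∑ M ∈ Finset.range N, sawSum α (M + 1) ^ 2 ≤ 2 * D₂ (L α N) ^ 2 + 2 := by
  refine le_trans ?_ (D₂_L_sq_comparison α hN).2
  gcongr with M hM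
  exact sawSum_sq_le_localMeanSq α (M + 1)

/-! ### Lower bounds from the frequencies `q k`. -/

/-- The determinant identity reads `q_{k+1} |q_k α - p_k| + q_k |q_{k+1} α - p_{k+1}| = 1`. -/
theorem ContFracData.abs_convergent_le {α : ℝ} {a q : ℕ → ℕ} {p : ℕ → ℤ}
    (d : ContFracData α a q p) (k : ℕ) : |(q k : ℝ) * α - p k| * q (k + 1) ≤ 1 := by
  have hdet : (p (k + 1) : ℝ) * q k - p k * q (k + 1) = (-1) ^ k := by exact_mod_cast d.det k
  have h0 := d.sign k
  have h1 := d.sign (k + 1)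
  have e : |q k * α - p k| = (-1) ^ k * (q k * α - p k) := by
    rw [← abs_of_pos h0, abs_mul]
    simp
  have hs : ((-1 : ℝ) ^ k) * (-1) ^ k = 1 := by rw [← pow_add, ← two_mul]; simp
  have e2 : (q (k + 1) : ℝ) * ((-1) ^ k * (q k * α - p k)) +
      q k * ((-1) ^ (k + 1) * (q (k + 1) * α - p (k + 1))) = 1 := by
    rw [pow_succ]
    linear_combination (-1) ^ k * hdet + hs
  have h2 : 0 ≤ q k * ((-1) ^ (k + 1) * (q (k + 1) * α - p (k + 1))) := by positivity
  rw [e]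
  linarith

theorem ContFracData.mul_abs_sub_round_le {α : ℝ} {a q : ℕ → ℕ} {p : ℕ → ℤ}
    (d : ContFracData α a q p) (k : ℕ) : (q (k + 1) : ℝ) * |q k * α - round (q k * α)| ≤ 1 := by
  rw [mul_comm]
  exact (mul_le_mul_of_nonneg_right (round_le _ (p k)) (Nat.cast_nonneg _)).trans
    (d.abs_convergent_le k)

/-- Only the frequencies `h = q k` are needed to bound the discrepancy from below. -/
theorem ContFracData.sum_sq_le_average {α : ℝ} {a q : ℕ → ℕ} {p : ℕ → ℤ}
    (d : ContFracData α a q p) (K : ℕ) (s : ℕ → ℝ) (F : ℕ → ℕ → ℝ)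
    (hF : ∀ M h : ℕ, (∑ n ∈ Finset.range (M + 1), Real.cos (2 * Real.pi * h * (n * α))) ^ 2 ≤ F M h)
    (hs : ∀ M, HasSum (fun h : ℕ => F M h / (h : ℝ) ^ 2) (s M)) :
    3 / (32 * Real.pi ^ 2) * ∑ k ∈ Finset.Ico 3 K, (a (k + 1) : ℝ) ^ 2 ≤
      1 / (q K : ℝ) * ∑ M ∈ Finset.range (q K), s M := by
  have hqK : (0 : ℝ) < q K := by exact_mod_cast d.q_pos K
  have hF0 : ∀ M h : ℕ, 0 ≤ F M h := fun M h => (sq_nonneg _).trans (hF M h)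
  -- Index `0` must be excluded: `q 0 = q 1` when `a 1 = 1`.
  have hlt : ∀ k, 1 ≤ k → q k < q (k + 1) := by
    intro k hk
    obtain ⟨k, rfl⟩ := Nat.exists_eq_add_of_le' hk
    have h1 : q (k + 1) + q k ≤ q (k + 1 + 1) := d.q_add_le k
    have h2 := d.q_pos k
    omega
  have hinj : Set.InjOn q (Finset.Ico 3 K) := by
    have h1 : StrictMono fun k => q (k + 1) := strictMono_nat_of_lt_succ fun k => hlt (k + 1) (by omega)
    intro i hi j hj hij
    simp only [Finset.coe_Ico, Set.mem_Ico] at hi hj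
    have := h1.injective (a₁ := i - 1) (a₂ := j - 1) (by
      simp only [Nat.sub_add_cancel (show 1 ≤ i by omega), Nat.sub_add_cancel (show 1 ≤ j by omega)]
      exact hij)
    omega
  have hterm : ∀ k ∈ Finset.Ico 3 K, 3 / (32 * Real.pi ^ 2) * (a (k + 1) : ℝ) ^ 2 ≤
      1 / (q K : ℝ) * ∑ M ∈ Finset.range (q K), F M (q k) / (q k : ℝ) ^ 2 := by
    intro k hk
    rw [Finset.mem_Ico] at hk
    have hqk : (0 : ℝ) < q k := by exact_mod_cast d.q_pos k
    have h1 := d.wellSeparated k (q k) (by have := d.q_pos k; omega)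
      (by rw [abs_lt]; have := hlt k (by omega); omega) (round ((q k : ℝ) * α))
    rw [Int.cast_natCast] at h1
    -- The sum starts at `k = 3` so that `q (k + 1) ≥ k + 1 ≥ 4`.
    have h2 := sum_sq_sum_cos_ge (x := q k * α) (Q := q (k + 1)) (N := q K)
      (by have := d.self_le_q (k + 1); omega) (d.q_mono (by omega)) h1 (d.mul_abs_sub_round_le k)
    have h3 : ∑ M ∈ Finset.range (q K), (2 * ∑ n ∈ Finset.range (M + 1),
        Real.cos (2 * Real.pi * (n * (q k * α)))) ^ 2 ≤ 4 * ∑ M ∈ Finset.range (q K), F M (q k) := by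
      rw [Finset.mul_sum]
      refine Finset.sum_le_sum fun M _ => ?_
      have h4 := hF M (q k)
      have e : ∀ n : ℕ, 2 * Real.pi * (n * (q k * α)) = 2 * Real.pi * q k * (n * α) :=
        fun n => by ring
      simp_rw [e]
      rw [mul_pow]
      linarith
    have ha : (a (k + 1) : ℝ) * q k ≤ q (k + 1) := by
      have : a (k + 1) * q k ≤ q (k + 1) := by
        obtain ⟨k, rfl⟩ := Nat.exists_eq_add_of_le' (show 1 ≤ k by omega)
        exact (Nat.le_add_right _ _).trans (d.q_rec k).ge
      exact_mod_cast this
    rw [← Finset.sum_div, one_div, ← div_eq_inv_mul, div_div, le_div_iff₀ (by positivity)]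
    calc 3 / (32 * Real.pi ^ 2) * (a (k + 1) : ℝ) ^ 2 * ((q k : ℝ) ^ 2 * q K)
        = 3 / (32 * Real.pi ^ 2) * (a (k + 1) * q k : ℝ) ^ 2 * q K := by ring
      _ ≤ 3 / (32 * Real.pi ^ 2) * (q (k + 1) : ℝ) ^ 2 * q K := by gcongr
      _ = (3 / (8 * Real.pi ^ 2) * (q (k + 1) : ℝ) ^ 2 * q K) / 4 := by ring
      _ ≤ _ := by linarith
  rw [Finset.mul_sum]
  refine (Finset.sum_le_sum hterm).trans ?_
  rw [← Finset.mul_sum, Finset.sum_comm]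
  gcongr with M hM
  rw [← Finset.sum_image (f := fun h : ℕ => F M h / (h : ℝ) ^ 2) hinj]
  exact sum_le_hasSum _ (fun h _ => div_nonneg (hF0 M h) (by positivity)) (hs M)

theorem exists_sum_sq_le_D₂_S : ∃ C : ℝ, 0 < C ∧
    ∀ (α : ℝ) (a q : ℕ → ℕ) (p : ℕ → ℤ), Irrational α → ContFracData α a q p → ∀ K : ℕ,
    ∑ k ∈ Finset.Ico 3 K, (a (k + 1) : ℝ) ^ 2 ≤ C * (D₂ (S α (q K)) ^ 2 + 1) := by
  have hpi := Real.pi_pos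
  refine ⟨32 * Real.pi ^ 2 / 3 * (2 * Real.pi ^ 2 * 8), by positivity, ?_⟩
  intro α a q p hα d K
  have h1 := (D₂_S_sq_comparison α (d.q_pos K)).2
  have h2 := d.sum_sq_le_average K (fun M => 2 * Real.pi ^ 2 * (localMeanSq {1, -1} α (M + 1) - 1))
    (fun M h => (2 * ∑ n ∈ Finset.range (M + 1), Real.cos (2 * Real.pi * h * (n * α))) ^ 2)
    (fun M h => by rw [mul_pow]; nlinarith [sq_nonneg (∑ n ∈ Finset.range (M + 1),
      Real.cos (2 * Real.pi * h * (n * α)))])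
    (fun M => hasSum_localMeanSq_pair hα (Nat.succ_pos M))
  rw [← Finset.mul_sum, Finset.sum_sub_distrib, mul_left_comm, mul_sub] at h2
  have hqK : (0 : ℝ) < q K := by exact_mod_cast d.q_pos K
  have e : 1 / (q K : ℝ) * ∑ _M ∈ Finset.range (q K), (1 : ℝ) = 1 := by
    simp [hqK.ne']
  rw [e] at h2
  have hD := sq_nonneg (D₂ (S α (q K)))
  have h3 : 3 / (32 * Real.pi ^ 2) * ∑ k ∈ Finset.Ico 3 K, (a (k + 1) : ℝ) ^ 2 ≤
      2 * Real.pi ^ 2 * (8 * (D₂ (S α (q K)) ^ 2 + 1)) :=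
    h2.trans (mul_le_mul_of_nonneg_left (by linarith) (by positivity))
  calc ∑ k ∈ Finset.Ico 3 K, (a (k + 1) : ℝ) ^ 2 = 32 * Real.pi ^ 2 / 3 *
        (3 / (32 * Real.pi ^ 2) * ∑ k ∈ Finset.Ico 3 K, (a (k + 1) : ℝ) ^ 2) := by field_simp
    _ ≤ 32 * Real.pi ^ 2 / 3 * (2 * Real.pi ^ 2 * (8 * (D₂ (S α (q K)) ^ 2 + 1))) := by gcongr
    _ = _ := by ring

theorem exists_sum_sq_le_D₂_L : ∃ C : ℝ, 0 < C ∧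
    ∀ (α : ℝ) (a q : ℕ → ℕ) (p : ℕ → ℤ), ContFracData α a q p → ∀ K : ℕ,
    ∑ k ∈ Finset.Ico 3 K, (a (k + 1) : ℝ) ^ 2 ≤ C * (D₂ (L α (q K)) ^ 2 + 1) := by
  have hpi := Real.pi_pos
  refine ⟨32 * Real.pi ^ 2 / 3 * (2 * Real.pi ^ 2 * 2), by positivity, ?_⟩
  intro α a q p d K
  have hqK : (0 : ℝ) < q K := by exact_mod_cast d.q_pos K
  have h1 := (D₂_L_sq_comparison α (d.q_pos K)).2
  have h2 := d.sum_sq_le_average K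
    (fun M => 2 * Real.pi ^ 2 * (localMeanSq {1} α (M + 1) - sawSum α (M + 1) ^ 2))
    (fun M h => expSumSq α (M + 1) h)
    (fun M h => le_add_of_nonneg_right (sq_nonneg _))
    (fun M => hasSum_localMeanSq_single α (M + 1))
  rw [← Finset.mul_sum, Finset.sum_sub_distrib, mul_left_comm, mul_sub] at h2
  have e : 0 ≤ 1 / (q K : ℝ) * ∑ M ∈ Finset.range (q K), sawSum α (M + 1) ^ 2 :=
    mul_nonneg (by positivity) (Finset.sum_nonneg fun _ _ => sq_nonneg _)
  have h3 : 3 / (32 * Real.pi ^ 2) * ∑ k ∈ Finset.Ico 3 K, (a (k + 1) : ℝ) ^ 2 ≤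
      2 * Real.pi ^ 2 * (2 * (D₂ (L α (q K)) ^ 2 + 1)) :=
    h2.trans (mul_le_mul_of_nonneg_left (by linarith) (by positivity))
  calc ∑ k ∈ Finset.Ico 3 K, (a (k + 1) : ℝ) ^ 2 = 32 * Real.pi ^ 2 / 3 *
        (3 / (32 * Real.pi ^ 2) * ∑ k ∈ Finset.Ico 3 K, (a (k + 1) : ℝ) ^ 2) := by field_simp
    _ ≤ 32 * Real.pi ^ 2 / 3 * (2 * Real.pi ^ 2 * (2 * (D₂ (L α (q K)) ^ 2 + 1))) := by gcongr
    _ = _ := by ring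

/-! ### Dedekind sums and their reciprocity law. -/

theorem emod_mul_emod_of_inverse {p r : ℤ} {q : ℕ} (h : p * r ≡ 1 [ZMOD q]) {n : ℤ} (h0 : 0 ≤ n)
    (hn : n < q) : ((n * p) % q * r) % q = n := by
  have h1 : (n * p) % q * r ≡ n [ZMOD q] := by
    calc (n * p) % q * r ≡ n * p * r [ZMOD q] := (Int.mod_modEq _ _).mul_right _
      _ = n * (p * r) := by ring
      _ ≡ n * 1 [ZMOD q] := h.mul_left _
      _ = n := by ring
  rw [h1.eq]
  exact Int.emod_eq_of_lt h0 hn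

/-- Multiplication by `p` permutes the residues modulo `q`, with inverse multiplication by `r`. -/
theorem sum_range_emod_of_inverse {β : Type*} [AddCommMonoid β] {p r : ℤ} {q : ℕ}
    (h : p * r ≡ 1 [ZMOD q]) (G : ℤ → ℤ → β) :
    ∑ n ∈ Finset.range q, G n ((n * p) % q) = ∑ m ∈ Finset.range q, G ((m * r) % q) m := by
  have h' : r * p ≡ 1 [ZMOD q] := by rwa [mul_comm]
  refine Finset.sum_bij' (fun n _ => (((n : ℤ) * p) % q).toNat)
    (fun m _ => (((m : ℤ) * r) % q).toNat) ?_ ?_ ?_ ?_ ?_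
  all_goals
    intro n hn
    rw [Finset.mem_range] at hn
    have hq : (0 : ℤ) < q := by omega
    have e1 : 0 ≤ ((n : ℤ) * p) % q := Int.emod_nonneg _ hq.ne'
    have e2 : ((n : ℤ) * p) % q < q := Int.emod_lt_of_pos _ hq
    have e3 : 0 ≤ ((n : ℤ) * r) % q := Int.emod_nonneg _ hq.ne'
    have e4 : ((n : ℤ) * r) % q < q := Int.emod_lt_of_pos _ hq
  · rw [Finset.mem_range]; omega
  · rw [Finset.mem_range]; omega
  · rw [Int.toNat_of_nonneg e1, emod_mul_emod_of_inverse h (by omega) (by omega)]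
    simp
  · rw [Int.toNat_of_nonneg e3, emod_mul_emod_of_inverse h' (by omega) (by omega)]
    simp
  · rw [Int.toNat_of_nonneg e1, emod_mul_emod_of_inverse h (by omega) (by omega)]

/-- The Dedekind sum `s(p, q)`, for coprime `p` and `q`. -/
noncomputable def dedekindSum (p : ℤ) (q : ℕ) : ℝ :=
  ((∑ n ∈ Finset.range q, (n : ℤ) * ((n * p) % q) : ℤ) : ℝ) / (q : ℝ) ^ 2 - ((q : ℝ) - 1) / 4

theorem dedekindSum_congr {p p' : ℤ} {q : ℕ} (h : p ≡ p' [ZMOD q]) :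
    dedekindSum p q = dedekindSum p' q := by
  unfold dedekindSum
  have e : ∀ n : ℕ, ((n : ℤ) * p) % q = ((n : ℤ) * p') % q := fun n => (h.mul_left _).eq
  simp_rw [e]

theorem dedekindSum_of_inverse {p r : ℤ} {q : ℕ} (h : p * r ≡ 1 [ZMOD q]) :
    dedekindSum p q = dedekindSum r q := by
  unfold dedekindSum
  rw [sum_range_emod_of_inverse h (fun x y => x * y)]
  simp_rw [mul_comm]

theorem sum_range_id_real (k : ℕ) : ∑ n ∈ Finset.range k, (n : ℝ) = k * (k - 1) / 2 := by
  induction k with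
  | zero => simp
  | succ k ih => rw [Finset.sum_range_succ, ih]; push_cast; ring

theorem sum_range_sq_real (k : ℕ) :
    ∑ n ∈ Finset.range k, (n : ℝ) ^ 2 = k * (k - 1) * (2 * k - 1) / 6 := by
  induction k with
  | zero => simp
  | succ k ih => rw [Finset.sum_range_succ, ih]; push_cast; ring

/-- Coprimality makes the residue of `n * p` nonzero for `0 < n < q`, so negating `p` replaces it by
`q` minus itself. -/
theorem dedekindSum_neg {p : ℤ} {q : ℕ} (hq : 0 < q) (h : IsCoprime p (q : ℤ)) :
    dedekindSum (-p) q = -dedekindSum p q := by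
  have key : ∑ n ∈ Finset.range q, (n : ℤ) * ((n * -p) % q) =
      ∑ n ∈ Finset.range q, ((n : ℤ) * q - n * ((n * p) % q)) := by
    refine Finset.sum_congr rfl fun n hn => ?_
    rw [Finset.mem_range] at hn
    rcases Nat.eq_zero_or_pos n with rfl | hn0
    · simp
    rw [← mul_sub]
    congr 1
    have hnd : ¬ (q : ℤ) ∣ (n : ℤ) * p := by
      intro hd
      have := h.symm.dvd_of_dvd_mul_right hd
      have := Int.le_of_dvd (by omega) this
      omega
    rw [mul_neg, Int.neg_emod, if_neg hnd]
    simp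
  have hqR : (0 : ℝ) < q := by exact_mod_cast hq
  have hsum := sum_range_id_real q
  unfold dedekindSum
  rw [key, Finset.sum_sub_distrib, ← Finset.sum_mul]
  push_cast
  rw [hsum]
  field_simp
  ring

theorem card_filter_lt_range (g k : ℕ) (hg : g < k) :
    ((Finset.range k).filter fun n => g < n).card = k - 1 - g := by
  have : (Finset.range k).filter (fun n => g < n) = Finset.Ico (g + 1) k := by
    ext n
    simp only [Finset.mem_filter, Finset.mem_range, Finset.mem_Ico]
    omega
  rw [this, Nat.card_Ico]
  omega

/-- Counting lattice points below a line through the origin by columns and by rows. -/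
theorem sum_div_mul_div_add_one {h k : ℕ} (hh : 0 < h) (hk : 0 < k) (hc : Nat.Coprime h k) :
    ∑ n ∈ Finset.range k, ((h * n / k : ℕ) : ℝ) * (((h * n / k : ℕ) : ℝ) + 1) =
      ∑ m ∈ Finset.range h, 2 * (m : ℝ) * ((k : ℝ) - 1 - ((k * m / h : ℕ) : ℝ)) := by
  -- Weight the lattice point `(n, m)` by `2m`: a column of height `f` has total weight `f (f + 1)`.
  have e1 : ∀ n ∈ Finset.range k, ((h * n / k : ℕ) : ℝ) * (((h * n / k : ℕ) : ℝ) + 1) =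
      ∑ m ∈ Finset.range h, if m * k ≤ h * n then 2 * (m : ℝ) else 0 := by
    intro n hn
    rw [Finset.mem_range] at hn
    have hlt : h * n / k < h := by
      rw [Nat.div_lt_iff_lt_mul hk]
      exact Nat.mul_lt_mul_of_pos_left hn hh
    rw [← Finset.sum_filter]
    have : (Finset.range h).filter (fun m => m * k ≤ h * n) = Finset.range (h * n / k + 1) := by
      ext m
      simp only [Finset.mem_filter, Finset.mem_range, Nat.lt_succ_iff, Nat.le_div_iff_mul_le hk]
      refine ⟨fun h => h.2, fun h1 => ⟨?_, h1⟩⟩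
      exact lt_of_le_of_lt ((Nat.le_div_iff_mul_le hk).2 h1) hlt
    rw [this, ← Finset.mul_sum, sum_range_id_real]
    push_cast
    ring
  rw [Finset.sum_congr rfl e1, Finset.sum_comm]
  refine Finset.sum_congr rfl fun m hm => ?_
  rw [Finset.mem_range] at hm
  rcases Nat.eq_zero_or_pos m with rfl | hm0
  · simp
  have hg : k * m / h < k := by
    rw [Nat.div_lt_iff_lt_mul hh]
    exact Nat.mul_lt_mul_of_pos_left hm hk
  -- By coprimality no point with `0 < m < h` and `n < k` lies on the line, so the weak inequality
  -- is strict.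
  have e2 : (Finset.range k).filter (fun n => m * k ≤ h * n) =
      (Finset.range k).filter fun n => k * m / h < n := by
    refine Finset.filter_congr fun n hn => ?_
    rw [Finset.mem_range] at hn
    rw [Nat.div_lt_iff_lt_mul hh]
    constructor
    · intro hle
      refine lt_of_le_of_ne (by linarith) ?_
      intro heq
      have hd : k ∣ n * h := ⟨m, heq.symm⟩
      have hd2 : k ∣ n := hc.symm.dvd_of_dvd_mul_right hd
      rcases Nat.eq_zero_or_pos n with rfl | hn0
      · have : 0 < k * m := by positivity
        omega
      · have := Nat.le_of_dvd hn0 hd2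
        omega
    · intro hlt
      linarith
  rw [← Finset.sum_filter, e2, Finset.sum_const, card_filter_lt_range _ _ hg, nsmul_eq_mul,
    Nat.cast_sub (by omega), Nat.cast_sub (by omega)]
  push_cast
  ring

theorem sum_mul_emod_eq (h k : ℕ) :
    ((∑ n ∈ Finset.range k, (n : ℤ) * ((n * (h : ℤ)) % k) : ℤ) : ℝ) =
      h * (k * (k - 1) * (2 * k - 1) / 6) - k * ∑ n ∈ Finset.range k, (n : ℝ) * (h * n / k : ℕ) := by
  have e : ∀ n : ℕ, ((n : ℤ) * h) % k = ((h * n % k : ℕ) : ℤ) := fun n => by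
    push_cast; rw [mul_comm]
  simp only [e]
  rw [← sum_range_sq_real, Finset.mul_sum, Finset.mul_sum, ← Finset.sum_sub_distrib, Int.cast_sum]
  refine Finset.sum_congr rfl fun n _ => ?_
  have h1 : ((k * (h * n / k) + h * n % k : ℕ) : ℝ) = (h * n : ℕ) := by
    rw [Nat.div_add_mod]
  push_cast at h1
  rw [Int.cast_mul, Int.cast_natCast, Int.cast_natCast]
  linear_combination (n : ℝ) * h1

/-- Dedekind's reciprocity law. -/
theorem dedekindSum_add_dedekindSum {h k : ℕ} (hh : 0 < h) (hk : 0 < k) (hc : Nat.Coprime h k) :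
    dedekindSum h k + dedekindSum k h =
      -1 / 4 + 1 / 12 * ((h : ℝ) / k + k / h + 1 / (h * k)) := by
  have hhR : (0 : ℝ) < h := by exact_mod_cast hh
  have hkR : (0 : ℝ) < k := by exact_mod_cast hk
  obtain ⟨r, hr⟩ : ∃ r : ℤ, (h : ℤ) * r ≡ 1 [ZMOD k] := Int.mod_coprime hc
  -- Since the residues of `h * n` permute those of `n`, their sum gives `F1 = ∑ ⌊hn/k⌋`, and their
  -- sum of squares expresses `X` by `F2 = ∑ ⌊hn/k⌋²`. The lattice count expresses `Y` by `F2` as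
  -- well, and in the final sum `F2` cancels.
  have hperm : ∀ g : ℤ → ℝ, ∑ n ∈ Finset.range k, g ((h * n % k : ℕ) : ℤ) =
      ∑ n ∈ Finset.range k, g n := by
    intro g
    rw [← sum_range_emod_of_inverse hr (fun _ y => g y)]
    refine Finset.sum_congr rfl fun n _ => ?_
    congr 1
    push_cast
    rw [mul_comm]
  have hdm : ∀ n : ℕ, ((h * n % k : ℕ) : ℝ) = h * n - k * (h * n / k : ℕ) := by
    intro n
    have h1 : ((k * (h * n / k) + h * n % k : ℕ) : ℝ) = (h * n : ℕ) := by
      rw [Nat.div_add_mod]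
    push_cast at h1 ⊢
    linarith
  have p1 := hperm (fun x => (x : ℝ))
  have p2 := hperm (fun x => (x : ℝ) ^ 2)
  simp only [Int.cast_natCast] at p1 p2
  have hlat := sum_div_mul_div_add_one hh hk hc
  have hA := sum_mul_emod_eq h k
  have hA' := sum_mul_emod_eq k h
  unfold dedekindSum
  rw [hA, hA']
  simp only [hdm] at p1 p2
  have x1 : ∀ n : ℕ, ((h : ℝ) * n - k * (h * n / k : ℕ)) ^ 2 = h ^ 2 * (n : ℝ) ^ 2 -
      2 * h * k * ((n : ℝ) * (h * n / k : ℕ)) + k ^ 2 * ((h * n / k : ℕ) : ℝ) ^ 2 :=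
    fun n => by ring
  have x2 : ∀ n : ℕ, ((h * n / k : ℕ) : ℝ) * (((h * n / k : ℕ) : ℝ) + 1) =
      ((h * n / k : ℕ) : ℝ) ^ 2 + ((h * n / k : ℕ) : ℝ) := fun n => by ring
  have x3 : ∀ m : ℕ, 2 * (m : ℝ) * ((k : ℝ) - 1 - ((k * m / h : ℕ) : ℝ)) =
      2 * ((k : ℝ) - 1) * m - 2 * ((m : ℝ) * (k * m / h : ℕ)) := fun m => by ring
  simp only [x1] at p2
  simp only [x2, x3] at hlat
  rw [Finset.sum_sub_distrib, ← Finset.mul_sum, ← Finset.mul_sum, sum_range_id_real] at p1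
  rw [Finset.sum_add_distrib, Finset.sum_sub_distrib, ← Finset.mul_sum, ← Finset.mul_sum,
    ← Finset.mul_sum, sum_range_sq_real] at p2
  rw [Finset.sum_add_distrib, Finset.sum_sub_distrib, ← Finset.mul_sum, ← Finset.mul_sum,
    sum_range_id_real] at hlat
  generalize ∑ n ∈ Finset.range k, (n : ℝ) * ((h * n / k : ℕ) : ℝ) = X at p2 ⊢
  generalize ∑ n ∈ Finset.range h, (n : ℝ) * ((k * n / h : ℕ) : ℝ) = Y at hlat ⊢
  generalize ∑ n ∈ Finset.range k, ((h * n / k : ℕ) : ℝ) ^ 2 = F2 at p2 hlat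
  generalize ∑ n ∈ Finset.range k, ((h * n / k : ℕ) : ℝ) = F1 at p1 hlat
  have hF1 : F1 = (h - 1) * (k - 1) / 2 := by
    have : (k : ℝ) * F1 = k * ((h - 1) * (k - 1) / 2) := by linarith
    exact mul_left_cancel₀ hkR.ne' this
  have hX : X = ((h ^ 2 - 1) * (k * (k - 1) * (2 * k - 1) / 6) + k ^ 2 * F2) / (2 * h * k) := by
    rw [eq_div_iff (by positivity)]
    linarith
  have hY : Y = ((k : ℝ) - 1) * (h * (h - 1) / 2) - (F2 + F1) / 2 := by linarith
  rw [hY, hF1, hX]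
  field_simp
  ring

theorem ContFracData.coprime {α : ℝ} {a q : ℕ → ℕ} {p : ℕ → ℤ}
    (d : ContFracData α a q p) (k : ℕ) : Nat.Coprime (q k) (q (k + 1)) := by
  rw [← Nat.isCoprime_iff_coprime]
  refine ⟨(-1) ^ k * p (k + 1), -((-1) ^ k * p k), ?_⟩
  have h := d.det k
  have hs : ((-1 : ℤ) ^ k) * (-1) ^ k = 1 := by rw [← pow_add, ← two_mul]; simp
  linear_combination (-1) ^ k * h + hs

theorem ContFracData.isCoprime {α : ℝ} {a q : ℕ → ℕ} {p : ℕ → ℤ}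
    (d : ContFracData α a q p) (k : ℕ) : IsCoprime (p (k + 1)) (q (k + 1) : ℤ) := by
  refine ⟨(-1) ^ k * q k, -((-1) ^ k * p k), ?_⟩
  have h := d.det k
  have hs : ((-1 : ℤ) ^ k) * (-1) ^ k = 1 := by rw [← pow_add, ← two_mul]; simp
  linear_combination (-1) ^ k * h + hs

/-- The determinant identity makes `q k` the inverse of `p (k + 1)` modulo `q (k + 1)`, up to the
sign `(-1) ^ k`. This brings the sum to a form to which reciprocity and the Euclidean algorithm
apply. -/
theorem ContFracData.dedekindSum_convergent {α : ℝ} {a q : ℕ → ℕ} {p : ℕ → ℤ}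
    (d : ContFracData α a q p) (k : ℕ) :
    dedekindSum (p (k + 1)) (q (k + 1)) = (-1) ^ k * dedekindSum (q k) (q (k + 1)) := by
  have h := d.det k
  have hmod : p (k + 1) * q k ≡ (-1) ^ k [ZMOD q (k + 1)] := by
    rw [Int.modEq_iff_dvd]
    exact ⟨-p k, by linear_combination -h⟩
  rcases neg_one_pow_eq_or ℤ k with hk | hk
  · rw [hk] at hmod
    rw [dedekindSum_of_inverse hmod]
    have : (-1 : ℝ) ^ k = 1 := by exact_mod_cast congrArg (Int.cast : ℤ → ℝ) hk
    rw [this, one_mul]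
  · rw [hk] at hmod
    have h2 : -p (k + 1) * q k ≡ 1 [ZMOD q (k + 1)] := by
      have := hmod.neg
      rwa [neg_neg, ← neg_mul] at this
    rw [← dedekindSum_of_inverse h2, dedekindSum_neg (d.q_pos _) (d.isCoprime k)]
    have : (-1 : ℝ) ^ k = -1 := by exact_mod_cast congrArg (Int.cast : ℤ → ℝ) hk
    rw [this]
    ring

/-- The Dedekind sums of the convergents are alternating sums of partial quotients, up to a
bounded error. -/
theorem ContFracData.exists_abs_dedekindSum_le {α : ℝ} {a q : ℕ → ℕ} {p : ℕ → ℤ}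
    (d : ContFracData α a q p) : ∃ C : ℝ, ∀ k,
    |12 * dedekindSum (p (k + 1)) (q (k + 1)) +
      ∑ j ∈ Finset.Icc 1 (k + 1), (-1 : ℝ) ^ j * a j| ≤ C := by
  -- The corrections make each reciprocity step exact: two copies of `3 / 2` cancel the constant `12
  -- * (-1 / 4)`, the ratio `q k / q (k + 1)` telescopes, and the convergent absorbs the term `1 /
  -- (h * k)`, which is the difference of consecutive convergents up to sign.
  obtain ⟨W, hW⟩ : ∃ W : ℕ → ℝ, ∀ k, W k = (-1) ^ (k + 1) * (12 * dedekindSum (q k) (q (k + 1)) -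
      (q k : ℝ) / q (k + 1) + 3 / 2) + (p (k + 1) : ℝ) / q (k + 1) := ⟨_, fun _ => rfl⟩
  have hqR : ∀ k, (0 : ℝ) < q k := fun k => by exact_mod_cast d.q_pos k
  have hstep : ∀ k, W (k + 1) = W k + (-1) ^ (k + 2) * a (k + 2) := by
    intro k
    have hrec := dedekindSum_add_dedekindSum (d.q_pos (k + 1)) (d.q_pos (k + 2)) (d.coprime (k + 1))
    have hmod : (q (k + 2) : ℤ) ≡ q k [ZMOD q (k + 1)] := by
      rw [Int.modEq_iff_dvd, d.q_rec]
      exact ⟨-a (k + 2), by push_cast; ring⟩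
    rw [dedekindSum_congr hmod] at hrec
    have hq2 : (q (k + 2) : ℝ) = a (k + 2) * q (k + 1) + q k := by exact_mod_cast d.q_rec k
    have hdiv : (q (k + 2) : ℝ) / q (k + 1) = a (k + 2) + q k / q (k + 1) := by
      rw [hq2]; field_simp [(hqR (k + 1)).ne']
    have hdet : (p (k + 2) : ℝ) * q (k + 1) - p (k + 1) * q (k + 2) = (-1) ^ (k + 1) := by
      exact_mod_cast d.det (k + 1)
    have hp : (p (k + 2) : ℝ) / q (k + 2) = p (k + 1) / q (k + 1) +
        (-1) ^ (k + 1) * (1 / (q (k + 1) * q (k + 2))) := by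
      rw [← hdet]
      field_simp [(hqR (k + 1)).ne', (hqR (k + 2)).ne']
      ring
    rw [hdiv] at hrec
    rw [hW, hW, show k + 1 + 1 = k + 2 from rfl, hp]
    rw [show (-1 : ℝ) ^ (k + 2) = -(-1) ^ (k + 1) by rw [pow_succ]; ring]
    linear_combination -12 * (-1 : ℝ) ^ (k + 1) * hrec
  have hsum : ∀ k, W k = W 0 + a 1 + ∑ j ∈ Finset.Icc 1 (k + 1), (-1 : ℝ) ^ j * a j := by
    intro k
    induction k with
    | zero => simp
    | succ k ih =>
      rw [hstep, ih, Finset.sum_Icc_succ_top (show 1 ≤ k + 1 + 1 by omega)]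
      ring
  refine ⟨|W 0 + a 1| + (|α| + 1) + 5 / 2, fun k => ?_⟩
  have hα : |(p (k + 1) : ℝ) / q (k + 1)| ≤ |α| + 1 := by
    have h1 := d.abs_convergent_le (k + 1)
    have h2 : (1 : ℝ) ≤ q (k + 2) := by exact_mod_cast d.q_pos (k + 2)
    have h3 : (1 : ℝ) ≤ q (k + 1) := by exact_mod_cast d.q_pos (k + 1)
    have h4 : |(q (k + 1) : ℝ) * α - p (k + 1)| ≤ 1 :=
      (le_mul_of_one_le_right (abs_nonneg _) h2).trans h1
    rw [abs_div, Nat.abs_cast, div_le_iff₀ (hqR _)]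
    have h5 : |(p (k + 1) : ℝ)| ≤ |(q (k + 1) : ℝ) * α| + |(q (k + 1) : ℝ) * α - p (k + 1)| := by
      have := abs_sub_abs_le_abs_sub (p (k + 1) : ℝ) ((q (k + 1) : ℝ) * α)
      rw [abs_sub_comm] at this
      linarith
    rw [abs_mul, Nat.abs_cast] at h5
    nlinarith
  have hr : |(q k : ℝ) / q (k + 1)| ≤ 1 := by
    rw [abs_of_nonneg (by positivity), div_le_one (hqR _)]
    exact_mod_cast d.q_mono (Nat.le_succ k)
  have key : 12 * dedekindSum (p (k + 1)) (q (k + 1)) +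
      ∑ j ∈ Finset.Icc 1 (k + 1), (-1 : ℝ) ^ j * a j =
      -(W 0 + a 1) + (p (k + 1) : ℝ) / q (k + 1) + (-1) ^ k * ((q k : ℝ) / q (k + 1) - 3 / 2) := by
    have h1 := hsum k
    rw [hW k] at h1
    rw [d.dedekindSum_convergent]
    rw [pow_succ] at h1
    linear_combination -h1
  rw [key]
  refine (abs_add_le _ _).trans (add_le_add ((abs_add_le _ _).trans (add_le_add ?_ hα)) ?_)
  · rw [abs_neg]
  · rw [abs_mul, abs_pow, abs_neg, abs_one, one_pow, one_mul]
    refine (abs_sub _ _).trans ?_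
    rw [abs_of_pos (show (0 : ℝ) < 3 / 2 by norm_num)]
    linarith

/-! ### Fourier analysis on `ℤ / Q` and the variance of sawtooth sums. -/

/-- The discrete Fourier transform of a real function on `ℤ / Q`. -/
noncomputable def cyclicFourier {Q : ℕ} [NeZero Q] (x : ZMod Q → ℝ) (j : ZMod Q) : ℂ :=
  ∑ M, ZMod.stdAddChar (M * j) * (x M : ℂ)

theorem sum_norm_sq_cyclicFourier {Q : ℕ} [NeZero Q] (x : ZMod Q → ℝ) :
    ∑ j, ‖cyclicFourier x j‖ ^ 2 = Q * ∑ M, x M ^ 2 := by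
  have e : ∀ j : ZMod Q, ((‖cyclicFourier x j‖ ^ 2 : ℝ) : ℂ) =
      ∑ M, ∑ M', ZMod.stdAddChar (j * (M - M')) * ((x M : ℂ) * x M') := by
    intro j
    rw [← Complex.normSq_eq_norm_sq, ← Complex.mul_conj]
    unfold cyclicFourier
    rw [map_sum, Finset.sum_mul_sum]
    refine Finset.sum_congr rfl fun M _ => Finset.sum_congr rfl fun M' _ => ?_
    rw [map_mul (starRingEnd ℂ), Complex.conj_ofReal, ← AddChar.map_neg_eq_conj,
      show j * (M - M') = M * j + -(M' * j) by ring, AddChar.map_add_eq_mul]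
    ring
  have h : ((∑ j, ‖cyclicFourier x j‖ ^ 2 : ℝ) : ℂ) = ((Q * ∑ M, x M ^ 2 : ℝ) : ℂ) := by
    rw [Complex.ofReal_sum]
    simp_rw [e]
    rw [Finset.sum_comm]
    simp_rw [Finset.sum_comm (s := (Finset.univ : Finset (ZMod Q))) (t := Finset.univ)
      (f := fun j M' => ZMod.stdAddChar (j * (_ - M')) * _), ← Finset.sum_mul,
      AddChar.sum_mulShift _ (ZMod.isPrimitive_stdAddChar Q), sub_eq_zero, ZMod.card]
    push_cast
    rw [Finset.mul_sum]
    refine Finset.sum_congr rfl fun M _ => ?_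
    rw [Finset.sum_eq_single M]
    · rw [if_pos rfl]; ring
    · intro M' _ hM'
      rw [if_neg hM'.symm]; simp
    · simp
  exact_mod_cast h

theorem cyclicFourier_shift_sub {Q : ℕ} [NeZero Q] (x : ZMod Q → ℝ) (r j : ZMod Q) :
    cyclicFourier (fun M => x (M + r) - x M) j =
      (ZMod.stdAddChar (-(r * j)) - 1) * cyclicFourier x j := by
  unfold cyclicFourier
  have h : ∑ M, ZMod.stdAddChar (M * j) * ((x (M + r) : ℝ) : ℂ) =
      ZMod.stdAddChar (-(r * j)) * ∑ M, ZMod.stdAddChar (M * j) * ((x M : ℝ) : ℂ) := by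
    rw [Finset.mul_sum]
    refine Fintype.sum_equiv (Equiv.addRight r) _ _ fun M => ?_
    rw [Equiv.coe_addRight, ← mul_assoc, ← AddChar.map_add_eq_mul]
    congr 2
    ring
  rw [sub_mul, one_mul, ← h, ← Finset.sum_sub_distrib]
  refine Finset.sum_congr rfl fun M _ => ?_
  push_cast
  ring

theorem cyclicFourier_const_sub_ite {Q : ℕ} [NeZero Q] (c : ℝ) (b : ZMod Q) {j : ZMod Q}
    (hj : j ≠ 0) : cyclicFourier (fun M => c - if M = b then 1 else 0) j =
      -ZMod.stdAddChar (b * j) := by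
  unfold cyclicFourier
  have e : ∀ M, ((c - if M = b then 1 else 0 : ℝ) : ℂ) = c - if M = b then 1 else 0 := by
    intro M; split_ifs <;> simp
  simp_rw [e, mul_sub]
  rw [Finset.sum_sub_distrib, ← Finset.sum_mul,
    AddChar.sum_mulShift _ (ZMod.isPrimitive_stdAddChar Q), if_neg hj]
  simp

theorem norm_stdAddChar_sub_one_ge {Q : ℕ} [NeZero Q] (m : ℤ) :
    4 * |(m : ℝ) / Q - round ((m : ℝ) / Q)| ≤ ‖ZMod.stdAddChar (-(m : ZMod Q)) - 1‖ := by
  have h1 : ZMod.stdAddChar (-(m : ZMod Q)) =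
      Complex.exp (Complex.I * ((-(2 * Real.pi * ((m : ℝ) / Q)) : ℝ) : ℂ)) := by
    have := ZMod.stdAddChar_coe (N := Q) (-m)
    rw [Int.cast_neg] at this
    rw [this]
    congr 1
    push_cast
    ring
  rw [h1, Complex.norm_exp_I_mul_ofReal_sub_one,
    show -(2 * Real.pi * ((m : ℝ) / Q)) / 2 = -(Real.pi * ((m : ℝ) / Q)) by ring, Real.sin_neg,
    norm_mul, norm_neg, Real.norm_eq_abs, Real.norm_eq_abs, abs_two]
  have h2 := four_mul_sq_le_sin_sq ((m : ℝ) / Q)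
  have h3 : 2 * |(m : ℝ) / Q - round ((m : ℝ) / Q)| ≤ |Real.sin (Real.pi * ((m : ℝ) / Q))| := by
    rw [← abs_two (α := ℝ), ← abs_mul, ← sq_le_sq, mul_pow]
    linarith
  linarith

theorem val_add_one_cases {Q : ℕ} [NeZero Q] (M : ZMod Q) :
    ((M + 1).val = M.val + 1 ∧ M ≠ -1) ∨ ((M + 1).val = 0 ∧ M.val + 1 = Q ∧ M = -1) := by
  have hlt := ZMod.val_lt M
  have hval : (M + 1).val = (M.val + 1) % Q := by
    rw [ZMod.val_add, ZMod.val_one_eq_one_mod, Nat.add_mod_mod]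
  have hiff : M = -1 ↔ (M + 1).val = 0 := by
    rw [ZMod.val_eq_zero, eq_neg_iff_add_eq_zero]
  rcases Nat.lt_or_ge (M.val + 1) Q with h | h
  · left
    rw [Nat.mod_eq_of_lt h] at hval
    exact ⟨hval, fun h' => by rw [hiff] at h'; omega⟩
  · right
    have h2 : M.val + 1 = Q := by omega
    rw [h2, Nat.mod_self] at hval
    exact ⟨hval, h2, hiff.2 hval⟩

theorem sum_zmod_eq_sum_range {Q : ℕ} [NeZero Q] {β : Type*} [AddCommMonoid β] (g : ZMod Q → β) :
    ∑ j, g j = ∑ i ∈ Finset.range Q, g (i : ZMod Q) := by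
  refine Finset.sum_bij' (fun j _ => j.val) (fun i _ => (i : ZMod Q)) ?_ ?_ ?_ ?_ ?_
  · intro j _; exact Finset.mem_range.2 (ZMod.val_lt j)
  · intro i _; exact Finset.mem_univ _
  · intro j _; simp
  · intro i hi; exact ZMod.val_cast_of_lt (Finset.mem_range.1 hi)
  · intro j _; simp

/-- The centred sawtooth at the multiples of `p / q`; its sum over a period vanishes. -/
noncomputable def centredSaw (p : ℤ) (Q n : ℕ) : ℝ :=
  (((n : ℤ) * p % Q : ℤ) : ℝ) / Q - 1 / 2 + 1 / (2 * Q)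

noncomputable def centredSawSum (p : ℤ) (Q M : ℕ) : ℝ :=
  ∑ n ∈ Finset.range M, centredSaw p Q n

/-- The residues of `n * p` run through `0, …, Q - 1`; divided by `Q` they have mean `1/2 - 1/(2Q)`.
-/
theorem centredSawSum_period {p r : ℤ} {Q : ℕ} (hQ : 0 < Q) (h : p * r ≡ 1 [ZMOD Q]) :
    centredSawSum p Q Q = 0 := by
  have hQR : (0 : ℝ) < Q := by exact_mod_cast hQ
  unfold centredSawSum centredSaw
  rw [sum_range_emod_of_inverse h (fun _ y : ℤ => (y : ℝ) / Q - 1 / 2 + 1 / (2 * Q))]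
  simp only [Int.cast_natCast]
  rw [Finset.sum_add_distrib, Finset.sum_sub_distrib, ← Finset.sum_div, sum_range_id_real]
  simp only [Finset.sum_const, Finset.card_range, nsmul_eq_mul]
  field_simp
  ring

/-- Two differences reduce the sums to a point mass. The difference with step `1` is the sawtooth `F
(p M)`; the difference of that with step `r` is `F (p M + 1) - F (p M)`, a constant minus a point
mass, whose nonzero Fourier coefficients have modulus `1`. At the frequency `i * p` the two steps
produce the factors `e(-ip/Q) - 1` and `e(-i/Q) - 1`. -/
theorem norm_mul_norm_cyclicFourier_centredSawSum {p r : ℤ} {Q : ℕ} [NeZero Q]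
    (h : p * r ≡ 1 [ZMOD Q]) {i : ℕ} (hi0 : 0 < i) (hi : i < Q) :
    ‖ZMod.stdAddChar (-((i : ℤ) : ZMod Q)) - 1‖ *
      (‖ZMod.stdAddChar (-(((i : ℤ) * p : ℤ) : ZMod Q)) - 1‖ *
        ‖cyclicFourier (fun M : ZMod Q => centredSawSum p Q M.val) (((i : ℤ) * p : ℤ) : ZMod Q)‖)
      = 1 := by
  have hQ : 0 < Q := NeZero.pos Q
  have hQR : (0 : ℝ) < Q := by exact_mod_cast hQ
  have hpr : (p : ZMod Q) * (r : ZMod Q) = 1 := by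
    have := (ZMod.intCast_eq_intCast_iff _ _ _).2 h
    push_cast at this
    exact this
  set j : ZMod Q := (((i : ℤ) * p : ℤ) : ZMod Q) with hj
  have hrj : (r : ZMod Q) * j = ((i : ℤ) : ZMod Q) := by
    rw [hj]; push_cast; linear_combination (i : ZMod Q) * hpr
  have hj0 : j ≠ 0 := by
    intro h0
    rw [h0, mul_zero] at hrj
    have h1 : ((i : ℕ) : ZMod Q) = 0 := by exact_mod_cast hrj.symm
    rw [ZMod.natCast_eq_zero_iff] at h1
    have := Nat.le_of_dvd hi0 h1
    omega
  let F : ZMod Q → ℝ := fun m => (m.val : ℝ) / Q - 1 / 2 + 1 / (2 * Q)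
  have hF : ∀ m, F (m + 1) - F m = 1 / Q - if m = -1 then 1 else 0 := by
    intro m
    simp only [F]
    rcases val_add_one_cases m with ⟨h1, h2⟩ | ⟨h1, h2, h3⟩
    · rw [h1, if_neg h2]; push_cast; ring
    · rw [h1, if_pos h3]
      have : (m.val : ℝ) = Q - 1 := by
        rw [eq_sub_iff_add_eq]; exact_mod_cast h2
      rw [this]
      field_simp
      push_cast
      ring
  have hfF : ∀ M : ZMod Q, centredSaw p Q M.val = F ((p : ZMod Q) * M) := by
    intro M
    simp only [F, centredSaw]
    have h1 := ZMod.val_intCast (n := Q) ((M.val : ℤ) * p)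
    push_cast at h1
    rw [ZMod.natCast_zmod_val, mul_comm M] at h1
    rw [← h1]
    push_cast
    rfl
  have h1 : (fun M : ZMod Q => centredSawSum p Q (M + 1).val - centredSawSum p Q M.val) =
      fun M => F ((p : ZMod Q) * M) := by
    ext M
    rw [← hfF]
    rcases val_add_one_cases M with ⟨h1, -⟩ | ⟨h1, h2, -⟩
    · rw [h1, centredSawSum, Finset.sum_range_succ, centredSawSum]
      ring
    -- At the wraparound the difference formula survives because the sum over a full period
    -- vanishes.
    · have h3 := centredSawSum_period hQ h
      have h4 : centredSawSum p Q Q = centredSawSum p Q M.val + centredSaw p Q M.val :=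
        (congrArg (centredSawSum p Q) h2.symm).trans
          (Finset.sum_range_succ (fun n => centredSaw p Q n) M.val)
      rw [h1, show centredSawSum p Q 0 = 0 by simp [centredSawSum]]
      linarith
  have h2 : (fun M : ZMod Q => F ((p : ZMod Q) * (M + r)) - F ((p : ZMod Q) * M)) =
      fun M => 1 / (Q : ℝ) - if M = -(r : ZMod Q) then 1 else 0 := by
    ext M
    rw [mul_add, hpr, hF]
    have : (p : ZMod Q) * M = -1 ↔ M = -(r : ZMod Q) := by
      constructor
      · intro h'
        linear_combination (r : ZMod Q) * h' - M * hpr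
      · intro h'
        rw [h']
        linear_combination -hpr
    simp only [this]
  have e1 := cyclicFourier_shift_sub (fun M : ZMod Q => centredSawSum p Q M.val) 1 j
  have e2 := cyclicFourier_shift_sub (fun M : ZMod Q => F ((p : ZMod Q) * M)) r j
  rw [h1, one_mul] at e1
  rw [h2, e1, hrj, cyclicFourier_const_sub_ite _ _ hj0] at e2
  have e3 := congrArg norm e2
  rw [norm_neg, AddChar.norm_apply, norm_mul, norm_mul] at e3
  exact e3.symm

theorem abs_sub_round_int_sub (m : ℤ) (x : ℝ) :
    |(m - x) - round ((m : ℝ) - x)| = |x - round x| := by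
  refine le_antisymm ?_ ?_
  · refine (round_le _ (m - round x)).trans (le_of_eq ?_)
    rw [abs_sub_comm x]
    push_cast
    congr 1
    ring
  · refine (round_le _ (m - round ((m : ℝ) - x))).trans (le_of_eq ?_)
    rw [abs_sub_comm]
    push_cast
    congr 1
    ring

theorem one_div_abs_sub_round_sq_le {i Q : ℕ} (hi0 : 0 < i) (hi : i < Q) :
    1 / ((i : ℝ) / Q - round ((i : ℝ) / Q)) ^ 2 ≤
      (Q : ℝ) ^ 2 * (1 / (i : ℝ) ^ 2 + 1 / ((Q : ℝ) - i) ^ 2) := by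
  have hQR : (0 : ℝ) < Q := by exact_mod_cast hi0.trans hi
  have hiR : (0 : ℝ) < i := by exact_mod_cast hi0
  have hiQ : (0 : ℝ) < Q - i := by rw [sub_pos]; exact_mod_cast hi
  generalize round ((i : ℝ) / Q) = m
  have e : ((i : ℝ) / Q - m) = (i - m * Q) / Q := by field_simp
  rw [e, div_pow, one_div_div, div_eq_mul_one_div]
  refine mul_le_mul_of_nonneg_left ?_ (by positivity)
  rcases le_or_gt m 0 with hm | hm
  · have hmR : (m : ℝ) ≤ 0 := by exact_mod_cast hm
    have : (i : ℝ) ≤ i - m * Q := by nlinarith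
    calc 1 / ((i : ℝ) - m * Q) ^ 2 ≤ 1 / (i : ℝ) ^ 2 := by gcongr
      _ ≤ _ := le_add_of_nonneg_right (by positivity)
  · have hmR : (1 : ℝ) ≤ m := by exact_mod_cast hm
    have : (Q : ℝ) - i ≤ m * Q - i := by nlinarith
    calc 1 / ((i : ℝ) - m * Q) ^ 2 = 1 / (m * Q - (i : ℝ)) ^ 2 := by rw [sub_sq_comm]
      _ ≤ 1 / ((Q : ℝ) - i) ^ 2 := by gcongr
      _ ≤ _ := le_add_of_nonneg_left (by positivity)

/-- The variance of the centred sawtooth sums over one period. -/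
theorem sum_sq_centredSawSum_le {p r : ℤ} {Q : ℕ} (hQ : 0 < Q) (h : p * r ≡ 1 [ZMOD Q]) :
    1 / (Q : ℝ) * ∑ M ∈ Finset.range Q, centredSawSum p Q M ^ 2 ≤
      (1 / (Q : ℝ) * ∑ M ∈ Finset.range Q, centredSawSum p Q M) ^ 2 +
        ∑ i ∈ Finset.Ico 1 Q,
          1 / ((i : ℝ) * ((p : ℝ) / Q) - round ((i : ℝ) * ((p : ℝ) / Q))) ^ 2 / (i : ℝ) ^ 2 := by
  have : NeZero Q := ⟨hQ.ne'⟩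
  have hQR : (0 : ℝ) < Q := by exact_mod_cast hQ
  obtain ⟨F, hF⟩ : ∃ F : ℕ → ℝ, ∀ i, F i =
      1 / ((i : ℝ) * ((p : ℝ) / Q) - round ((i : ℝ) * ((p : ℝ) / Q))) ^ 2 := ⟨_, fun _ => rfl⟩
  have hF0 : ∀ i, 0 ≤ F i := fun i => by rw [hF]; positivity
  have hpr : (p : ZMod Q) * (r : ZMod Q) = 1 := by
    have := (ZMod.intCast_eq_intCast_iff _ _ _).2 h
    push_cast at this
    exact this
  let Φ : ZMod Q → ℝ := fun M => centredSawSum p Q M.val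
  have hparseval := sum_norm_sq_cyclicFourier Φ
  -- Frequencies are indexed as `j = i * p`, so that the weights become `‖i/Q‖` and `‖ip/Q‖`, the
  -- shape treated by `exists_sum_main_range_le`.
  have hre : ∑ j, ‖cyclicFourier Φ j‖ ^ 2 = ∑ i, ‖cyclicFourier Φ (i * p)‖ ^ 2 := by
    refine (Fintype.sum_equiv (Units.mulRight ⟨(p : ZMod Q), r, hpr, by rw [mul_comm, hpr]⟩) _ _
      fun i => ?_).symm
    rfl
  have hΦ : ∀ g : ℝ → ℝ, ∑ M, g (Φ M) = ∑ M ∈ Finset.range Q, g (centredSawSum p Q M) := by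
    intro g
    rw [sum_zmod_eq_sum_range]
    refine Finset.sum_congr rfl fun i hi => ?_
    simp only [Φ]
    rw [ZMod.val_cast_of_lt (Finset.mem_range.1 hi)]
  rw [hre, hΦ (fun y => y ^ 2), sum_zmod_eq_sum_range, Finset.range_eq_Ico,
    Finset.sum_eq_sum_Ico_succ_bot hQ] at hparseval
  have hzero : ‖cyclicFourier Φ (((0 : ℕ) : ZMod Q) * p)‖ ^ 2 =
      (∑ M ∈ Finset.range Q, centredSawSum p Q M) ^ 2 := by
    rw [← hΦ (fun y => y), Nat.cast_zero, zero_mul, cyclicFourier]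
    simp only [mul_zero, AddChar.map_zero_eq_one, one_mul]
    rw [← Complex.ofReal_sum, Complex.norm_real, Real.norm_eq_abs, sq_abs]
  rw [hzero, ← Finset.range_eq_Ico] at hparseval
  have hterm : ∀ i ∈ Finset.Ico 1 Q, ‖cyclicFourier Φ ((i : ZMod Q) * p)‖ ^ 2 ≤
      1 / 256 * (Q : ℝ) ^ 2 * (F i / (i : ℝ) ^ 2 + F i / ((Q : ℝ) - i) ^ 2) := by
    intro i hi
    rw [Finset.mem_Ico] at hi
    have hprod := norm_mul_norm_cyclicFourier_centredSawSum h hi.1 hi.2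
    have n1 := norm_stdAddChar_sub_one_ge (Q := Q) (i : ℤ)
    have n2 := norm_stdAddChar_sub_one_ge (Q := Q) ((i : ℤ) * p)
    rw [show (((i : ℤ) * p : ℤ) : ZMod Q) = (i : ZMod Q) * p by push_cast; rfl] at hprod n2
    rw [show (((i : ℤ) * p : ℤ) : ℝ) / Q = (i : ℝ) * ((p : ℝ) / Q) by push_cast; ring] at n2
    rw [Int.cast_natCast] at n1
    change _ * (_ * ‖cyclicFourier Φ _‖) = 1 at hprod
    generalize ‖ZMod.stdAddChar (-((i : ℤ) : ZMod Q)) - 1‖ = A at hprod n1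
    generalize ‖ZMod.stdAddChar (-((i : ZMod Q) * (p : ZMod Q))) - 1‖ = B at hprod n2
    have hE := norm_nonneg (cyclicFourier Φ ((i : ZMod Q) * p))
    generalize ‖cyclicFourier Φ ((i : ZMod Q) * p)‖ = E at hprod hE ⊢
    have hround := one_div_abs_sub_round_sq_le hi.1 hi.2
    have hFi := hF i
    have hx0 := abs_nonneg ((i : ℝ) / Q - round ((i : ℝ) / Q))
    have hy0 := abs_nonneg ((i : ℝ) * ((p : ℝ) / Q) - round ((i : ℝ) * ((p : ℝ) / Q)))
    rw [← sq_abs] at hround hFi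
    -- neither distance vanishes, since `Q` divides neither `i` nor `i * p`
    have hxpos : 0 < |(i : ℝ) / Q - round ((i : ℝ) / Q)| := by
      refine lt_of_le_of_ne hx0 fun h0 => ?_
      have h1 := sub_eq_zero.1 (abs_eq_zero.1 h0.symm)
      rw [div_eq_iff hQR.ne'] at h1
      have h2 : (i : ℤ) = round ((i : ℝ) / Q) * Q := by exact_mod_cast h1
      have h3 : (Q : ℤ) ∣ i := ⟨_, by rw [mul_comm]; exact h2⟩
      have := Nat.le_of_dvd hi.1 (by exact_mod_cast h3)
      omega
    have hypos : 0 < |(i : ℝ) * ((p : ℝ) / Q) - round ((i : ℝ) * ((p : ℝ) / Q))| := by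
      refine lt_of_le_of_ne hy0 fun h0 => ?_
      have h1 := sub_eq_zero.1 (abs_eq_zero.1 h0.symm)
      rw [← mul_div_assoc, div_eq_iff hQR.ne'] at h1
      have h2 : (i : ℤ) * p = round ((i : ℝ) * p / Q) * Q := by
        exact_mod_cast h1
      have h3 : (((i : ℤ) * p : ℤ) : ZMod Q) = 0 := by
        rw [h2]; push_cast; simp
      have h4 : ((i : ℕ) : ZMod Q) = 0 := by
        push_cast at h3
        calc ((i : ℕ) : ZMod Q) = (i : ZMod Q) * p * r := by rw [mul_assoc, hpr, mul_one]
          _ = 0 := by rw [h3, zero_mul]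
      rw [ZMod.natCast_eq_zero_iff] at h4
      have := Nat.le_of_dvd hi.1 h4
      omega
    generalize |(i : ℝ) / Q - round ((i : ℝ) / Q)| = x at *
    generalize |(i : ℝ) * ((p : ℝ) / Q) - round ((i : ℝ) * ((p : ℝ) / Q))| = y at *
    -- Each factor `|e(t) - 1|` is at least `4‖t‖`; squaring the product of the two constants gives
    -- `256`.
    have h16 : 16 * x * y * E ≤ 1 := by
      have hA : 0 ≤ A := by linarith
      have : (4 * x) * ((4 * y) * E) ≤ A * (B * E) := by gcongr
      nlinarith
    have hEle : E ^ 2 ≤ 1 / 256 * (1 / x ^ 2) * (1 / y ^ 2) := by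
      have h1 : E ≤ 1 / (16 * x * y) := by
        rw [le_div_iff₀ (by positivity)]; linarith
      calc E ^ 2 ≤ (1 / (16 * x * y)) ^ 2 := by gcongr
        _ = _ := by field_simp; norm_num
    calc E ^ 2 ≤ 1 / 256 * (1 / x ^ 2) * (1 / y ^ 2) := hEle
      _ ≤ 1 / 256 * ((Q : ℝ) ^ 2 * (1 / (i : ℝ) ^ 2 + 1 / ((Q : ℝ) - i) ^ 2)) * (1 / y ^ 2) := by
          gcongr
      _ = _ := by rw [hFi]; ring
  -- The reflection `i ↦ Q - i` preserves the distance of `i * p / Q` to `ℤ`.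
  have hreflect : ∑ i ∈ Finset.Ico 1 Q, F i / ((Q : ℝ) - i) ^ 2 =
      ∑ i ∈ Finset.Ico 1 Q, F i / (i : ℝ) ^ 2 := by
    refine Finset.sum_bij' (fun i _ => Q - i) (fun i _ => Q - i) ?_ ?_ ?_ ?_ ?_
    · intro i hi; rw [Finset.mem_Ico] at hi ⊢; omega
    · intro i hi; rw [Finset.mem_Ico] at hi ⊢; omega
    · intro i hi; rw [Finset.mem_Ico] at hi; omega
    · intro i hi; rw [Finset.mem_Ico] at hi; omega
    · intro i hi
      rw [Finset.mem_Ico] at hi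
      have hc : ((Q - i : ℕ) : ℝ) = (Q : ℝ) - i := Nat.cast_sub hi.2.le
      rw [hc, hF, hF, hc]
      have e : ((Q : ℝ) - i) * ((p : ℝ) / Q) = (p : ℝ) - i * ((p : ℝ) / Q) := by field_simp
      have habs := abs_sub_round_int_sub p (i * ((p : ℝ) / Q))
      rw [e, ← sq_abs, ← sq_abs ((p : ℝ) - i * ((p : ℝ) / Q) - _), habs]
  have hsum := Finset.sum_le_sum hterm
  rw [← Finset.mul_sum, Finset.sum_add_distrib, hreflect] at hsum
  simp_rw [← hF]
  have hS0 : 0 ≤ ∑ i ∈ Finset.Ico 1 Q, F i / (i : ℝ) ^ 2 :=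
    Finset.sum_nonneg fun i _ => div_nonneg (hF0 i) (by positivity)
  generalize ∑ i ∈ Finset.Ico 1 Q, F i / (i : ℝ) ^ 2 = R at *
  rw [zero_add] at hparseval
  have hfin : (Q : ℝ) * ∑ M ∈ Finset.range Q, centredSawSum p Q M ^ 2 ≤
      (∑ M ∈ Finset.range Q, centredSawSum p Q M) ^ 2 + (Q : ℝ) ^ 2 * R := by
    rw [← hparseval]
    have : 1 / 256 * (Q : ℝ) ^ 2 * (R + R) ≤ (Q : ℝ) ^ 2 * R := by nlinarith [sq_nonneg (Q : ℝ), mul_nonneg (sq_nonneg (Q : ℝ)) hS0]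
    linarith
  calc 1 / (Q : ℝ) * ∑ M ∈ Finset.range Q, centredSawSum p Q M ^ 2
      = 1 / (Q : ℝ) ^ 2 * (Q * ∑ M ∈ Finset.range Q, centredSawSum p Q M ^ 2) := by field_simp
    _ ≤ 1 / (Q : ℝ) ^ 2 * ((∑ M ∈ Finset.range Q, centredSawSum p Q M) ^ 2 + (Q : ℝ) ^ 2 * R) := by
        gcongr
    _ = _ := by field_simp

/-! ### Sawtooth sums of `α` compared with those of its convergents. -/

/-- Summation by parts: `f n` occurs in `Q - 1 - n` of the partial sums. -/
theorem sum_range_sum_range_add (f : ℕ → ℝ) (Q : ℕ) :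
    ∑ M ∈ Finset.range Q, ∑ n ∈ Finset.range M, f n + ∑ n ∈ Finset.range Q, (n : ℝ) * f n =
      ((Q : ℝ) - 1) * ∑ n ∈ Finset.range Q, f n := by
  induction Q with
  | zero => simp
  | succ Q ih =>
    rw [Finset.sum_range_succ, Finset.sum_range_succ (fun n => (n : ℝ) * f n),
      Finset.sum_range_succ f]
    push_cast
    linarith

/-- As the full sum vanishes, summation by parts leaves `-∑ n * centredSaw p Q n`, which is a
Dedekind sum up to elementary terms. -/
theorem average_centredSawSum {p r : ℤ} {Q : ℕ} (hQ : 0 < Q) (h : p * r ≡ 1 [ZMOD Q]) :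
    1 / (Q : ℝ) * ∑ M ∈ Finset.range Q, centredSawSum p Q M =
      -dedekindSum p Q - ((Q : ℝ) - 1) / (4 * Q) := by
  have hQR : (0 : ℝ) < Q := by exact_mod_cast hQ
  have h1 := sum_range_sum_range_add (centredSaw p Q) Q
  have h2 := centredSawSum_period hQ h
  rw [centredSawSum] at h2
  rw [h2, mul_zero] at h1
  have e : ∀ n : ℕ, (n : ℝ) * centredSaw p Q n =
      (((n : ℤ) * ((n : ℤ) * p % Q) : ℤ) : ℝ) / Q - n * (1 / 2 - 1 / (2 * Q)) := by
    intro n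
    unfold centredSaw
    push_cast
    ring
  simp_rw [e] at h1
  rw [Finset.sum_sub_distrib, ← Finset.sum_div, ← Finset.sum_mul, sum_range_id_real,
    ← Int.cast_sum] at h1
  change ∑ M ∈ Finset.range Q, centredSawSum p Q M + _ = 0 at h1
  rw [eq_neg_of_add_eq_zero_left h1, dedekindSum]
  field_simp
  ring

theorem ContFracData.exists_inverse {α : ℝ} {a q : ℕ → ℕ} {p : ℕ → ℤ}
    (d : ContFracData α a q p) (k : ℕ) : ∃ r : ℤ, p (k + 1) * r ≡ 1 [ZMOD q (k + 1)] := by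
  obtain ⟨u, v, h⟩ := d.isCoprime k
  refine ⟨u, Int.modEq_iff_dvd.2 ⟨v, by linear_combination -h⟩⟩

/-- `nα` and `np/q` differ by less than `1/q`, while for `0 < n < q` the residue of `np` lies
between `1` and `q - 1`. So no integer lies between them and their floors agree. -/
theorem ContFracData.abs_fract_sub_le {α : ℝ} {a q : ℕ → ℕ} {p : ℕ → ℤ}
    (d : ContFracData α a q p) (k : ℕ) {n : ℕ} (hn : n < q (k + 1)) :
    |Int.fract ((n : ℝ) * α) - (((n : ℤ) * p (k + 1) % q (k + 1) : ℤ) : ℝ) / q (k + 1)| ≤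
      1 / q (k + 1) := by
  have hQ := d.q_pos (k + 1)
  have hQR : (0 : ℝ) < q (k + 1) := by exact_mod_cast hQ
  rcases Nat.eq_zero_or_pos n with rfl | hn0
  · simp
  have h1 := d.abs_convergent_le (k + 1)
  have h2 : (q (k + 1) : ℝ) ≤ q (k + 2) := by exact_mod_cast d.q_mono (Nat.le_succ (k + 1))
  have h3 : |(q (k + 1) : ℝ) * α - p (k + 1)| * q (k + 1) ≤ 1 :=
    (mul_le_mul_of_nonneg_left h2 (abs_nonneg _)).trans h1
  obtain ⟨m, hm⟩ : ∃ m, m = (n : ℤ) * p (k + 1) % q (k + 1) := ⟨_, rfl⟩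
  obtain ⟨f, hf⟩ : ∃ f, f = (n : ℤ) * p (k + 1) / q (k + 1) := ⟨_, rfl⟩
  have hdm : (q (k + 1) : ℤ) * f + m = n * p (k + 1) := by rw [hm, hf]; exact Int.mul_ediv_add_emod _ _
  have hm0 : 0 ≤ m := hm ▸ Int.emod_nonneg _ (by omega)
  have hmlt : m < q (k + 1) := hm ▸ Int.emod_lt_of_pos _ (by omega)
  have hmne : m ≠ 0 := by
    intro h0
    have hd : (q (k + 1) : ℤ) ∣ n * p (k + 1) := Int.dvd_of_emod_eq_zero (hm ▸ h0)
    have hd' := (d.isCoprime k).symm.dvd_of_dvd_mul_right hd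
    have := Nat.le_of_dvd hn0 (by exact_mod_cast hd')
    omega
  have hdmR : (q (k + 1) : ℝ) * f + m = n * p (k + 1) := by exact_mod_cast hdm
  have hm1R : (1 : ℝ) ≤ m := by exact_mod_cast (show 1 ≤ m by omega)
  have hm2R : (m : ℝ) + 1 ≤ q (k + 1) := by exact_mod_cast (show m + 1 ≤ q (k + 1) by omega)
  have hnR : (n : ℝ) < q (k + 1) := by exact_mod_cast hn
  have hn0R : (0 : ℝ) < n := by exact_mod_cast hn0
  have herr : |(n : ℝ) * α - f - m / q (k + 1)| < 1 / q (k + 1) := by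
    have e : (n : ℝ) * α - f - m / q (k + 1) =
        n * ((q (k + 1) : ℝ) * α - p (k + 1)) / q (k + 1) := by
      field_simp
      linarith
    rw [e, abs_div, abs_mul, Nat.abs_cast, Nat.abs_cast]
    refine div_lt_div_of_pos_right ?_ hQR
    rcases (abs_nonneg ((q (k + 1) : ℝ) * α - p (k + 1))).eq_or_lt with h0 | h0
    · rw [← h0]; norm_num
    · nlinarith
  have hm3 : 1 / (q (k + 1) : ℝ) ≤ m / q (k + 1) := by gcongr
  have hm4 : (m : ℝ) / q (k + 1) + 1 / q (k + 1) ≤ 1 := by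
    rw [← add_div, div_le_one hQR]; exact hm2R
  rw [abs_lt] at herr
  have hfl : ⌊(n : ℝ) * α⌋ = f := by
    rw [Int.floor_eq_iff]
    constructor <;> linarith
  rw [Int.fract, hfl, ← hm]
  exact (abs_lt.2 herr).le

theorem ContFracData.abs_sawSum_sub_le {α : ℝ} {a q : ℕ → ℕ} {p : ℕ → ℤ}
    (d : ContFracData α a q p) (k : ℕ) {M : ℕ} (hM : M ≤ q (k + 1)) :
    |sawSum α M - centredSawSum (p (k + 1)) (q (k + 1)) M| ≤ 3 / 2 := by
  have hQR : (0 : ℝ) < q (k + 1) := by exact_mod_cast d.q_pos (k + 1)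
  have hMR : (M : ℝ) ≤ q (k + 1) := by exact_mod_cast hM
  unfold sawSum centredSawSum
  rw [← Finset.sum_sub_distrib]
  refine (Finset.abs_sum_le_sum_abs _ _).trans ?_
  calc ∑ n ∈ Finset.range M, |Int.fract ((n : ℝ) * α) - 1 / 2 - centredSaw (p (k + 1)) (q (k + 1)) n|
      ≤ ∑ n ∈ Finset.range M, (3 / 2) * (1 / (q (k + 1) : ℝ)) := by
        refine Finset.sum_le_sum fun n hn => ?_
        have h1 := d.abs_fract_sub_le k ((Finset.mem_range.1 hn).trans_le hM)
        have e : Int.fract ((n : ℝ) * α) - 1 / 2 - centredSaw (p (k + 1)) (q (k + 1)) n =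
            (Int.fract ((n : ℝ) * α) - (((n : ℤ) * p (k + 1) % q (k + 1) : ℤ) : ℝ) / q (k + 1)) -
              1 / 2 * (1 / q (k + 1)) := by
          unfold centredSaw
          field_simp
          ring
        rw [e]
        refine (abs_sub _ _).trans ?_
        rw [abs_of_pos (show 0 < 1 / 2 * (1 / (q (k + 1) : ℝ)) by positivity)]
        linarith
    _ = 3 / 2 * (M / q (k + 1)) := by
        rw [Finset.sum_const, Finset.card_range, nsmul_eq_mul]; ring
    _ ≤ 3 / 2 * 1 := by
        gcongr
        rw [div_le_one hQR]; exact hMR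
    _ = 3 / 2 := mul_one _

theorem sum_range_succ_eq_of_period {U : ℕ → ℝ} {Q : ℕ} (h : U Q = U 0) :
    ∑ M ∈ Finset.range Q, U (M + 1) = ∑ M ∈ Finset.range Q, U M := by
  have h1 := Finset.sum_range_succ' U Q
  rw [Finset.sum_range_succ, h] at h1
  linarith

/-- The shift from `M + 1` to `M` costs nothing, since the centred sums vanish at both ends of the
period. The constant `9 / 2` is twice the square of the error `3 / 2`. -/
theorem ContFracData.average_sawSum_sq_comparison {α : ℝ} {a q : ℕ → ℕ} {p : ℕ → ℤ}
    (d : ContFracData α a q p) (k : ℕ) :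
    1 / (q (k + 1) : ℝ) * ∑ M ∈ Finset.range (q (k + 1)), sawSum α (M + 1) ^ 2 ≤
      2 * (1 / (q (k + 1) : ℝ) * ∑ M ∈ Finset.range (q (k + 1)),
        centredSawSum (p (k + 1)) (q (k + 1)) M ^ 2) + 9 / 2 ∧
    1 / (q (k + 1) : ℝ) * ∑ M ∈ Finset.range (q (k + 1)),
      centredSawSum (p (k + 1)) (q (k + 1)) M ^ 2 ≤
      2 * (1 / (q (k + 1) : ℝ) * ∑ M ∈ Finset.range (q (k + 1)), sawSum α (M + 1) ^ 2) + 9 / 2 := by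
  obtain ⟨r, hr⟩ := d.exists_inverse k
  have hQ := d.q_pos (k + 1)
  have hper : centredSawSum (p (k + 1)) (q (k + 1)) (q (k + 1)) ^ 2 =
      centredSawSum (p (k + 1)) (q (k + 1)) 0 ^ 2 := by
    rw [centredSawSum_period hQ hr]; simp [centredSawSum]
  rw [← sum_range_succ_eq_of_period (U := fun M => centredSawSum (p (k + 1)) (q (k + 1)) M ^ 2) hper]
  have hdiff : ∀ M ∈ Finset.range (q (k + 1)),
      (sawSum α (M + 1) - centredSawSum (p (k + 1)) (q (k + 1)) (M + 1)) ^ 2 ≤ 9 / 4 := by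
    intro M hM
    have h1 := d.abs_sawSum_sub_le k (M := M + 1) (Finset.mem_range.1 hM)
    rw [← sq_abs]
    nlinarith [abs_nonneg (sawSum α (M + 1) - centredSawSum (p (k + 1)) (q (k + 1)) (M + 1))]
  constructor
  · have h := average_le hQ (f := fun M => sawSum α (M + 1) ^ 2 -
      2 * centredSawSum (p (k + 1)) (q (k + 1)) (M + 1) ^ 2) (c := 9 / 2) fun M hM => by
        have := hdiff M hM
        nlinarith [sq_nonneg (sawSum α (M + 1) - 2 * centredSawSum (p (k + 1)) (q (k + 1)) (M + 1))]
    rw [Finset.sum_sub_distrib, ← Finset.mul_sum, mul_sub] at h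
    linarith
  · have h := average_le hQ (f := fun M => centredSawSum (p (k + 1)) (q (k + 1)) (M + 1) ^ 2 -
      2 * sawSum α (M + 1) ^ 2) (c := 9 / 2) fun M hM => by
        have := hdiff M hM
        nlinarith [sq_nonneg (2 * sawSum α (M + 1) - centredSawSum (p (k + 1)) (q (k + 1)) (M + 1))]
    rw [Finset.sum_sub_distrib, ← Finset.mul_sum, mul_sub] at h
    linarith

/-- Squared mean plus variance: the mean is the Dedekind sum, and the variance is bounded through
the separation of multiples of the convergent itself. -/
theorem exists_average_sawSum_sq_le : ∃ C : ℝ, 0 < C ∧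
    ∀ (α : ℝ) (a q : ℕ → ℕ) (p : ℕ → ℤ), ContFracData α a q p → ∀ k : ℕ,
    1 / (q (k + 1) : ℝ) * ∑ M ∈ Finset.range (q (k + 1)), sawSum α (M + 1) ^ 2 ≤
      C * (dedekindSum (p (k + 1)) (q (k + 1)) ^ 2 +
        ∑ j ∈ Finset.Icc 1 (k + 1), (a j : ℝ) ^ 2 + 1) := by
  obtain ⟨C, hC, hmain⟩ := exists_sum_main_range_le
  refine ⟨2 * C + 10, by positivity, ?_⟩
  intro α a q p d k
  obtain ⟨r, hr⟩ := d.exists_inverse k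
  have hQ := d.q_pos (k + 1)
  have hQR : (1 : ℝ) ≤ q (k + 1) := by exact_mod_cast hQ
  have h1 := (d.average_sawSum_sq_comparison k).1
  have h2 := sum_sq_centredSawSum_le hQ hr
  rw [average_centredSawSum hQ hr] at h2
  have h3 := hmain α a q p d ((p (k + 1) : ℝ) / q (k + 1)) (k + 1)
    (fun i => 1 / ((i : ℝ) * ((p (k + 1) : ℝ) / q (k + 1)) -
      round ((i : ℝ) * ((p (k + 1) : ℝ) / q (k + 1)))) ^ 2)
    (fun j hj => d.wellSeparated_convergent (by omega)) (fun _ _ => by positivity)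
    (fun _ _ => by rw [one_div]; exact inv_mul_le_one)
  have h4 : |((q (k + 1) : ℝ) - 1) / (4 * q (k + 1))| ≤ 1 / 4 := by
    rw [abs_of_nonneg (div_nonneg (by linarith) (by positivity)), div_le_iff₀ (by positivity)]
    linarith
  have h5 : (((q (k + 1) : ℝ) - 1) / (4 * q (k + 1))) ^ 2 ≤ 1 / 16 := by
    rw [← sq_abs]
    nlinarith [abs_nonneg (((q (k + 1) : ℝ) - 1) / (4 * q (k + 1)))]
  have hA : 0 ≤ ∑ j ∈ Finset.Icc 1 (k + 1), (a j : ℝ) ^ 2 := Finset.sum_nonneg fun _ _ => sq_nonneg _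
  nlinarith [sq_nonneg (dedekindSum (p (k + 1)) (q (k + 1)) -
    ((q (k + 1) : ℝ) - 1) / (4 * q (k + 1))), sq_nonneg (dedekindSum (p (k + 1)) (q (k + 1)))]

/-- By Cauchy–Schwarz the squared mean is at most the mean square. -/
theorem ContFracData.dedekindSum_sq_le {α : ℝ} {a q : ℕ → ℕ} {p : ℕ → ℤ}
    (d : ContFracData α a q p) (k : ℕ) :
    dedekindSum (p (k + 1)) (q (k + 1)) ^ 2 ≤
      4 * (1 / (q (k + 1) : ℝ) * ∑ M ∈ Finset.range (q (k + 1)), sawSum α (M + 1) ^ 2) + 10 := by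
  obtain ⟨r, hr⟩ := d.exists_inverse k
  have hQ := d.q_pos (k + 1)
  have hQR : (1 : ℝ) ≤ q (k + 1) := by exact_mod_cast hQ
  have h1 := (d.average_sawSum_sq_comparison k).2
  have h2 := sq_sum_le_card_mul_sum_sq (s := Finset.range (q (k + 1)))
    (f := fun M => centredSawSum (p (k + 1)) (q (k + 1)) M)
  rw [Finset.card_range] at h2
  have h3 : (1 / (q (k + 1) : ℝ) * ∑ M ∈ Finset.range (q (k + 1)),
      centredSawSum (p (k + 1)) (q (k + 1)) M) ^ 2 ≤
      1 / (q (k + 1) : ℝ) * ∑ M ∈ Finset.range (q (k + 1)),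
        centredSawSum (p (k + 1)) (q (k + 1)) M ^ 2 := by
    rw [mul_pow]
    calc _ ≤ (1 / (q (k + 1) : ℝ)) ^ 2 * (q (k + 1) * ∑ M ∈ Finset.range (q (k + 1)),
          centredSawSum (p (k + 1)) (q (k + 1)) M ^ 2) := by gcongr
      _ = _ := by field_simp
  rw [average_centredSawSum hQ hr] at h3
  have h4 : |((q (k + 1) : ℝ) - 1) / (4 * q (k + 1))| ≤ 1 / 4 := by
    rw [abs_of_nonneg (div_nonneg (by linarith) (by positivity)), div_le_iff₀ (by positivity)]
    linarith
  have h5 : (((q (k + 1) : ℝ) - 1) / (4 * q (k + 1))) ^ 2 ≤ 1 / 16 := by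
    rw [← sq_abs]
    nlinarith [abs_nonneg (((q (k + 1) : ℝ) - 1) / (4 * q (k + 1)))]
  nlinarith [sq_nonneg (dedekindSum (p (k + 1)) (q (k + 1)) +
    2 * (((q (k + 1) : ℝ) - 1) / (4 * q (k + 1))))]

/-! ### Asymptotic form of the estimates and the final equivalences. -/

theorem isBigO_sqrt_iff {ι : Type*} {l : Filter ι} {f g : ι → ℝ} (hg : ∀ᶠ x in l, 0 ≤ g x) :
    f =O[l] (fun x => Real.sqrt (g x)) ↔ ∃ C, 0 ≤ C ∧ ∀ᶠ x in l, f x ^ 2 ≤ C * g x := by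
  constructor
  · intro h
    obtain ⟨c, hc, h⟩ := h.exists_nonneg
    refine ⟨c ^ 2, sq_nonneg c, ?_⟩
    filter_upwards [hg, h.bound] with x hx hb
    rw [Real.norm_eq_abs, Real.norm_of_nonneg (Real.sqrt_nonneg _)] at hb
    calc f x ^ 2 = |f x| ^ 2 := (sq_abs _).symm
      _ ≤ (c * Real.sqrt (g x)) ^ 2 := by gcongr
      _ = c ^ 2 * g x := by rw [mul_pow, Real.sq_sqrt hx]
  · rintro ⟨C, hC, h⟩
    refine IsBigO.of_bound (Real.sqrt C) ?_
    filter_upwards [hg, h] with x hx hb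
    rw [Real.norm_eq_abs, Real.norm_of_nonneg (Real.sqrt_nonneg _), ← Real.sqrt_mul hC]
    exact Real.abs_le_sqrt hb

theorem isBigO_average_iff {A : ℕ → ℝ} (hA : ∀ K, 0 ≤ A K) :
    (fun K : ℕ => 1 / (K : ℝ) * A K) =O[atTop] (fun _ : ℕ => (1 : ℝ)) ↔
      ∃ C, 0 ≤ C ∧ ∀ᶠ K : ℕ in atTop, A K ≤ C * K := by
  constructor
  · intro h
    obtain ⟨c, hc, h⟩ := h.exists_nonneg
    refine ⟨c, hc, ?_⟩
    filter_upwards [eventually_gt_atTop 0, h.bound] with K hK hb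
    have hKR : (0 : ℝ) < K := by exact_mod_cast hK
    rw [norm_one, mul_one, Real.norm_of_nonneg (mul_nonneg (by positivity) (hA K)), one_div,
      inv_mul_le_iff₀ hKR] at hb
    linarith
  · rintro ⟨C, hC, h⟩
    refine IsBigO.of_bound C ?_
    filter_upwards [eventually_gt_atTop 0, h] with K hK hb
    have hKR : (0 : ℝ) < K := by exact_mod_cast hK
    rw [norm_one, mul_one, Real.norm_of_nonneg (mul_nonneg (by positivity) (hA K)), one_div,
      inv_mul_le_iff₀ hKR]
    linarith

theorem isBigO_abs_div_sqrt_iff {B : ℕ → ℝ} :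
    (fun K : ℕ => 1 / Real.sqrt (K : ℝ) * |B K|) =O[atTop] (fun _ : ℕ => (1 : ℝ)) ↔
      ∃ C, 0 ≤ C ∧ ∀ᶠ K : ℕ in atTop, B K ^ 2 ≤ C * K := by
  constructor
  · intro h
    obtain ⟨c, hc, h⟩ := h.exists_nonneg
    refine ⟨c ^ 2, sq_nonneg c, ?_⟩
    filter_upwards [eventually_gt_atTop 0, h.bound] with K hK hb
    have hKR : (0 : ℝ) < K := by exact_mod_cast hK
    have hs := Real.sqrt_pos.2 hKR
    rw [norm_one, mul_one, Real.norm_of_nonneg (by positivity), one_div,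
      inv_mul_le_iff₀ hs] at hb
    calc B K ^ 2 = |B K| ^ 2 := (sq_abs _).symm
      _ ≤ (Real.sqrt K * c) ^ 2 := by gcongr
      _ = c ^ 2 * K := by rw [mul_pow, Real.sq_sqrt hKR.le]; ring
  · rintro ⟨C, hC, h⟩
    refine IsBigO.of_bound (Real.sqrt C) ?_
    filter_upwards [eventually_gt_atTop 0, h] with K hK hb
    have hKR : (0 : ℝ) < K := by exact_mod_cast hK
    have hs := Real.sqrt_pos.2 hKR
    rw [norm_one, mul_one, Real.norm_of_nonneg (by positivity), one_div,
      inv_mul_le_iff₀ hs, mul_comm, ← Real.sqrt_mul hC]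
    exact Real.abs_le_sqrt hb

namespace ContFracData

variable {α : ℝ} {a q : ℕ → ℕ} {p : ℕ → ℤ}

theorem log_q_le_sum_sq (d : ContFracData α a q p) (K : ℕ) :
    Real.log (q K) ≤ ∑ k ∈ Finset.Icc 1 K, (a k : ℝ) ^ 2 := by
  refine (d.log_q_le K).trans (Finset.sum_le_sum fun k _ => ?_)
  have : a k ≤ a k ^ 2 := Nat.le_self_pow (by norm_num) _
  exact_mod_cast this

theorem log_q_nonneg (d : ContFracData α a q p) (K : ℕ) : 0 ≤ Real.log (q K) :=
  Real.log_nonneg (by exact_mod_cast d.q_pos K)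

/-- If the quadratic mean of the partial quotients is controlled by `log q_K`, then it is
bounded, since `log q_K` is at most the sum of the partial quotients. -/
theorem sum_sq_le_of_le_log (d : ContFracData α a q p) {C : ℝ} (hC : 0 ≤ C) {K : ℕ}
    (h : ∑ k ∈ Finset.Icc 1 K, (a k : ℝ) ^ 2 ≤ C * (Real.log (q K) + 1)) :
    ∑ k ∈ Finset.Icc 1 K, (a k : ℝ) ^ 2 ≤ C ^ 2 * K + 2 * C := by
  have h1 := mul_le_mul_of_nonneg_left (d.log_q_le K) hC
  -- From `C a ≤ a² / 2 + C² / 2`; half of the sum of squares is then absorbed on the left.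
  have h2 : C * ∑ k ∈ Finset.Icc 1 K, (a k : ℝ) ≤
      1 / 2 * ∑ k ∈ Finset.Icc 1 K, (a k : ℝ) ^ 2 + K * (C ^ 2 / 2) := by
    have h3 : ∑ _k ∈ Finset.Icc 1 K, C ^ 2 / 2 = K * (C ^ 2 / 2) := by simp
    rw [← h3, Finset.mul_sum, Finset.mul_sum, ← Finset.sum_add_distrib]
    refine Finset.sum_le_sum fun k _ => ?_
    nlinarith [sq_nonneg ((a k : ℝ) - C)]
  linarith

theorem sum_sq_le_add (a : ℕ → ℕ) (K : ℕ) : ∑ k ∈ Finset.Icc 1 K, (a k : ℝ) ^ 2 ≤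
    ∑ k ∈ Finset.Icc 1 3, (a k : ℝ) ^ 2 + ∑ k ∈ Finset.Ico 3 K, (a (k + 1) : ℝ) ^ 2 := by
  rcases le_total K 3 with h | h
  · rw [Finset.Ico_eq_empty (by omega), Finset.sum_empty, add_zero]
    exact Finset.sum_le_sum_of_subset_of_nonneg (Finset.Icc_subset_Icc_right h)
      fun _ _ _ => sq_nonneg _
  · induction K, h using Nat.le_induction with
    | base => simp
    | succ K hK ih =>
      rw [Finset.sum_Icc_succ_top (by omega), Finset.sum_Ico_succ_top hK]
      linarith

/-- Used with `D` the discrepancy of `S` or of `L` at `q K`. The lower bounds miss `a 1`, `a 2`, `a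
3`, whose squares go into the constant, which may depend on `α`. -/
theorem exists_sum_sq_le_mul (d : ContFracData α a q p) {D : ℕ → ℝ} {C : ℝ} (hC : 0 < C)
    (hD : ∀ K, ∑ k ∈ Finset.Ico 3 K, (a (k + 1) : ℝ) ^ 2 ≤ C * (D K ^ 2 + 1))
    (h : ∃ C', 0 ≤ C' ∧ ∀ᶠ K in atTop, D K ^ 2 ≤ C' * Real.log (q K)) :
    ∃ C', 0 ≤ C' ∧ ∀ᶠ K : ℕ in atTop, ∑ k ∈ Finset.Icc 1 K, (a k : ℝ) ^ 2 ≤ C' * K := by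
  obtain ⟨C', hC', h⟩ := h
  set A3 := ∑ k ∈ Finset.Icc 1 3, (a k : ℝ) ^ 2 with hA3
  have hA30 : 0 ≤ A3 := Finset.sum_nonneg fun _ _ => sq_nonneg _
  set E := A3 + C * (C' + 1) with hE
  have hE0 : 0 ≤ E := by positivity
  refine ⟨E ^ 2 + 2 * E, by positivity, ?_⟩
  filter_upwards [h, eventually_ge_atTop 1] with K hK hK1
  have hl := d.log_q_nonneg K
  have h1 : ∑ k ∈ Finset.Icc 1 K, (a k : ℝ) ^ 2 ≤ E * (Real.log (q K) + 1) := by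
    have h2 := sum_sq_le_add a K
    have h3 := hD K
    have h4 : C * (D K ^ 2 + 1) ≤ C * (C' * Real.log (q K) + 1) := by gcongr
    have h5 : C * (C' * Real.log (q K) + 1) ≤ C * ((C' + 1) * (Real.log (q K) + 1)) := by
      gcongr
      nlinarith
    have h6 : 0 ≤ A3 * Real.log (q K) := by positivity
    rw [hE]
    linarith
  have h2 := d.sum_sq_le_of_le_log hE0 h1
  have hKR : (1 : ℝ) ≤ K := by exact_mod_cast hK1
  nlinarith

theorem le_log_mul (d : ContFracData α a q p) {K : ℕ} (hK : 2 ≤ K) :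
    (K : ℝ) ≤ 4 / Real.log 2 * Real.log (q K) := by
  have h2 : 0 < Real.log 2 := Real.log_pos (by norm_num)
  have h := d.mul_log_two_le K
  have hKR : (2 : ℝ) ≤ K := by exact_mod_cast hK
  rw [div_mul_eq_mul_div, le_div_iff₀ h2]
  nlinarith

theorem tendsto_q (d : ContFracData α a q p) : Tendsto q atTop atTop :=
  tendsto_atTop_mono d.self_le_q tendsto_id

theorem exists_q_le_lt (d : ContFracData α a q p) {N : ℕ} (hN : 0 < N) :
    ∃ K, q K ≤ N ∧ N < q (K + 1) := by
  have hex : ∃ K, N < q K := ⟨N + 1, d.self_le_q (N + 1)⟩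
  classical
  have h0 : Nat.find hex ≠ 0 := by
    intro h
    have := Nat.find_spec hex
    rw [h, d.q_zero] at this
    omega
  obtain ⟨K, hK⟩ := Nat.exists_eq_succ_of_ne_zero h0
  refine ⟨K, not_lt.1 (Nat.find_min hex (by omega)), ?_⟩
  have := Nat.find_spec hex
  rwa [hK] at this

/-- For `q_K ≤ N < q_{K+1}` the upper bound at level `K + 1` applies, and `K + 1 ≪ log q_K + 1 ≪ log
N`. -/
theorem exists_D₂_S_sq_le_log (d : ContFracData α a q p) (hα : Irrational α)
    (h : ∃ C, 0 ≤ C ∧ ∀ᶠ K : ℕ in atTop, ∑ k ∈ Finset.Icc 1 K, (a k : ℝ) ^ 2 ≤ C * K) :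
    ∃ C, 0 ≤ C ∧ ∀ᶠ N : ℕ in atTop, D₂ (S α N) ^ 2 ≤ C * Real.log N := by
  obtain ⟨C, hC, h⟩ := h
  obtain ⟨K₀, hK₀⟩ := eventually_atTop.1 h
  obtain ⟨C₁, hC₁, h₁⟩ := exists_D₂_S_sq_le
  have h2 : 0 < Real.log 2 := Real.log_pos (by norm_num)
  refine ⟨C₁ * (C * (2 / Real.log 2 + 2) + 1), by positivity, ?_⟩
  filter_upwards [eventually_ge_atTop 3, eventually_ge_atTop (q K₀)] with N hN3 hNK
  obtain ⟨K, hK1, hK2⟩ := d.exists_q_le_lt (show 0 < N by omega)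
  have hK : K₀ ≤ K + 1 := by
    by_contra hcon
    have := d.q_mono (show K + 1 ≤ K₀ by omega)
    omega
  have h3 := h₁ α a q p hα d (K + 1) N (by omega) hK2.le
  have h4 := hK₀ (K + 1) hK
  have h5 := d.mul_log_two_le K
  have hNR : (3 : ℝ) ≤ N := by exact_mod_cast hN3
  have hl : 1 ≤ Real.log N := by
    rw [Real.le_log_iff_exp_le (by linarith)]
    exact Real.exp_one_lt_three.le.trans hNR
  have hqN : Real.log (q K) ≤ Real.log N :=
    Real.log_le_log (by exact_mod_cast d.q_pos K) (by exact_mod_cast hK1)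
  have h6 : (K : ℝ) + 1 ≤ (2 / Real.log 2 + 2) * Real.log N := by
    have h7 : (K : ℝ) ≤ 2 / Real.log 2 * Real.log N + 1 := by
      rw [div_mul_eq_mul_div, ← sub_le_iff_le_add, le_div_iff₀ h2]
      linarith
    linarith
  push_cast at h4
  calc D₂ (S α N) ^ 2 ≤ C₁ * (∑ k ∈ Finset.Icc 1 (K + 1), (a k : ℝ) ^ 2 + 1) := h3
    _ ≤ C₁ * (C * ((2 / Real.log 2 + 2) * Real.log N) + Real.log N) := by
        gcongr
        exact h4.trans (by gcongr)
    _ = _ := by ring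

/-- The alternating sum is a Dedekind sum up to a bounded error, hence controlled by the mean square
of `sawSum`, hence by `D₂ (L α (q K)) ^ 2 ≪ log q_K ≤ ∑ a_k² ≪ K`. -/
theorem exists_alternating_sq_le (d : ContFracData α a q p)
    (hsq : ∃ C, 0 ≤ C ∧ ∀ᶠ K : ℕ in atTop, ∑ k ∈ Finset.Icc 1 K, (a k : ℝ) ^ 2 ≤ C * K)
    (h : ∃ C, 0 ≤ C ∧ ∀ᶠ K in atTop, D₂ (L α (q K)) ^ 2 ≤ C * Real.log (q K)) :
    ∃ C, 0 ≤ C ∧ ∀ᶠ K : ℕ in atTop,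
      (∑ k ∈ Finset.Icc 1 K, (-1 : ℝ) ^ k * (a k : ℝ)) ^ 2 ≤ C * K := by
  obtain ⟨C, hC, hsq⟩ := hsq
  obtain ⟨C', hC', h⟩ := h
  obtain ⟨B, hB⟩ := d.exists_abs_dedekindSum_le
  -- `288 = 2 * 12 ^ 2`, and `8` and `18` come from `s ^ 2 ≤ 4 * (2 * D₂ ^ 2 + 2) + 10`.
  refine ⟨288 * (8 * (C' * C) + 18) + 2 * B ^ 2, by positivity, ?_⟩
  filter_upwards [hsq, h, eventually_ge_atTop 1] with K hA hD hK
  obtain ⟨k, rfl⟩ := Nat.exists_eq_add_of_le' hK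
  have hKR : (1 : ℝ) ≤ (k + 1 : ℕ) := by exact_mod_cast hK
  have h1 := hB k
  have h2 := d.dedekindSum_sq_le k
  have h3 := average_sawSum_sq_le α (d.q_pos (k + 1))
  have h4 := d.log_q_le_sum_sq (k + 1)
  generalize dedekindSum (p (k + 1)) (q (k + 1)) = s at *
  generalize ∑ j ∈ Finset.Icc 1 (k + 1), (-1 : ℝ) ^ j * (a j : ℝ) = T at *
  have h5 : (12 * s + T) ^ 2 ≤ B ^ 2 := by
    rw [← sq_abs]; gcongr
  have h6 : T ^ 2 ≤ 288 * s ^ 2 + 2 * B ^ 2 := by nlinarith [sq_nonneg (T + 24 * s)]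
  have h7 : D₂ (L α (q (k + 1))) ^ 2 ≤ C' * C * (k + 1 : ℕ) := by
    rw [mul_assoc]
    exact hD.trans (mul_le_mul_of_nonneg_left (h4.trans hA) hC')
  have h8 : s ^ 2 ≤ (8 * (C' * C) + 18) * (k + 1 : ℕ) := by nlinarith
  nlinarith [sq_nonneg B]

theorem exists_D₂_L_sq_le_log (d : ContFracData α a q p)
    (hsq : ∃ C, 0 ≤ C ∧ ∀ᶠ K : ℕ in atTop, ∑ k ∈ Finset.Icc 1 K, (a k : ℝ) ^ 2 ≤ C * K)
    (halt : ∃ C, 0 ≤ C ∧ ∀ᶠ K : ℕ in atTop,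
      (∑ k ∈ Finset.Icc 1 K, (-1 : ℝ) ^ k * (a k : ℝ)) ^ 2 ≤ C * K) :
    ∃ C, 0 ≤ C ∧ ∀ᶠ K in atTop, D₂ (L α (q K)) ^ 2 ≤ C * Real.log (q K) := by
  obtain ⟨C, hC, hsq⟩ := hsq
  obtain ⟨C', hC', halt⟩ := halt
  obtain ⟨B, hB⟩ := d.exists_abs_dedekindSum_le
  obtain ⟨C₁, hC₁, h₁⟩ := exists_D₂_L_sq_le
  obtain ⟨C₂, hC₂, h₂⟩ := exists_average_sawSum_sq_le
  have hlog : 0 < Real.log 2 := Real.log_pos (by norm_num)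
  refine ⟨(C₁ * (C + 1) + 2 * (C₂ * (C' + B ^ 2 + C + 1))) * (4 / Real.log 2), by positivity, ?_⟩
  filter_upwards [hsq, halt, eventually_ge_atTop 2] with K hA hT hK
  obtain ⟨k, rfl⟩ := Nat.exists_eq_add_of_le' (show 1 ≤ K by omega)
  have hKR : (1 : ℝ) ≤ (k + 1 : ℕ) := by exact_mod_cast (show 1 ≤ k + 1 by omega)
  have h1 := hB k
  have h3 := h₁ α a q p d (k + 1) (q (k + 1)) (d.q_pos (k + 1)) le_rfl
  have h4 := h₂ α a q p d k
  have h5 := d.le_log_mul hK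
  generalize dedekindSum (p (k + 1)) (q (k + 1)) = s at *
  generalize ∑ j ∈ Finset.Icc 1 (k + 1), (-1 : ℝ) ^ j * (a j : ℝ) = T at *
  have h6 : (12 * s + T) ^ 2 ≤ B ^ 2 := by
    rw [← sq_abs]; gcongr
  have h7 : s ^ 2 ≤ T ^ 2 + B ^ 2 := by nlinarith [sq_nonneg (12 * s + 2 * T), sq_nonneg s]
  have h8 : s ^ 2 ≤ (C' + B ^ 2) * (k + 1 : ℕ) := by nlinarith [sq_nonneg B]
  calc D₂ (L α (q (k + 1))) ^ 2
      ≤ C₁ * (∑ j ∈ Finset.Icc 1 (k + 1), (a j : ℝ) ^ 2 + 1) + 2 * (C₂ * (s ^ 2 +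
          ∑ j ∈ Finset.Icc 1 (k + 1), (a j : ℝ) ^ 2 + 1)) := by linarith
    _ ≤ C₁ * (C * (k + 1 : ℕ) + (k + 1 : ℕ)) + 2 * (C₂ * ((C' + B ^ 2) * (k + 1 : ℕ) +
          C * (k + 1 : ℕ) + (k + 1 : ℕ))) := by gcongr
    _ = (C₁ * (C + 1) + 2 * (C₂ * (C' + B ^ 2 + C + 1))) * (k + 1 : ℕ) := by ring
    _ ≤ (C₁ * (C + 1) + 2 * (C₂ * (C' + B ^ 2 + C + 1))) *
          (4 / Real.log 2 * Real.log (q (k + 1))) := by gcongr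
    _ = _ := by ring

end ContFracData

end LatticeDiscrepancy

theorem theorem1 (α : ℝ) (hα : Irrational α) :
    (((fun N : ℕ => LatticeDiscrepancy.D₂ (LatticeDiscrepancy.S α N))
          =O[atTop] (fun N : ℕ => Real.sqrt (Real.log (N : ℝ)))) ↔
      ((fun K : ℕ => LatticeDiscrepancy.D₂
            (LatticeDiscrepancy.S α (LatticeDiscrepancy.convergentDen α K)))
          =O[atTop] (fun K : ℕ =>
            Real.sqrt (Real.log (LatticeDiscrepancy.convergentDen α K : ℝ))))) ∧
    (((fun K : ℕ => LatticeDiscrepancy.D₂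
            (LatticeDiscrepancy.S α (LatticeDiscrepancy.convergentDen α K)))
          =O[atTop] (fun K : ℕ =>
            Real.sqrt (Real.log (LatticeDiscrepancy.convergentDen α K : ℝ)))) ↔
      ((fun K : ℕ => 1 / (K : ℝ) *
            ∑ k ∈ Finset.Icc 1 K, LatticeDiscrepancy.partialQuotient α k ^ 2)
          =O[atTop] (fun _ : ℕ => (1 : ℝ)))) ∧
    (((fun K : ℕ => LatticeDiscrepancy.D₂
            (LatticeDiscrepancy.L α (LatticeDiscrepancy.convergentDen α K)))
          =O[atTop] (fun K : ℕ =>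
            Real.sqrt (Real.log (LatticeDiscrepancy.convergentDen α K : ℝ)))) ↔
      (((fun K : ℕ => 1 / (K : ℝ) *
            ∑ k ∈ Finset.Icc 1 K, LatticeDiscrepancy.partialQuotient α k ^ 2)
          =O[atTop] (fun _ : ℕ => (1 : ℝ))) ∧
       ((fun K : ℕ => 1 / Real.sqrt (K : ℝ) *
            |∑ k ∈ Finset.Icc 1 K, (-1 : ℝ) ^ k * LatticeDiscrepancy.partialQuotient α k|)
          =O[atTop] (fun _ : ℕ => (1 : ℝ))))) := by
  obtain ⟨a, p, d, ha⟩ := LatticeDiscrepancy.exists_contFracData hα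
  have hpq : ∀ k ∈ Set.Ici 1, LatticeDiscrepancy.partialQuotient α k = a k := by
    intro k hk
    obtain ⟨k, rfl⟩ := Nat.exists_eq_add_of_le' (Set.mem_Ici.1 hk)
    exact ha k
  have hsq : ∀ K : ℕ, ∑ k ∈ Finset.Icc 1 K, LatticeDiscrepancy.partialQuotient α k ^ 2 =
      ∑ k ∈ Finset.Icc 1 K, (a k : ℝ) ^ 2 := fun K =>
    Finset.sum_congr rfl fun k hk => by rw [hpq k (Finset.mem_Icc.1 hk).1]
  have halt : ∀ K : ℕ, ∑ k ∈ Finset.Icc 1 K, (-1 : ℝ) ^ k * LatticeDiscrepancy.partialQuotient α k =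
      ∑ k ∈ Finset.Icc 1 K, (-1 : ℝ) ^ k * (a k : ℝ) := fun K =>
    Finset.sum_congr rfl fun k hk => by rw [hpq k (Finset.mem_Icc.1 hk).1]
  simp_rw [hsq, halt]
  rw [LatticeDiscrepancy.isBigO_average_iff fun K => Finset.sum_nonneg fun _ _ => sq_nonneg _,
    LatticeDiscrepancy.isBigO_abs_div_sqrt_iff,
    LatticeDiscrepancy.isBigO_sqrt_iff (Eventually.of_forall fun N => Real.log_natCast_nonneg N),
    LatticeDiscrepancy.isBigO_sqrt_iff (Eventually.of_forall d.log_q_nonneg),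
    LatticeDiscrepancy.isBigO_sqrt_iff (Eventually.of_forall d.log_q_nonneg)]
  obtain ⟨C₁, hC₁, h₁⟩ := LatticeDiscrepancy.exists_sum_sq_le_D₂_S
  obtain ⟨C₂, hC₂, h₂⟩ := LatticeDiscrepancy.exists_sum_sq_le_D₂_L
  have hS : (∃ C, 0 ≤ C ∧ ∀ᶠ K in atTop, LatticeDiscrepancy.D₂ (LatticeDiscrepancy.S α
      (LatticeDiscrepancy.convergentDen α K)) ^ 2 ≤
        C * Real.log (LatticeDiscrepancy.convergentDen α K)) →
      ∃ C, 0 ≤ C ∧ ∀ᶠ K : ℕ in atTop, ∑ k ∈ Finset.Icc 1 K, (a k : ℝ) ^ 2 ≤ C * K :=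
    d.exists_sum_sq_le_mul hC₁ (h₁ α a _ p hα d)
  have hL := d.exists_sum_sq_le_mul hC₂ (h₂ α a _ p d)
  have hsub : (∃ C, 0 ≤ C ∧ ∀ᶠ N : ℕ in atTop, LatticeDiscrepancy.D₂ (LatticeDiscrepancy.S α N) ^ 2 ≤
      C * Real.log N) → ∃ C, 0 ≤ C ∧ ∀ᶠ K in atTop, LatticeDiscrepancy.D₂ (LatticeDiscrepancy.S α
      (LatticeDiscrepancy.convergentDen α K)) ^ 2 ≤
        C * Real.log (LatticeDiscrepancy.convergentDen α K) := fun ⟨C, hC, h⟩ =>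
    ⟨C, hC, d.tendsto_q.eventually h⟩
  have hup := d.exists_D₂_S_sq_le_log hα
  -- For `S` the cycle is: all `N` to the subsequence `q K`, then to bounded quadratic means, then
  -- back to all `N`.
  exact ⟨⟨hsub, fun h => hup (hS h)⟩, ⟨hS, fun h => hsub (hup h)⟩,
    ⟨fun h => ⟨hL h, d.exists_alternating_sq_le (hL h) h⟩,
      fun h => d.exists_D₂_L_sq_le_log h.1 h.2⟩⟩
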